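/- **Theorem 5.5 (Full cubic $C^n$).** Let $\mathbb K$ be a good topological ring, i.e. a commutative topological ring with unit whose group of units $\mathbb K^\times$ is dense in $\mathbb K$. Let $n\ge 0$, and write $\mathsf n=\{1,\dots,n\}$. *Conventions.* A topological $\mathbb K$-module is a $\mathbb K$-module with a topology for which addition, negation and scalar multiplication are continuous. For a subset $U$ of a $\mathbb K$-module $V$ put $U^{[1]}=\{(x,v,t)\in V\times V\times\mathbb K : x\in U,\ x+tv\in U\}$. If $U$ is open in a topological $\mathbb K$-module $V$ and $W$ is a topological $\mathbb K$-module, a map $f:U\to W$ is of class $C^0_{\mathbb K}$ if it is continuous, and of class $C^{k+1}_{\mathbb K}$ if there is a continuous map $f^{[1]}:U^{[1]}\to W$ of class $C^k_{\mathbb K}$ with $f^{[1]}(x,v,t)=t^{-1}(f(x+tv)-f(x))$ for all $(x,v,t)\in U^{[1]}$ with $t\in\mathbb K^\times$. A (small, strict) $n$-fold groupoid $G$ is a family of sets $(G^A)_{A\subseteq\mathsf n}$ together with, for all $A$ and $i\in A$, a groupoid structure with set of morphisms $G^A$ and set of objects $G^{A\setminus\{i\}}$, such that for all $A$ and $i\neq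 j$ in $A$ the four groupoids on $G^A,G^{A\setminus\{i\}},G^{A\setminus\{j\}},G^{A\setminus\{i,j\}}$ form a double groupoid. A morphism is a family of maps, one for each $A$, that are functors for all these groupoids. For a subset $U$ of a $\mathbb K$-module $V$, the groupoid $U^{\{1\}}$ has morphisms $U^{[1]}$ and objects $U\times\mathbb K$; the source of $(x,v,t)$ is $(x,t)$, its target is $(x+tv,t)$, the unit at $(x,t)$ is $(x,0,t)$, the product is $(x+tv,v',t)*(x,v,t)=(x,v'+v,t)$, and the inverse of $(x,v,t)$ is $(x+tv,-v,t)$. The $n$-fold groupoid $U^{\mathsf n}$ is obtained by iterating this construction: $U^{\emptyset;0}=U$, and for $A\subseteq\{1,\dots,n\}$ $$U^{A;\mathsf{n+1}}=U^{A;\mathsf n}\times\mathbb K,\qquad U^{A\cup\{n+1\};\mathsf{n+1}}=(U^{A;\mathsf n})^{[1]}.$$ In direction $n+1$ the structure maps are those just given, with $U^{A;\mathsf n}$ in place of $U$. A structure map $p$ of $U^{\mathsf n}$ (in one of the directions $1,\dots,n$) gives the structure maps $p\times\mathrm{id}_{\mathbb K}$ and $(y,w,t)\mapsto(p(y),p^{[1]}(y,w,t),t)$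 of $U^{\mathsf{n+1}}$, where $p^{[1]}$ is the canonical polynomial map with $t\,p^{[1]}(y,w,t)=p(y+tw)-p(y)$, i.e. with $p(y+\varepsilon w)=p(y)+\varepsilon\,p^{[1]}(y,w,t)$ after extending scalars from $\mathbb K$ to $\mathbb K[\varepsilon]/(\varepsilon^2-t\varepsilon)$. Each $U^{A;\mathsf n}$ is a subset of a product of copies of $V$ and $\mathbb K$, and carries the induced topology if $V$ is a topological module. The finite part $U^{\mathsf n}_{\rm fin}\subseteq U^{\mathsf n}$ is obtained by the same iteration, requiring in each step that the new scalar $t$ be invertible. A map $f:U\to W$ induces $f^{\mathsf n}_{\rm fin}:U^{\mathsf n}_{\rm fin}\to W^{\mathsf n}_{\rm fin}$ by iterating $n$ times $f\mapsto f\times\mathrm{id}$ on objects and $f\mapsto\big((x,v,t)\mapsto(f(x),t^{-1}(f(x+tv)-f(x)),t)\big)$ on morphisms. **(A)** Let $V,W$ be topological $\mathbb K$-modules, $W$ Hausdorff, $U\subseteq V$ open and $f:U\to W$ a map. Then the following are equivalent: 1. $f$ is of class $C^n_{\mathbb K}$; 2. $f^{\mathsf n}_{\rm fin}$ extends to a continuous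 morphism of $n$-fold groupoids $f^{\mathsf n}:U^{\mathsf n}\to W^{\mathsf n}$ (continuous meaning that all vertex maps $U^{A;\mathsf n}\to W^{A;\mathsf n}$ are continuous). **(B)** Let $M$ be a Hausdorff manifold of class $C^n_{\mathbb K}$ modelled on a topological $\mathbb K$-module $V$, given by an atlas $\mathcal A$ of charts $\varphi:M\supseteq D_\varphi\to U_\varphi\subseteq V$ (homeomorphisms between open sets, with domains covering $M$) whose transition maps are of class $C^n_{\mathbb K}$. Then there are an $n$-fold groupoid $M^{\mathsf n}$ (the $n$-fold tangent groupoid of $M$), with $M^{\emptyset;\mathsf n}=M\times\mathbb K^n$, and, for every $\varphi\in\mathcal A$, a morphism of $n$-fold groupoids $\iota_\varphi:U_\varphi^{\mathsf n}\to M^{\mathsf n}$, such that - $\iota_\varphi$ is injective on all vertex sets, and on $U_\varphi^{\emptyset;\mathsf n}=U_\varphi\times\mathbb K^n$ it is $\varphi^{-1}\times\mathrm{id}$; - for all $\varphi,\psi\in\mathcal A$ with transition map $\tau=\psi\circ\varphi^{-1}$ defined on $U_{\varphi\psi}=\varphi(D_\varphi\cap D_\psi)$, the morphism $\tau^{\mathsf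 n}_{\rm fin}$ extends to a continuous morphism $\tau^{\mathsf n}:U_{\varphi\psi}^{\mathsf n}\to U_\psi^{\mathsf n}$ with $\iota_\varphi=\iota_\psi\circ\tau^{\mathsf n}$ on $U_{\varphi\psi}^{\mathsf n}$; - $M^{\mathsf n}$ is generated by the images of the $\iota_\varphi$: no smaller family of subsets that contains all the images is closed under all structure maps; - if $\varphi\in\mathcal A$ has domain $D_\varphi=M$ (so that $M$ is identified with the open set $U_\varphi$ of $V$), then $\iota_\varphi:U_\varphi^{\mathsf n}\to M^{\mathsf n}$ is an isomorphism. -/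

import Mathlib

open Set Topology

set_option linter.unusedVariables false
set_option linter.unusedSectionVars false

universe u

namespace FullCubic

/-! ### Hypercubes -/

/-- Vertices of the natural `n`-hypercube, i.e. subsets of `{1, …, n}`: passing from `n` to `n + 1`,
a subset `A` of `{1, …, n}` gives the "old" vertex `A` and the "new" vertex `A ∪ {n + 1}`. -/
inductive Vtx : ℕ → Type
  | empty : Vtx 0
  | old {n : ℕ} : Vtx n → Vtx (n + 1)
  | new {n : ℕ} : Vtx n → Vtx (n + 1)

/-- The vertex `∅`. -/
def Vtx.bot : (n : ℕ) → Vtx n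
  | 0 => .empty
  | n + 1 => .old (Vtx.bot n)

/-- Edges `(B, A)` of the hypercube: `B ⊆ A` and `A` has exactly one element more than `B`.
`last A` is the edge `(A, A ∪ {n + 1})`; `old e`, `new e` are the two copies of an edge `e` of the
`n`-hypercube in the old and in the new half of the `(n + 1)`-hypercube. -/
inductive Edge : {n : ℕ} → Vtx n → Vtx n → Type
  | last {n : ℕ} (A : Vtx n) : Edge (.old A) (.new A)
  | old {n : ℕ} {B A : Vtx n} : Edge B A → Edge (.old B) (.old A)
  | new {n : ℕ} {B A : Vtx n} : Edge B A → Edge (.new B) (.new A)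

/-! ### `n`-fold groupoids -/

/-- The sets and structure maps of an `n`-fold groupoid (no laws yet): a set for each vertex of the
hypercube and, for each edge `(B, A)`, source and target `α, β : G^A → G^B`, units
`1 : G^B → G^A`, inversion, and a product `a ∗ b` defined when `α a = β b`. -/
structure CubeData (n : ℕ) where
  cell : Vtx n → Type u
  src : ∀ {B A : Vtx n}, Edge B A → cell A → cell B
  tgt : ∀ {B A : Vtx n}, Edge B A → cell A → cell B
  one : ∀ {B A : Vtx n}, Edge B A → cell B → cell A
  inv : ∀ {B A : Vtx n}, Edge B A → cell A → cell A
  comp : ∀ {B A : Vtx n} (e : Edge B A) (a b : cell A), src e a = tgt e b → cell A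

/-- `G` is a (strict, small) `n`-fold groupoid: every edge is a groupoid, and every face is a
double groupoid. In a face `(D, C, B, A)` the edges `e = (B, A)` and `e' = (D, C)` are parallel, and
so are `f = (C, A)` and `f' = (D, B)`. -/
structure CubeData.IsNFoldGroupoid {n : ℕ} (G : CubeData.{u} n) : Prop where
  -- each edge is a groupoid
  src_comp : ∀ {B A : Vtx n} (e : Edge B A) (a b : G.cell A) (h : G.src e a = G.tgt e b),
    G.src e (G.comp e a b h) = G.src e b
  tgt_comp : ∀ {B A : Vtx n} (e : Edge B A) (a b : G.cell A) (h : G.src e a = G.tgt e b),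
    G.tgt e (G.comp e a b h) = G.tgt e a
  assoc : ∀ {B A : Vtx n} (e : Edge B A) (a b c : G.cell A) (hab : G.src e a = G.tgt e b)
    (hbc : G.src e b = G.tgt e c) (h₁ : G.src e (G.comp e a b hab) = G.tgt e c)
    (h₂ : G.src e a = G.tgt e (G.comp e b c hbc)),
    G.comp e (G.comp e a b hab) c h₁ = G.comp e a (G.comp e b c hbc) h₂
  src_one : ∀ {B A : Vtx n} (e : Edge B A) (x : G.cell B), G.src e (G.one e x) = x
  tgt_one : ∀ {B A : Vtx n} (e : Edge B A) (x : G.cell B), G.tgt e (G.one e x) = x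
  comp_one : ∀ {B A : Vtx n} (e : Edge B A) (a : G.cell A)
    (h : G.src e a = G.tgt e (G.one e (G.src e a))), G.comp e a (G.one e (G.src e a)) h = a
  one_comp : ∀ {B A : Vtx n} (e : Edge B A) (a : G.cell A)
    (h : G.src e (G.one e (G.tgt e a)) = G.tgt e a), G.comp e (G.one e (G.tgt e a)) a h = a
  src_inv : ∀ {B A : Vtx n} (e : Edge B A) (a : G.cell A), G.src e (G.inv e a) = G.tgt e a
  tgt_inv : ∀ {B A : Vtx n} (e : Edge B A) (a : G.cell A), G.tgt e (G.inv e a) = G.src e a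
  comp_inv : ∀ {B A : Vtx n} (e : Edge B A) (a : G.cell A)
    (h : G.src e a = G.tgt e (G.inv e a)), G.comp e a (G.inv e a) h = G.one e (G.tgt e a)
  inv_comp : ∀ {B A : Vtx n} (e : Edge B A) (a : G.cell A)
    (h : G.src e (G.inv e a) = G.tgt e a), G.comp e (G.inv e a) a h = G.one e (G.src e a)
  -- each pair of parallel projections is a morphism of groupoids
  src_src : ∀ {D C B A : Vtx n} (e : Edge B A) (f : Edge C A) (f' : Edge D B) (e' : Edge D C),
    B ≠ C → ∀ a, G.src f' (G.src e a) = G.src e' (G.src f a)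
  src_tgt : ∀ {D C B A : Vtx n} (e : Edge B A) (f : Edge C A) (f' : Edge D B) (e' : Edge D C),
    B ≠ C → ∀ a, G.src f' (G.tgt e a) = G.tgt e' (G.src f a)
  tgt_tgt : ∀ {D C B A : Vtx n} (e : Edge B A) (f : Edge C A) (f' : Edge D B) (e' : Edge D C),
    B ≠ C → ∀ a, G.tgt f' (G.tgt e a) = G.tgt e' (G.tgt f a)
  src_unit : ∀ {D C B A : Vtx n} (e : Edge B A) (f : Edge C A) (f' : Edge D B) (e' : Edge D C),
    B ≠ C → ∀ c, G.src e (G.one f c) = G.one f' (G.src e' c)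
  tgt_unit : ∀ {D C B A : Vtx n} (e : Edge B A) (f : Edge C A) (f' : Edge D B) (e' : Edge D C),
    B ≠ C → ∀ c, G.tgt e (G.one f c) = G.one f' (G.tgt e' c)
  src_mul : ∀ {D C B A : Vtx n} (e : Edge B A) (f : Edge C A) (f' : Edge D B) (e' : Edge D C),
    B ≠ C → ∀ a b (h : G.src f a = G.tgt f b) (h' : G.src f' (G.src e a) = G.tgt f' (G.src e b)),
      G.src e (G.comp f a b h) = G.comp f' (G.src e a) (G.src e b) h'
  tgt_mul : ∀ {D C B A : Vtx n} (e : Edge B A) (f : Edge C A) (f' : Edge D B) (e' : Edge D C),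
    B ≠ C → ∀ a b (h : G.src f a = G.tgt f b) (h' : G.src f' (G.tgt e a) = G.tgt f' (G.tgt e b)),
      G.tgt e (G.comp f a b h) = G.comp f' (G.tgt e a) (G.tgt e b) h'
  -- each pair of parallel unit sections is a morphism of groupoids
  one_one : ∀ {D C B A : Vtx n} (e : Edge B A) (f : Edge C A) (f' : Edge D B) (e' : Edge D C),
    B ≠ C → ∀ d, G.one e (G.one f' d) = G.one f (G.one e' d)
  one_mul : ∀ {D C B A : Vtx n} (e : Edge B A) (f : Edge C A) (f' : Edge D B) (e' : Edge D C),
    B ≠ C → ∀ a b (h : G.src f' a = G.tgt f' b) (h' : G.src f (G.one e a) = G.tgt f (G.one e b)),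
      G.one e (G.comp f' a b h) = G.comp f (G.one e a) (G.one e b) h'
  -- the two products satisfy the interchange law
  interchange : ∀ {D C B A : Vtx n} (e : Edge B A) (f : Edge C A) (f' : Edge D B) (e' : Edge D C),
    B ≠ C → ∀ (a b c d : G.cell A)
      (hac : G.src f a = G.tgt f c) (hbd : G.src f b = G.tgt f d)
      (hab : G.src e a = G.tgt e b) (hcd : G.src e c = G.tgt e d)
      (h₁ : G.src e (G.comp f a c hac) = G.tgt e (G.comp f b d hbd))
      (h₂ : G.src f (G.comp e a b hab) = G.tgt f (G.comp e c d hcd)),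
      G.comp e (G.comp f a c hac) (G.comp f b d hbd) h₁
        = G.comp f (G.comp e a b hab) (G.comp e c d hcd) h₂

/-- Morphisms of `n`-fold groupoids: families of maps, one for each vertex, that are functors on
each edge groupoid. -/
structure CubeHom {n : ℕ} (G H : CubeData.{u} n) where
  map : ∀ A : Vtx n, G.cell A → H.cell A
  map_src : ∀ {B A : Vtx n} (e : Edge B A) (a : G.cell A), map B (G.src e a) = H.src e (map A a)
  map_tgt : ∀ {B A : Vtx n} (e : Edge B A) (a : G.cell A), map B (G.tgt e a) = H.tgt e (map A a)
  map_one : ∀ {B A : Vtx n} (e : Edge B A) (b : G.cell B), map A (G.one e b) = H.one e (map B b)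
  map_comp : ∀ {B A : Vtx n} (e : Edge B A) (a b : G.cell A) (h : G.src e a = G.tgt e b)
    (h' : H.src e (map A a) = H.tgt e (map A b)),
    map A (G.comp e a b h) = H.comp e (map A a) (map A b) h'

/-- The family of sets `S` is closed under all structure maps of `G`. -/
structure CubeData.IsSub {n : ℕ} (G : CubeData.{u} n) (S : ∀ A : Vtx n, Set (G.cell A)) : Prop where
  src_mem : ∀ {B A : Vtx n} (e : Edge B A), ∀ a ∈ S A, G.src e a ∈ S B
  tgt_mem : ∀ {B A : Vtx n} (e : Edge B A), ∀ a ∈ S A, G.tgt e a ∈ S B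
  one_mem : ∀ {B A : Vtx n} (e : Edge B A), ∀ b ∈ S B, G.one e b ∈ S A
  inv_mem : ∀ {B A : Vtx n} (e : Edge B A), ∀ a ∈ S A, G.inv e a ∈ S A
  comp_mem : ∀ {B A : Vtx n} (e : Edge B A), ∀ a ∈ S A, ∀ b ∈ S A,
    ∀ h : G.src e a = G.tgt e b, G.comp e a b h ∈ S A

/-! ### The modules in which the vertex sets of `U^n` live -/

/-- The module in which the vertex set `U^{A;n}` lives: the derivation symbol of generation `n + 1`
replaces a module `E` by `E × E × K` (morphisms `(x, v, t)`; new vertices) and by `E × K`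
(objects `(x, t)`; old vertices). -/
def Amb (K V : Type u) : {n : ℕ} → Vtx n → Type u
  | _, .empty => V
  | _, .old A => Amb K V A × K
  | _, .new A => Amb K V A × Amb K V A × K

namespace Amb

section instances

variable (K V : Type u)

instance instAddCommGroup [AddCommGroup K] [AddCommGroup V] :
    {n : ℕ} → (A : Vtx n) → AddCommGroup (Amb K V A)
  | _, .empty => inferInstanceAs (AddCommGroup V)
  | _, .old A =>
    letI := instAddCommGroup A
    inferInstanceAs (AddCommGroup (Amb K V A × K))
  | _, .new A =>
    letI := instAddCommGroup A
    inferInstanceAs (AddCommGroup (Amb K V A × Amb K V A × K))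

instance instModule [CommRing K] [AddCommGroup V] [Module K V] :
    {n : ℕ} → (A : Vtx n) → Module K (Amb K V A)
  | _, .empty => inferInstanceAs (Module K V)
  | _, .old A =>
    letI := instModule A
    inferInstanceAs (Module K (Amb K V A × K))
  | _, .new A =>
    letI := instModule A
    inferInstanceAs (Module K (Amb K V A × Amb K V A × K))

instance instTopologicalSpace [TopologicalSpace K] [TopologicalSpace V] :
    {n : ℕ} → (A : Vtx n) → TopologicalSpace (Amb K V A)
  | _, .empty => inferInstanceAs (TopologicalSpace V)
  | _, .old A =>
    letI := instTopologicalSpace A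
    inferInstanceAs (TopologicalSpace (Amb K V A × K))
  | _, .new A =>
    letI := instTopologicalSpace A
    inferInstanceAs (TopologicalSpace (Amb K V A × Amb K V A × K))

end instances

end Amb

/-! ### Scalar extension from `K` to `K[ε]/(ε² - tε)`

`QuadraticAlgebra K 0 t` is `K ⊕ K ε` with `ε² = tε`. If `p` is a polynomial map, then
`p (y + εw) = p y + ε p^[1] (y, w, t)`, where `p^[1]` is the polynomial map with
`t p^[1] (y, w, t) = p (y + tw) - p y`. This is how the target and inversion maps, which are
polynomial but not linear, are derived. -/

/-- The scalar extension `V ⊕ εV` of the `K`-module `V` to `K[ε]/(ε² - tε)`. -/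
def Tw {K : Type u} (_ : K) (V : Type u) : Type u := V × V

instance {K : Type u} (t : K) (V : Type u) [AddCommGroup V] : AddCommGroup (Tw t V) :=
  inferInstanceAs (AddCommGroup (V × V))

instance {K : Type u} [CommRing K] (t : K) (V : Type u) [AddCommGroup V] [Module K V] :
    Module (QuadraticAlgebra K 0 t) (Tw t V) where
  smul a x := ((a.re • x.1, a.re • x.2 + a.im • x.1 + (t * a.im) • x.2) : V × V)
  one_smul x := Prod.ext (by change (1 : K) • x.1 = x.1; simp)
    (by change (1 : K) • x.2 + (0 : K) • x.1 + (t * 0 : K) • x.2 = x.2; simp)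
  mul_smul a b x := Prod.ext
    (by change (a * b).re • x.1 = a.re • b.re • x.1; simp [mul_smul])
    (by
      change (a * b).re • x.2 + (a * b).im • x.1 + (t * (a * b).im) • x.2
        = a.re • (b.re • x.2 + b.im • x.1 + (t * b.im) • x.2) + a.im • b.re • x.1
          + (t * a.im) • (b.re • x.2 + b.im • x.1 + (t * b.im) • x.2)
      simp only [QuadraticAlgebra.re_mul, QuadraticAlgebra.im_mul]
      module)
  smul_zero a := Prod.ext (by change a.re • (0 : V) = 0; simp)
    (by change a.re • (0 : V) + a.im • (0 : V) + (t * a.im) • (0 : V) = 0; simp)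
  smul_add a x y := Prod.ext
    (by change a.re • (x.1 + y.1) = a.re • x.1 + a.re • y.1; simp)
    (by
      change a.re • (x.2 + y.2) + a.im • (x.1 + y.1) + (t * a.im) • (x.2 + y.2)
        = (a.re • x.2 + a.im • x.1 + (t * a.im) • x.2)
          + (a.re • y.2 + a.im • y.1 + (t * a.im) • y.2)
      module)
  add_smul a b x := Prod.ext
    (by change (a + b).re • x.1 = a.re • x.1 + b.re • x.1; simp [add_smul])
    (by
      change (a + b).re • x.2 + (a + b).im • x.1 + (t * (a + b).im) • x.2
        = (a.re • x.2 + a.im • x.1 + (t * a.im) • x.2)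
          + (b.re • x.2 + b.im • x.1 + (t * b.im) • x.2)
      simp only [QuadraticAlgebra.re_add, QuadraticAlgebra.im_add]
      module)
  zero_smul x := Prod.ext (by change (0 : K) • x.1 = 0; simp)
    (by change (0 : K) • x.2 + (0 : K) • x.1 + (t * 0 : K) • x.2 = 0; simp)

namespace Amb

/-- `y + εw`. -/
def join {K V : Type u} [CommRing K] (t : K) : {n : ℕ} → (A : Vtx n) → Amb K V A → Amb K V A →
    Amb (QuadraticAlgebra K 0 t) (Tw t V) A
  | _, .empty => fun y w => ((y, w) : V × V)
  | _, .old A => fun (y, s) (y', s') => (join t A y y', ⟨s, s'⟩)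
  | _, .new A => fun (y, w, s) (y', w', s') => (join t A y y', join t A w w', ⟨s, s'⟩)

/-- The coefficient `w` of `ε` in `y + εw`. -/
def im {K V : Type u} [CommRing K] (t : K) : {n : ℕ} → (A : Vtx n) →
    Amb (QuadraticAlgebra K 0 t) (Tw t V) A → Amb K V A
  | _, .empty => fun z => Prod.snd (α := V) (β := V) z
  | _, .old A => fun (z, s) => (im t A z, s.im)
  | _, .new A => fun (z, z', s) => (im t A z, im t A z', s.im)

end Amb

/-! ### The structure maps

On a `last` edge they are those of the groupoid of morphisms `(x, v, t)`, from `(x, t)` to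
`(x + tv, t)`. A structure map `p` of an edge `e` gives, on the edge `old e`, the map `p × id`, and
on the edge `new e` the derived map `(y, w, t) ↦ (p y, p^[1] (y, w, t), t)`. Sources, units and
products are (restrictions of) linear maps, so that `p^[1] (y, w, t) = p w` for them. -/

section structureMaps

/-- Source: `α (x, v, t) = (x, t)`. -/
def srcMap (K V : Type u) : {n : ℕ} → {B A : Vtx n} → Edge B A → Amb K V A → Amb K V B
  | _, _, _, .last _ => fun (y, _, t) => (y, t)
  | _, _, _, .old e => fun (y, t) => (srcMap K V e y, t)
  | _, _, _, .new e => fun (y, w, t) => (srcMap K V e y, srcMap K V e w, t)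

/-- Units: `1_(x, t) = (x, 0, t)`. -/
def oneMap (K V : Type u) [AddCommGroup K] [AddCommGroup V] :
    {n : ℕ} → {B A : Vtx n} → Edge B A → Amb K V B → Amb K V A
  | _, _, _, .last _ => fun (y, t) => (y, 0, t)
  | _, _, _, .old e => fun (y, t) => (oneMap K V e y, t)
  | _, _, _, .new e => fun (y, w, t) => (oneMap K V e y, oneMap K V e w, t)

/-- Products: `(x', v', t) ∗ (x, v, t) = (x, v' + v, t)`. -/
def compMap (K V : Type u) [AddCommGroup K] [AddCommGroup V] :
    {n : ℕ} → {B A : Vtx n} → Edge B A → Amb K V A → Amb K V A → Amb K V A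
  | _, _, _, .last _ => fun (_, w', _) (y, w, t) => (y, w' + w, t)
  | _, _, _, .old e => fun (y', _) (y, t) => (compMap K V e y' y, t)
  | _, _, _, .new e => fun (y', w', _) (y, w, t) => (compMap K V e y' y, compMap K V e w' w, t)

/-- Target: `β (x, v, t) = (x + tv, t)`. -/
def tgtMap : {n : ℕ} → {B A : Vtx n} → Edge B A →
    ∀ (K V : Type u) [CommRing K] [AddCommGroup V] [Module K V], Amb K V A → Amb K V B
  | _, _, _, .last _ => fun _ _ _ _ _ (y, w, t) => (y + t • w, t)
  | _, _, _, .old e => fun K V _ _ _ (y, t) => (tgtMap e K V y, t)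
  | _, _, _, .new (B := B) (A := A) e => fun K V _ _ _ (y, w, t) =>
    (tgtMap e K V y,
      Amb.im t B (tgtMap e (QuadraticAlgebra K 0 t) (Tw t V) (Amb.join t A y w)), t)

/-- Inversion: `(x, v, t)⁻¹ = (x + tv, -v, t)`. -/
def invMap : {n : ℕ} → {B A : Vtx n} → Edge B A →
    ∀ (K V : Type u) [CommRing K] [AddCommGroup V] [Module K V], Amb K V A → Amb K V A
  | _, _, _, .last _ => fun _ _ _ _ _ (y, w, t) => (y + t • w, -w, t)
  | _, _, _, .old e => fun K V _ _ _ (y, t) => (invMap e K V y, t)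
  | _, _, _, .new (A := A) e => fun K V _ _ _ (y, w, t) =>
    (invMap e K V y,
      Amb.im t A (invMap e (QuadraticAlgebra K 0 t) (Tw t V) (Amb.join t A y w)), t)

end structureMaps

/-! ### The derived maps have the difference quotient property -/

section naturality

/-- Change of scalars along `g` and `h`. -/
def Amb.map {K L V W : Type u} (g : K → L) (h : V → W) :
    {n : ℕ} → (A : Vtx n) → Amb K V A → Amb L W A
  | _, .empty => fun y => h y
  | _, .old A => fun (y, t) => (Amb.map g h A y, g t)
  | _, .new A => fun (y, w, t) => (Amb.map g h A y, Amb.map g h A w, g t)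

variable {K L V W : Type u} [CommRing K] [AddCommGroup V] [Module K V]
  [CommRing L] [AddCommGroup W] [Module L W]

theorem Amb.map_add (g : K →+* L) (h : V →+ W) :
    ∀ {n : ℕ} (A : Vtx n) (y z : Amb K V A),
      Amb.map g h A (y + z) = Amb.map g h A y + Amb.map g h A z
  | _, .empty => fun y z => h.map_add y z
  | _, .old A => fun (y, t) (z, s) => Prod.ext (Amb.map_add g h A y z) (g.map_add t s)
  | _, .new A => fun (y, w, t) (z, x, s) => Prod.ext (Amb.map_add g h A y z)
      (Prod.ext (Amb.map_add g h A w x) (g.map_add t s))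

theorem Amb.map_smul (g : K →+* L) (h : V →+ W) (hh : ∀ (r : K) (v : V), h (r • v) = g r • h v) :
    ∀ {n : ℕ} (A : Vtx n) (r : K) (y : Amb K V A),
      Amb.map g h A (r • y) = g r • Amb.map g h A y
  | _, .empty => fun r y => hh r y
  | _, .old A => fun r (y, t) => Prod.ext (Amb.map_smul g h hh A r y) (g.map_mul r t)
  | _, .new A => fun r (y, w, t) => Prod.ext (Amb.map_smul g h hh A r y)
      (Prod.ext (Amb.map_smul g h hh A r w) (g.map_mul r t))

/-- `K[ε]/(ε² - tε) → L[ε]/(ε² - g(t)ε)`. -/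
def quadMap (g : K →+* L) (t : K) : QuadraticAlgebra K 0 t →+* QuadraticAlgebra L 0 (g t) where
  toFun a := ⟨g a.re, g a.im⟩
  map_one' := by ext <;> simp [QuadraticAlgebra.re_one, QuadraticAlgebra.im_one]
  map_mul' a b := by ext <;> simp
  map_zero' := by ext <;> simp
  map_add' a b := by ext <;> simp

/-- `V ⊕ εV → W ⊕ εW`. -/
def twMap (h : V →+ W) (t : K) (s : L) : Tw t V →+ Tw s W := h.prodMap h

/-- The evaluation `K[ε]/(ε² - tε) → K`, `ε ↦ t`. -/
def evalT (t : K) : QuadraticAlgebra K 0 t →+* K where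
  toFun a := a.re + t * a.im
  map_one' := by simp [QuadraticAlgebra.re_one, QuadraticAlgebra.im_one]
  map_mul' a b := by simp; ring
  map_zero' := by simp
  map_add' a b := by simp; ring

/-- The evaluation `K[ε]/(ε² - tε) → K`, `ε ↦ 0`. -/
def evalZ (t : K) : QuadraticAlgebra K 0 t →+* K where
  toFun a := a.re
  map_one' := by simp [QuadraticAlgebra.re_one]
  map_mul' a b := by simp
  map_zero' := by simp
  map_add' a b := by simp

/-- `V ⊕ εV → V`, `ε ↦ t`. -/
def twEvalT (t : K) : Tw t V →+ V where
  toFun x := Prod.fst (α := V) (β := V) x + t • Prod.snd (α := V) (β := V) x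
  map_zero' := by change (0 : V) + t • (0 : V) = 0; simp
  map_add' x y := by
    change (x.1 + y.1 : V) + t • (x.2 + y.2 : V) = (x.1 + t • x.2) + (y.1 + t • y.2)
    module

/-- `V ⊕ εV → V`, `ε ↦ 0`. -/
def twEvalZ (t : K) : Tw t V →+ V := AddMonoidHom.fst V V

theorem twMap_smul (g : K →+* L) (h : V →+ W) (hh : ∀ (r : K) (v : V), h (r • v) = g r • h v)
    (t : K) (a : QuadraticAlgebra K 0 t) (x : Tw t V) :
    twMap h t (g t) (a • x) = quadMap g t a • twMap h t (g t) x :=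
  Prod.ext (hh _ _) (by
    change h (a.re • x.2 + a.im • x.1 + (t * a.im) • x.2)
      = g a.re • h x.2 + g a.im • h x.1 + (g t * g a.im) • h x.2
    simp [hh])

theorem twEvalT_smul (t : K) (a : QuadraticAlgebra K 0 t) (x : Tw t V) :
    twEvalT t (a • x) = evalT t a • twEvalT t x := by
  change a.re • x.1 + t • (a.re • x.2 + a.im • x.1 + (t * a.im) • x.2)
    = (a.re + t * a.im) • (x.1 + t • x.2)
  module

theorem twEvalZ_smul (t : K) (a : QuadraticAlgebra K 0 t) (x : Tw t V) :
    twEvalZ t (a • x) = evalZ t a • twEvalZ t x := rfl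

theorem Amb.join_map (g : K →+* L) (h : V →+ W) (t : K) :
    ∀ {n : ℕ} (A : Vtx n) (y w : Amb K V A),
      Amb.join (g t) A (Amb.map g h A y) (Amb.map g h A w)
        = Amb.map (quadMap g t) (twMap h t (g t)) A (Amb.join t A y w)
  | _, .empty => fun _ _ => rfl
  | _, .old A => fun (y, _) (w, _) => Prod.ext (Amb.join_map g h t A y w) rfl
  | _, .new A => fun (y, y', _) (w, w', _) => Prod.ext (Amb.join_map g h t A y w)
      (Prod.ext (Amb.join_map g h t A y' w') rfl)

theorem Amb.im_map (g : K →+* L) (h : V →+ W) (t : K) :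
    ∀ {n : ℕ} (A : Vtx n) (z : Amb (QuadraticAlgebra K 0 t) (Tw t V) A),
      Amb.im (g t) A (Amb.map (quadMap g t) (twMap h t (g t)) A z) = Amb.map g h A (Amb.im t A z)
  | _, .empty => fun _ => rfl
  | _, .old A => fun (z, _) => Prod.ext (Amb.im_map g h t A z) rfl
  | _, .new A => fun (z, z', _) => Prod.ext (Amb.im_map g h t A z)
      (Prod.ext (Amb.im_map g h t A z') rfl)

theorem Amb.evalT_join (t : K) : ∀ {n : ℕ} (A : Vtx n) (y w : Amb K V A),
    Amb.map (evalT t) (twEvalT t) A (Amb.join t A y w) = y + t • w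
  | _, .empty => fun _ _ => rfl
  | _, .old A => fun (y, _) (w, _) => Prod.ext (Amb.evalT_join t A y w) rfl
  | _, .new A => fun (y, y', _) (w, w', _) => Prod.ext (Amb.evalT_join t A y w)
      (Prod.ext (Amb.evalT_join t A y' w') rfl)

theorem Amb.evalZ_join (t : K) : ∀ {n : ℕ} (A : Vtx n) (y w : Amb K V A),
    Amb.map (evalZ t) (twEvalZ t) A (Amb.join t A y w) = y
  | _, .empty => fun _ _ => rfl
  | _, .old A => fun (y, _) (w, _) => Prod.ext (Amb.evalZ_join t A y w) rfl
  | _, .new A => fun (y, y', _) (w, w', _) => Prod.ext (Amb.evalZ_join t A y w)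
      (Prod.ext (Amb.evalZ_join t A y' w') rfl)

theorem Amb.evalT_eq (t : K) : ∀ {n : ℕ} (A : Vtx n)
    (z : Amb (QuadraticAlgebra K 0 t) (Tw t V) A),
    Amb.map (evalT t) (twEvalT t) A z
      = Amb.map (evalZ t) (twEvalZ t) A z + t • Amb.im t A z
  | _, .empty => fun _ => rfl
  | _, .old A => fun (z, _) => Prod.ext (Amb.evalT_eq t A z) rfl
  | _, .new A => fun (z, z', _) => Prod.ext (Amb.evalT_eq t A z) (Prod.ext (Amb.evalT_eq t A z') rfl)

theorem tgtMap_map : ∀ {n : ℕ} {B A : Vtx n} (e : Edge B A) (K V L W : Type u)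
    [CommRing K] [AddCommGroup V] [Module K V] [CommRing L] [AddCommGroup W] [Module L W]
    (g : K →+* L) (h : V →+ W) (_ : ∀ (r : K) (v : V), h (r • v) = g r • h v) (y : Amb K V A),
    tgtMap e L W (Amb.map g h A y) = Amb.map g h B (tgtMap e K V y)
  | _, _, _, .last A => fun K V L W _ _ _ _ _ _ g h hh (y, w, t) => by
    refine Prod.ext ?_ rfl
    change Amb.map g h A y + g t • Amb.map g h A w = Amb.map g h A (y + t • w)
    rw [Amb.map_add, Amb.map_smul g h hh]
  | _, _, _, .old e => fun K V L W _ _ _ _ _ _ g h hh (y, t) =>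
    Prod.ext (tgtMap_map e K V L W g h hh y) rfl
  | _, _, _, .new (B := B) (A := A) e => fun K V L W _ _ _ _ _ _ g h hh (y, w, t) => by
    refine Prod.ext (tgtMap_map e K V L W g h hh y) (Prod.ext ?_ rfl)
    change Amb.im (g t) B (tgtMap e (QuadraticAlgebra L 0 (g t)) (Tw (g t) W)
        (Amb.join (g t) A (Amb.map g h A y) (Amb.map g h A w)))
      = Amb.map g h B (Amb.im t B (tgtMap e (QuadraticAlgebra K 0 t) (Tw t V) (Amb.join t A y w)))
    rw [Amb.join_map, tgtMap_map e _ _ _ _ (quadMap g t) (twMap h t (g t)) (twMap_smul g h hh t),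
      Amb.im_map]

theorem invMap_map : ∀ {n : ℕ} {B A : Vtx n} (e : Edge B A) (K V L W : Type u)
    [CommRing K] [AddCommGroup V] [Module K V] [CommRing L] [AddCommGroup W] [Module L W]
    (g : K →+* L) (h : V →+ W) (_ : ∀ (r : K) (v : V), h (r • v) = g r • h v) (y : Amb K V A),
    invMap e L W (Amb.map g h A y) = Amb.map g h A (invMap e K V y)
  | _, _, _, .last A => fun K V L W _ _ _ _ _ _ g h hh (y, w, t) => by
    have hneg : -Amb.map g h A w = Amb.map g h A (-w) := by
      rw [← neg_one_smul K w, Amb.map_smul g h hh, _root_.map_neg, _root_.map_one, neg_one_smul]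
    refine Prod.ext ?_ (Prod.ext hneg rfl)
    change Amb.map g h A y + g t • Amb.map g h A w = Amb.map g h A (y + t • w)
    rw [Amb.map_add, Amb.map_smul g h hh]
  | _, _, _, .old e => fun K V L W _ _ _ _ _ _ g h hh (y, t) =>
    Prod.ext (invMap_map e K V L W g h hh y) rfl
  | _, _, _, .new (B := B) (A := A) e => fun K V L W _ _ _ _ _ _ g h hh (y, w, t) => by
    refine Prod.ext (invMap_map e K V L W g h hh y) (Prod.ext ?_ rfl)
    change Amb.im (g t) A (invMap e (QuadraticAlgebra L 0 (g t)) (Tw (g t) W)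
        (Amb.join (g t) A (Amb.map g h A y) (Amb.map g h A w)))
      = Amb.map g h A (Amb.im t A (invMap e (QuadraticAlgebra K 0 t) (Tw t V) (Amb.join t A y w)))
    rw [Amb.join_map, invMap_map e _ _ _ _ (quadMap g t) (twMap h t (g t)) (twMap_smul g h hh t),
      Amb.im_map]

/-- The difference quotient property of the derived target map:
`β (y + tw) = β y + t β^[1] (y, w, t)`. -/
theorem tgtMap_add_smul {n : ℕ} {B A : Vtx n} (e : Edge B A) (y w : Amb K V A) (t : K) :
    tgtMap e K V (y + t • w) = tgtMap e K V y
      + t • Amb.im t B (tgtMap e (QuadraticAlgebra K 0 t) (Tw t V) (Amb.join t A y w)) := by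
  conv_lhs => rw [← Amb.evalT_join]
  rw [tgtMap_map e _ _ _ _ (evalT t) (twEvalT t) (twEvalT_smul t), Amb.evalT_eq,
    ← tgtMap_map e _ _ _ _ (evalZ t) (twEvalZ t) (twEvalZ_smul t), Amb.evalZ_join]

/-- The difference quotient property of the derived inversion map. -/
theorem invMap_add_smul {n : ℕ} {B A : Vtx n} (e : Edge B A) (y w : Amb K V A) (t : K) :
    invMap e K V (y + t • w) = invMap e K V y
      + t • Amb.im t A (invMap e (QuadraticAlgebra K 0 t) (Tw t V) (Amb.join t A y w)) := by
  conv_lhs => rw [← Amb.evalT_join]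
  rw [invMap_map e _ _ _ _ (evalT t) (twEvalT t) (twEvalT_smul t), Amb.evalT_eq,
    ← invMap_map e _ _ _ _ (evalZ t) (twEvalZ t) (twEvalZ_smul t), Amb.evalZ_join]

theorem srcMap_add_smul : ∀ {n : ℕ} {B A : Vtx n} (e : Edge B A) (y w : Amb K V A) (t : K),
    srcMap K V e (y + t • w) = srcMap K V e y + t • srcMap K V e w
  | _, _, _, .last _ => fun (_, _, _) (_, _, _) _ => rfl
  | _, _, _, .old e => fun (y, _) (w, _) t => Prod.ext (srcMap_add_smul e y w t) rfl
  | _, _, _, .new e => fun (y, y', _) (w, w', _) t => Prod.ext (srcMap_add_smul e y w t)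
      (Prod.ext (srcMap_add_smul e y' w' t) rfl)

theorem oneMap_add_smul : ∀ {n : ℕ} {B A : Vtx n} (e : Edge B A) (y w : Amb K V B) (t : K),
    oneMap K V e (y + t • w) = oneMap K V e y + t • oneMap K V e w
  | _, _, _, .last A => fun (_, _) (_, _) t => Prod.ext rfl
      (Prod.ext (by change (0 : Amb K V A) = 0 + t • 0; simp) rfl)
  | _, _, _, .old e => fun (y, _) (w, _) t => Prod.ext (oneMap_add_smul e y w t) rfl
  | _, _, _, .new e => fun (y, y', _) (w, w', _) t => Prod.ext (oneMap_add_smul e y w t)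
      (Prod.ext (oneMap_add_smul e y' w' t) rfl)

theorem compMap_add_smul : ∀ {n : ℕ} {B A : Vtx n} (e : Edge B A) (y z w x : Amb K V A) (t : K),
    compMap K V e (y + t • w) (z + t • x) = compMap K V e y z + t • compMap K V e w x
  | _, _, _, .last A => fun (_, y, _) (_, z, _) (_, w, _) (_, x, _) t => Prod.ext rfl
      (Prod.ext (by
        change (y + t • w) + (z + t • x) = (y + z : Amb K V A) + t • (w + x)
        module) rfl)
  | _, _, _, .old e => fun (y, _) (z, _) (w, _) (x, _) t =>
      Prod.ext (compMap_add_smul e y z w x t) rfl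
  | _, _, _, .new e => fun (y, y', _) (z, z', _) (w, w', _) (x, x', _) t =>
      Prod.ext (compMap_add_smul e y z w x t) (Prod.ext (compMap_add_smul e y' z' w' x' t) rfl)

end naturality

/-! ### The `n`-fold tangent groupoid `U^n` of a subset `U` of a module -/

section tangent

variable (K : Type u) {V : Type u} [CommRing K] [AddCommGroup V] [Module K V]

/-- The first extended domain `U^[1] = {(x, v, t) | x ∈ U, x + tv ∈ U}`. -/
def extDom (U : Set V) : Set (V × V × K) := {p | p.1 ∈ U ∧ p.1 + p.2.2 • p.2.1 ∈ U}

/-- The vertex set `U^{A;n}`: for a new vertex `(U^{A;n})^[1]`, for an old vertex `U^{A;n} × K`. -/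
def ext (U : Set V) : {n : ℕ} → (A : Vtx n) → Set (Amb K V A)
  | _, .empty => U
  | _, .old A => {p : Amb K V A × K | p.1 ∈ ext U A}
  | _, .new A => extDom K (ext U A)

/-- The vertex set of the finite part: as before, but the scalar added at each of the `n` steps has
to be invertible. -/
def finExt (U : Set V) : {n : ℕ} → (A : Vtx n) → Set (Amb K V A)
  | _, .empty => U
  | _, .old A => {p : Amb K V A × K | p.1 ∈ finExt U A ∧ IsUnit p.2}
  | _, .new A => {p : Amb K V A × Amb K V A × K | p ∈ extDom K (finExt U A) ∧ IsUnit p.2.2}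

variable {K}

theorem ext_mono {U U' : Set V} (h : U ⊆ U') : ∀ {n : ℕ} (A : Vtx n), ext K U A ⊆ ext K U' A
  | _, .empty => h
  | _, .old A => fun _ hp => ext_mono h A hp
  | _, .new A => fun _ hp => ⟨ext_mono h A hp.1, ext_mono h A hp.2⟩

variable {U : Set V}

theorem srcMap_mem : ∀ {n : ℕ} {B A : Vtx n} (e : Edge B A) (y : Amb K V A),
    y ∈ ext K U A → srcMap K V e y ∈ ext K U B
  | _, _, _, .last _ => fun (_, _, _) hy => hy.1
  | _, _, _, .old e => fun (y, _) hy => srcMap_mem e y hy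
  | _, _, _, .new (B := B) e => fun (y, w, t) hy => ⟨srcMap_mem e y hy.1, by
      change srcMap K V e y + t • srcMap K V e w ∈ ext K U B
      rw [← srcMap_add_smul]; exact srcMap_mem e _ hy.2⟩

theorem oneMap_mem : ∀ {n : ℕ} {B A : Vtx n} (e : Edge B A) (y : Amb K V B),
    y ∈ ext K U B → oneMap K V e y ∈ ext K U A
  | _, _, _, .last A => fun (y, t) hy => ⟨hy, by
      change y + t • (0 : Amb K V A) ∈ ext K U A
      rw [smul_zero, add_zero]; exact hy⟩
  | _, _, _, .old e => fun (y, _) hy => oneMap_mem e y hy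
  | _, _, _, .new (A := A) e => fun (y, w, t) hy => ⟨oneMap_mem e y hy.1, by
      change oneMap K V e y + t • oneMap K V e w ∈ ext K U A
      rw [← oneMap_add_smul]; exact oneMap_mem e _ hy.2⟩

theorem tgtMap_mem : ∀ {n : ℕ} {B A : Vtx n} (e : Edge B A) (y : Amb K V A),
    y ∈ ext K U A → tgtMap e K V y ∈ ext K U B
  | _, _, _, .last _ => fun (_, _, _) hy => hy.2
  | _, _, _, .old e => fun (y, _) hy => tgtMap_mem e y hy
  | _, _, _, .new (B := B) (A := A) e => fun (y, w, t) hy => ⟨tgtMap_mem e y hy.1, by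
      change tgtMap e K V y + t • Amb.im t B (tgtMap e (QuadraticAlgebra K 0 t) (Tw t V)
        (Amb.join t A y w)) ∈ ext K U B
      rw [← tgtMap_add_smul]; exact tgtMap_mem e _ hy.2⟩

theorem invMap_mem : ∀ {n : ℕ} {B A : Vtx n} (e : Edge B A) (y : Amb K V A),
    y ∈ ext K U A → invMap e K V y ∈ ext K U A
  | _, _, _, .last A => fun (y, w, t) hy => ⟨hy.2, by
      change y + t • w + t • (-w) ∈ ext K U A
      rw [smul_neg, add_neg_cancel_right]; exact hy.1⟩
  | _, _, _, .old e => fun (y, _) hy => invMap_mem e y hy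
  | _, _, _, .new (A := A) e => fun (y, w, t) hy => ⟨invMap_mem e y hy.1, by
      change invMap e K V y + t • Amb.im t A (invMap e (QuadraticAlgebra K 0 t) (Tw t V)
        (Amb.join t A y w)) ∈ ext K U A
      rw [← invMap_add_smul]; exact invMap_mem e _ hy.2⟩

theorem compMap_mem : ∀ {n : ℕ} {B A : Vtx n} (e : Edge B A) (a b : Amb K V A),
    a ∈ ext K U A → b ∈ ext K U A → srcMap K V e a = tgtMap e K V b →
      compMap K V e a b ∈ ext K U A
  | _, _, _, .last A => fun (x, w', s) (y, w, t) ha hb h => by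
    obtain ⟨h₁, h₂⟩ := Prod.mk.inj h
    obtain rfl : x = y + t • w := h₁
    obtain rfl : s = t := h₂
    refine ⟨hb.1, ?_⟩
    change y + s • (w' + w) ∈ ext K U A
    have := ha.2
    change y + s • w + s • w' ∈ ext K U A at this
    rwa [smul_add, add_comm (s • w'), ← add_assoc]
  | _, _, _, .old e => fun (x, _) (y, _) ha hb h =>
    compMap_mem e x y ha hb (Prod.mk.inj h).1
  | _, _, _, .new (A := A) e => fun (x, w', s) (y, w, t) ha hb h => by
    obtain ⟨h₁, h₂⟩ := Prod.mk.inj h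
    obtain ⟨h₂, h₃⟩ := Prod.mk.inj h₂
    obtain rfl : s = t := h₃
    refine ⟨compMap_mem e x y ha.1 hb.1 h₁, ?_⟩
    change compMap K V e x y + s • compMap K V e w' w ∈ ext K U A
    rw [← compMap_add_smul]
    refine compMap_mem e _ _ ha.2 hb.2 ?_
    change srcMap K V e (x + s • w') = tgtMap e K V (y + s • w)
    rw [srcMap_add_smul, tgtMap_add_smul, h₁, h₂]

variable (K) in
/-- `U^n`, obtained by applying the derivation symbols of generation `1, …, n` to `U`. -/
def tangentCube (n : ℕ) (U : Set V) : CubeData.{u} n where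
  cell A := ext K U A
  src e a := ⟨srcMap K V e a.1, srcMap_mem e a.1 a.2⟩
  tgt e a := ⟨tgtMap e K V a.1, tgtMap_mem e a.1 a.2⟩
  one e a := ⟨oneMap K V e a.1, oneMap_mem e a.1 a.2⟩
  inv e a := ⟨invMap e K V a.1, invMap_mem e a.1 a.2⟩
  comp e a b h := ⟨compMap K V e a.1 b.1, compMap_mem e a.1 b.1 a.2 b.2 (congrArg Subtype.val h)⟩

/-- The underlying point of the ambient module. -/
def val {n : ℕ} {A : Vtx n} (p : (tangentCube K n U).cell A) : Amb K V A := Subtype.val p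

end tangent

/-! ### The class `C^n` and the prolongations of maps -/

section calculus

variable (K : Type u) {V W : Type u} [CommRing K] [AddCommGroup V] [Module K V]
  [AddCommGroup W] [Module K W]

/-- `f` is of class `C^n` over `K` on `U` (only the values of `f` on `U` matter). `C^0` means
continuous; `f` is `C^(n+1)` if its difference quotient `t⁻¹ (f (x + tv) - f x)`, given for
invertible `t`, extends to a continuous map `f^[1]` on `U^[1]` which is of class `C^n`. -/
def IsC [TopologicalSpace K] [TopologicalSpace W] :
    ℕ → ∀ {V : Type u} [AddCommGroup V] [Module K V] [TopologicalSpace V], Set V → (V → W) → Prop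
  | 0, _, _, _, _, U, f => ContinuousOn f U
  | n + 1, V, _, _, _, U, f => ∃ g : V × V × K → W,
      ContinuousOn g (extDom K U) ∧
      (∀ (x v : V) (t : Kˣ), (x, v, (t : K)) ∈ extDom K U →
        g (x, v, (t : K)) = (↑t⁻¹ : K) • (f (x + (t : K) • v) - f x)) ∧
      IsC n (extDom K U) g

/-- The vertex maps of `f^n_fin`, obtained by applying `n` times
`f ↦ ((x, v, t) ↦ (f x, t⁻¹ (f (x + tv) - f x), t))` resp. `f ↦ f × id`. They are meaningful on the
finite part (`Ring.inverse t` is `t⁻¹` if `t` is invertible). -/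
noncomputable def finMap (f : V → W) : {n : ℕ} → (A : Vtx n) → Amb K V A → Amb K W A
  | _, .empty => fun x => f x
  | _, .old A => fun (y, t) => (finMap f A y, t)
  | _, .new A => fun (y, w, t) =>
    (finMap f A y, Ring.inverse t • (finMap f A (y + t • w) - finMap f A y), t)

variable {K}

/-- `F : U^n → U'^n` is a continuous morphism of `n`-fold groupoids which extends `f^n_fin`. -/
def ContinuouslyExtends [TopologicalSpace K] [TopologicalSpace V] [TopologicalSpace W] {n : ℕ}
    {U : Set V} {U' : Set W} (F : CubeHom (tangentCube K n U) (tangentCube K n U'))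
    (f : V → W) : Prop :=
  (∀ A : Vtx n, Continuous (fun p : ext K U A => val (F.map A p))) ∧
  ∀ (A : Vtx n) (p : ext K U A), (p : Amb K V A) ∈ finExt K U A →
    val (F.map A p) = finMap K f A p

end calculus

/-! ### Manifolds -/

section manifolds

/-- `𝒜` is an atlas of class `C^n` over `K`, with values in the topological `K`-module `V`, of the
topological space `M`. -/
structure IsAtlas (K : Type u) {V M : Type u} [CommRing K] [AddCommGroup V] [Module K V]
    [TopologicalSpace K] [TopologicalSpace V] [TopologicalSpace M] (n : ℕ)
    (𝒜 : Set (OpenPartialHomeomorph M V)) : Prop where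
  exists_mem_source : ∀ x : M, ∃ φ ∈ 𝒜, x ∈ φ.source
  isC_transition : ∀ φ ∈ 𝒜, ∀ ψ ∈ 𝒜, IsC K n (φ.symm.trans ψ).source (φ.symm.trans ψ)

/-- The component in `V` of a point of `V^{∅;n} = V × K^n`. -/
def groundPt (K V : Type u) : (n : ℕ) → Amb K V (Vtx.bot n) → V
  | 0, x => x
  | n + 1, p => groundPt K V n (Prod.fst (α := Amb K V (Vtx.bot n)) (β := K) p)

/-- The component in `K^n` of a point of `V^{∅;n} = V × K^n`. -/
def groundScal (K V : Type u) : (n : ℕ) → Amb K V (Vtx.bot n) → Fin n → K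
  | 0, _ => Fin.elim0
  | n + 1, p => Fin.snoc (α := fun _ => K)
      (groundScal K V n (Prod.fst (α := Amb K V (Vtx.bot n)) (β := K) p))
      (Prod.snd (α := Amb K V (Vtx.bot n)) (β := K) p)

variable {K V M : Type u} [CommRing K] [AddCommGroup V] [Module K V]
  [TopologicalSpace K] [TopologicalSpace V] [TopologicalSpace M]

theorem transition_source_subset (φ ψ : OpenPartialHomeomorph M V) :
    (φ.symm.trans ψ).source ⊆ φ.target := fun _ hx => by
  rw [OpenPartialHomeomorph.trans_source] at hx
  exact hx.1

/-- `G` is an `n`-fold tangent groupoid `M^n` of the manifold `M` with atlas `𝒜`: an `n`-fold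
groupoid over `M × K^n` which is glued together from the local `n`-fold groupoids `U^n`, where `U`
runs through the images of the charts `φ ∈ 𝒜`. Here `base` identifies the vertex set
`G^∅` with `M × K^n`, and `ι φ : U^n → G` is the inclusion belonging to the chart `φ`. -/
structure IsTangentGroupoid {n : ℕ} (𝒜 : Set (OpenPartialHomeomorph M V)) (G : CubeData.{u} n)
    (base : G.cell (Vtx.bot n) ≃ M × (Fin n → K))
    (ι : ∀ φ : 𝒜, CubeHom (tangentCube K n φ.1.target) G) : Prop where
  isNFoldGroupoid : G.IsNFoldGroupoid
  /-- On objects, `ι φ` is the inverse of the chart `φ`. -/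
  base_ι : ∀ (φ : 𝒜) (p : ext K φ.1.target (Vtx.bot n)),
    base ((ι φ).map (Vtx.bot n) p) = (φ.1.symm (groundPt K V n p), groundScal K V n p)
  /-- The local `n`-fold groupoids are embedded. -/
  injective : ∀ (φ : 𝒜) (A : Vtx n), Function.Injective ((ι φ).map A)
  /-- The local `n`-fold groupoids are glued along the prolongations `τ^n` of the transition maps
  `τ = ψ ∘ φ⁻¹`. -/
  compat : ∀ φ ψ : 𝒜, ∃ T : CubeHom (tangentCube K n (φ.1.symm.trans ψ.1).source)
      (tangentCube K n ψ.1.target),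
    ContinuouslyExtends T (φ.1.symm.trans ψ.1) ∧
    ∀ (A : Vtx n) (p : ext K (φ.1.symm.trans ψ.1).source A),
      (ι φ).map A ⟨p.1, ext_mono (transition_source_subset φ.1 ψ.1) A p.2⟩
        = (ι ψ).map A (T.map A p)
  /-- The local `n`-fold groupoids generate `G`. -/
  generated : ∀ S : ∀ A : Vtx n, Set (G.cell A), G.IsSub S →
    (∀ (φ : 𝒜) (A : Vtx n), Set.range ((ι φ).map A) ⊆ S A) → ∀ A, S A = Set.univ
  /-- If there is a chart identifying `M` with an open subset `U` of `V`, then `M^n` is `U^n`. -/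
  bijective_of_global : ∀ φ : 𝒜, φ.1.source = Set.univ →
    ∀ A : Vtx n, Function.Bijective ((ι φ).map A)

end manifolds

end FullCubic

/-! A cell of `U^n` has `2^n` vertices in `V × K^n`, namely its iterated sources and targets
(`vtx`). On vertices every structure map is what it is in the iterated pair groupoid: passing to a
face, degenerating, reflecting, or gluing along a common face. If all scalars of a cell are
invertible, one can divide by them, and the cell is determined by its vertices (`vtx_injective`). So
the finite part lives in a pair groupoid, where every map acts functorially. Since units are dense,
the finite part is dense in `U^n` for open `U` (`ext_subset_closure_finExt`). More precisely, a cell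
whose vertices in a lower set are finite is a limit of finite cells with the same vertices there
(`mem_closure_finExt`). Hence finite composable pairs are dense among composable pairs
(`composable_subset_closure`).

Part (A), forward: each direction of the cube costs one order of differentiability, and a map of
class `C^n` prolongs continuously to all vertex sets (`exists_prolongation`). Functoriality holds on
finite cells and passes to the limit. Conversely, the extension on the cell in one direction
provides `f^[1]`. A density argument shows that the remaining extensions of `f` are extensions of
the prolongations of `f^[1]`, which allows induction (`extends_prolong`, `Extends.isC`).

Part (B): the union of the chart groupoids is not closed under products, since composable cells may
come from different charts, and a common home is needed in which all cells can be multiplied. A cell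
`a` of a chart `φ` is encoded by the set `nets φ a` of all nets of finite cells converging to `a`,
recorded through their vertices in `M × K^n`. This set does not depend on the chart
(`exists_transition`), determines `a` up to topological inseparability (`inseparable_of_mem_nets`),
and turns the structure maps of `U^n` into setwise operations in a pair groupoid (`mulSet_nets`,
`invSet_nets`). Arbitrary sets of cubes violate the unit and interchange laws. These laws hold for
regular sets: cosets in each direction whose elements can be glued along faces. Sets of nets are
regular (`isRegular_nets`), and regularity survives products of matching sets (`IsRegular.mulSet`).
Therefore the sets generated by the charts form an `n`-fold groupoid.

Two devices recur. The topology of `K` need not be Hausdorff, so limits do not determine scalar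
components; these are tracked separately by `scal`. Cells at all vertices of the hypercube are
compared as degenerate top cells (`up`), so that units become invisible on the level of sets. The
algebraic laws in a derived direction are the same laws over `K[ε]/(ε² - tε)`. The only law that
requires dividing by `t` is the cocycle identity `tgtMap_cocycle`, which is first proved where `t`
is regular. -/

namespace FullCubic

/-! ### Sets of cubes in the `n`-fold pair groupoid

For a set `D` of directions, the maps `(D → Bool) → Z` are the top cells of the iterated pair
groupoid of `Z`. The product of two such cells in direction `i` glues them along a face. We
study the induced operations on sets of cells. -/

section cubeSets

open Function

variable {D Z : Type*} [DecidableEq D]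

/-- The face `i = 0` of `x` is the face `i = 1` of `y`. -/
def Composable (i : D) (x y : (D → Bool) → Z) : Prop :=
  ∀ ε, x (update ε i false) = y (update ε i true)

/-- The product of `x` and `y` in direction `i`. -/
def stack (i : D) (x y : (D → Bool) → Z) : (D → Bool) → Z := fun ε => if ε i then x ε else y ε

/-- The inverse of `x` in direction `i`. -/
def flipAt (i : D) (x : (D → Bool) → Z) : (D → Bool) → Z := fun ε => x (update ε i (!ε i))

/-- The set of all products in direction `i`. -/
def mulSet (i : D) (X Y : Set ((D → Bool) → Z)) : Set ((D → Bool) → Z) :=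
  {z | ∃ x ∈ X, ∃ y ∈ Y, Composable i x y ∧ z = stack i x y}

/-- The set of all inverses in direction `i`. -/
def invSet (i : D) (X : Set ((D → Bool) → Z)) : Set ((D → Bool) → Z) := {x | flipAt i x ∈ X}

/-- The source `X⁻¹ ∗ X` of `X`. -/
def srcSet (i : D) (X : Set ((D → Bool) → Z)) : Set ((D → Bool) → Z) := mulSet i (invSet i X) X

/-- The target `X ∗ X⁻¹` of `X`. -/
def tgtSet (i : D) (X : Set ((D → Bool) → Z)) : Set ((D → Bool) → Z) := mulSet i X (invSet i X)

theorem flipAt_flipAt (i : D) (x : (D → Bool) → Z) : flipAt i (flipAt i x) = x := by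
  funext ε; simp [flipAt]

theorem flipAt_comm (i j : D) (x : (D → Bool) → Z) :
    flipAt i (flipAt j x) = flipAt j (flipAt i x) := by
  rcases eq_or_ne i j with rfl | h
  · rfl
  · funext ε; simp [flipAt, update_of_ne h, update_of_ne h.symm, update_comm h]

theorem invSet_invSet (i : D) (X : Set ((D → Bool) → Z)) : invSet i (invSet i X) = X := by
  ext x; simp [invSet, flipAt_flipAt]

theorem invSet_comm (i j : D) (X : Set ((D → Bool) → Z)) :
    invSet i (invSet j X) = invSet j (invSet i X) := by
  ext x; simp only [invSet, mem_ofPred_eq, flipAt_comm i j x]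

theorem flipAt_mem_invSet {i : D} {X : Set ((D → Bool) → Z)} {x} (hx : x ∈ X) :
    flipAt i x ∈ invSet i X := by
  simpa [invSet, flipAt_flipAt] using hx

theorem mulSet_mono {i : D} {X X' Y Y' : Set ((D → Bool) → Z)} (h : X ⊆ X') (h' : Y ⊆ Y') :
    mulSet i X Y ⊆ mulSet i X' Y' := by
  rintro _ ⟨x, hx, y, hy, hxy, rfl⟩
  exact ⟨x, h hx, y, h' hy, hxy, rfl⟩

/-- Both bracketings test the same two pairs of faces, so no regularity is needed here, in contrast
to the interchange law. -/
theorem mulSet_assoc (i : D) (X Y W : Set ((D → Bool) → Z)) :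
    mulSet i (mulSet i X Y) W = mulSet i X (mulSet i Y W) := by
  ext z; constructor
  · rintro ⟨_, ⟨x, hx, y, hy, hxy, rfl⟩, w, hw, h, rfl⟩
    have h' : Composable i y w := fun ε => by simpa [stack] using h ε
    refine ⟨x, hx, _, ⟨y, hy, w, hw, h', rfl⟩, fun ε => by simpa [stack] using hxy ε, ?_⟩
    funext ε; simp only [stack]; split_ifs <;> rfl
  · rintro ⟨x, hx, _, ⟨y, hy, w, hw, h, rfl⟩, hxy, rfl⟩
    have h' : Composable i x y := fun ε => by simpa [stack] using hxy ε
    refine ⟨_, ⟨x, hx, y, hy, h', rfl⟩, w, hw, fun ε => by simpa [stack] using h ε, ?_⟩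
    funext ε; simp only [stack]; split_ifs <;> rfl

theorem invSet_mulSet_self (i : D) (X Y : Set ((D → Bool) → Z)) :
    invSet i (mulSet i X Y) = mulSet i (invSet i Y) (invSet i X) := by
  ext z; constructor
  · rintro ⟨x, hx, y, hy, hxy, hz⟩
    refine ⟨flipAt i y, flipAt_mem_invSet hy, flipAt i x, flipAt_mem_invSet hx,
      fun ε => by simpa [flipAt] using (hxy ε).symm, ?_⟩
    rw [← flipAt_flipAt i z, hz]
    funext ε; cases h : ε i <;> simp [flipAt, stack, h]
  · rintro ⟨y, hy, x, hx, hxy, rfl⟩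
    refine ⟨_, hx, _, hy, fun ε => by simpa [flipAt] using (hxy ε).symm, ?_⟩
    funext ε; cases h : ε i <;> simp [flipAt, stack, h]

theorem invSet_mulSet_subset {i j : D} (h : i ≠ j) (X Y : Set ((D → Bool) → Z)) :
    mulSet i (invSet j X) (invSet j Y) ⊆ invSet j (mulSet i X Y) := by
  rintro _ ⟨x, hx, y, hy, hxy, rfl⟩
  refine ⟨_, hx, _, hy, fun ε => ?_, ?_⟩
  · have := hxy (update ε j (!ε j))
    simpa [flipAt, update_of_ne h.symm, update_comm h.symm] using this
  · funext ε; simp [flipAt, stack, update_of_ne h]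

/-- Reflecting in `j` leaves faces in direction `i` faces, which gives one inclusion; applying it to
the reflected sets gives the other, since reflections are involutions. -/
theorem invSet_mulSet {i j : D} (h : i ≠ j) (X Y : Set ((D → Bool) → Z)) :
    invSet j (mulSet i X Y) = mulSet i (invSet j X) (invSet j Y) := by
  refine Subset.antisymm (fun z hz => ?_) (invSet_mulSet_subset h X Y)
  have := invSet_mulSet_subset h (invSet j X) (invSet j Y)
  rw [invSet_invSet, invSet_invSet] at this
  have h2 : flipAt j z ∈ mulSet i X Y := hz
  simpa [invSet, flipAt_flipAt] using this h2

theorem srcSet_invSet_self (i : D) (X : Set ((D → Bool) → Z)) :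
    srcSet i (invSet i X) = tgtSet i X := by
  rw [srcSet, invSet_invSet, tgtSet]

theorem tgtSet_invSet_self (i : D) (X : Set ((D → Bool) → Z)) :
    tgtSet i (invSet i X) = srcSet i X := by
  rw [tgtSet, invSet_invSet, srcSet]

theorem srcSet_invSet {i j : D} (h : i ≠ j) (X : Set ((D → Bool) → Z)) :
    srcSet i (invSet j X) = invSet j (srcSet i X) := by
  rw [srcSet, srcSet, invSet_mulSet h, invSet_comm]

theorem tgtSet_invSet {i j : D} (h : i ≠ j) (X : Set ((D → Bool) → Z)) :
    tgtSet i (invSet j X) = invSet j (tgtSet i X) := by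
  rw [tgtSet, tgtSet, invSet_mulSet h, invSet_comm]

theorem invSet_tgtSet_self (i : D) (X : Set ((D → Bool) → Z)) :
    invSet i (tgtSet i X) = tgtSet i X := by
  rw [tgtSet, invSet_mulSet_self, invSet_invSet]

theorem invSet_srcSet_self (i : D) (X : Set ((D → Bool) → Z)) :
    invSet i (srcSet i X) = srcSet i X := by
  rw [srcSet, invSet_mulSet_self, invSet_invSet]

/-! ### Cosets, gluing and regular sets of cubes -/

/-- `X` is stable under gluing along lower sets of vertices. -/
def Gluable (X : Set ((D → Bool) → Z)) : Prop :=
  ∀ R R' : Set (D → Bool), IsLowerSet R → IsLowerSet R' → ∀ x ∈ X, ∀ x' ∈ X,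
    (∀ ε ∈ R, ε ∈ R' → x ε = x' ε) → ∃ z ∈ X, (∀ ε ∈ R, z ε = x ε) ∧ ∀ ε ∈ R', z ε = x' ε

/-- `X` is a coset: `X ∗ X⁻¹ ∗ X ⊆ X`. -/
def IsCoset (i : D) (X : Set ((D → Bool) → Z)) : Prop := mulSet i (tgtSet i X) X ⊆ X

/-- `X` and its reflections are gluable, and `X` is a coset in each direction. -/
structure IsRegular (X : Set ((D → Bool) → Z)) : Prop where
  gluable : ∀ l : List D, Gluable (l.foldl (fun X i => invSet i X) X)
  isCoset : ∀ i, IsCoset i X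

/-- Since `x = x ∗ x⁻¹ ∗ x`. Only the reverse inclusion is a condition on `X`, and it is what makes
`X ∗ X⁻¹` act as a unit. -/
theorem subset_tgtSet_mul (i : D) (X : Set ((D → Bool) → Z)) : X ⊆ mulSet i (tgtSet i X) X := by
  intro x hx
  refine ⟨_, ⟨x, hx, _, flipAt_mem_invSet hx, fun ε => by simp [flipAt], rfl⟩, x, hx,
    fun ε => by simp [stack, flipAt], ?_⟩
  funext ε; simp only [stack]; split_ifs <;> rfl

theorem IsCoset.tgtSet_mul {i : D} {X : Set ((D → Bool) → Z)} (h : IsCoset i X) :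
    mulSet i (tgtSet i X) X = X := Subset.antisymm h (subset_tgtSet_mul i X)

theorem IsCoset.mul_srcSet {i : D} {X : Set ((D → Bool) → Z)} (h : IsCoset i X) :
    mulSet i X (srcSet i X) = X := by
  conv_rhs => rw [← h.tgtSet_mul]
  rw [tgtSet, srcSet, mulSet_assoc]

theorem IsCoset.invSet_self {i : D} {X : Set ((D → Bool) → Z)} (h : IsCoset i X) :
    IsCoset i (invSet i X) := by
  rw [IsCoset, tgtSet_invSet_self, ← invSet_srcSet_self, ← invSet_mulSet_self, h.mul_srcSet]

theorem IsCoset.invSet {i : D} {X : Set ((D → Bool) → Z)} (h : IsCoset i X) (j : D) :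
    IsCoset i (invSet j X) := by
  rcases eq_or_ne i j with rfl | hij
  · exact h.invSet_self
  · rw [IsCoset, tgtSet_invSet hij, ← invSet_mulSet hij, h.tgtSet_mul]

theorem IsRegular.invSet {X : Set ((D → Bool) → Z)} (h : IsRegular X) (j : D) :
    IsRegular (invSet j X) :=
  ⟨fun l => h.gluable (j :: l), fun i => (h.isCoset i).invSet j⟩

theorem IsCoset.tgtSet_mul_tgtSet {i : D} {X : Set ((D → Bool) → Z)} (h : IsCoset i X) :
    mulSet i (tgtSet i X) (tgtSet i X) = tgtSet i X := by
  conv_lhs => rw [tgtSet, ← mulSet_assoc, ← tgtSet, h.tgtSet_mul, ← tgtSet]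

theorem IsCoset.srcSet_tgtSet {i : D} {X : Set ((D → Bool) → Z)} (h : IsCoset i X) :
    srcSet i (tgtSet i X) = tgtSet i X := by
  rw [srcSet, invSet_tgtSet_self, h.tgtSet_mul_tgtSet]

/-- By associativity `(X ∗ Y)⁻¹ ∗ (X ∗ Y) = Y⁻¹ ∗ (X⁻¹ ∗ X) ∗ Y`. The middle factor is `Y ∗ Y⁻¹`,
which is absorbed because `Y` is a coset. -/
theorem srcSet_mulSet_self {i : D} {X Y : Set ((D → Bool) → Z)} (hY : IsCoset i Y)
    (h : srcSet i X = tgtSet i Y) : srcSet i (mulSet i X Y) = srcSet i Y := by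
  rw [srcSet, invSet_mulSet_self, mulSet_assoc, ← mulSet_assoc i (FullCubic.invSet i X), ← srcSet, h,
    hY.tgtSet_mul, ← srcSet]

theorem tgtSet_mulSet_self {i : D} {X Y : Set ((D → Bool) → Z)} (hX : IsCoset i X)
    (h : srcSet i X = tgtSet i Y) : tgtSet i (mulSet i X Y) = tgtSet i X := by
  rw [tgtSet, invSet_mulSet_self, mulSet_assoc, ← mulSet_assoc i Y, ← tgtSet, ← h,
    ← mulSet_assoc, hX.mul_srcSet, ← tgtSet]

theorem IsCoset.mulSet_self {i : D} {X Y : Set ((D → Bool) → Z)} (hX : IsCoset i X)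
    (h : srcSet i X = tgtSet i Y) : IsCoset i (mulSet i X Y) := by
  rw [IsCoset, tgtSet_mulSet_self hX h, ← mulSet_assoc, hX.tgtSet_mul]

/-- Completion of `y` in direction `i` by a cell of `Z` with the same source. -/
theorem exists_of_srcSet_eq {i : D} {Y W : Set ((D → Bool) → Z)} (h : srcSet i Y = tgtSet i W)
    {z z' : (D → Bool) → Z} (hz : z ∈ W) (hz' : z' ∈ W) (hzz : ∀ ε, ε i = false → z ε = z' ε) :
    ∃ y ∈ Y, ∃ y' ∈ Y, (∀ ε, ε i = true → y ε = y' ε) ∧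
      (∀ ε, ε i = false → y ε = z (update ε i true)) ∧
      (∀ ε, ε i = false → y' ε = z' (update ε i true)) := by
  have hm : stack i z (flipAt i z') ∈ srcSet i Y := by
    rw [h]
    exact ⟨z, hz, _, flipAt_mem_invSet hz',
      fun ε => by simpa [flipAt] using hzz (update ε i false) (by simp), rfl⟩
  obtain ⟨y, hy, y', hy', hyy, he⟩ := hm
  refine ⟨_, hy, y', hy', fun ε hε => ?_, fun ε hε => ?_, fun ε hε => ?_⟩
  · have := hyy ε
    rw [← hε, update_eq_self] at this
    simpa [flipAt, hε] using this
  · have := congrFun he (update ε i true)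
    simp only [stack, update_self, if_true] at this
    simpa [flipAt, hε] using this.symm
  · have := congrFun he ε
    simp only [stack, hε] at this
    simpa [flipAt, hε] using this.symm

/-- The element in question is `x₁ ∗ x₂⁻¹ ∗ x₃`: its faces are the target face of `x₁` and the
source face of `x₃`. -/
theorem IsCoset.mem {i : D} {X : Set ((D → Bool) → Z)} (h : IsCoset i X) {x₁ x₂ x₃}
    (h₁ : x₁ ∈ X) (h₂ : x₂ ∈ X) (h₃ : x₃ ∈ X) (h₁₂ : ∀ ε, ε i = false → x₁ ε = x₂ ε)
    (h₂₃ : ∀ ε, ε i = true → x₂ ε = x₃ ε) : stack i x₁ x₃ ∈ X := by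
  refine h ⟨_, ⟨x₁, h₁, _, flipAt_mem_invSet h₂, fun ε => ?_, rfl⟩, x₃, h₃, fun ε => ?_, ?_⟩
  · simpa [flipAt] using h₁₂ (update ε i false) (by simp)
  · simpa [stack, flipAt] using h₂₃ (update ε i true) (by simp)
  · funext ε; simp only [stack]; split_ifs <;> rfl

/-- `y ∗ z ∗ z'⁻¹` belongs to `Y`. -/
theorem IsCoset.stack_mem {i : D} {Y W : Set ((D → Bool) → Z)} (hY : IsCoset i Y)
    (h : srcSet i Y = tgtSet i W) {y z z' : (D → Bool) → Z} (hy : y ∈ Y) (hz : z ∈ W)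
    (hz' : z' ∈ W) (hyz : Composable i y z) (hzz : ∀ ε, ε i = false → z ε = z' ε) :
    stack i y (fun ε => z' (update ε i true)) ∈ Y := by
  obtain ⟨y₁, hy₁, y₂, hy₂, h₁₂, h₁, h₂⟩ := exists_of_srcSet_eq h hz hz' hzz
  have : stack i y y₂ ∈ Y := hY.mem hy hy₁ hy₂
    (fun ε hε => by
      rw [h₁ ε hε]
      have := hyz ε
      rwa [← hε, update_eq_self] at this) h₁₂
  convert this using 1
  funext ε
  cases hε : ε i
  · simp [stack, hε, h₂ ε hε]
  · simp [stack, hε]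

/-- `z'⁻¹ ∗ z ∗ w` belongs to `W`. -/
theorem IsCoset.stack_mem' {i : D} {V W : Set ((D → Bool) → Z)} (hW : IsCoset i W)
    (h : srcSet i V = tgtSet i W) {z z' w : (D → Bool) → Z} (hz : z ∈ V) (hz' : z' ∈ V)
    (hw : w ∈ W) (hzw : Composable i z w) (hzz : ∀ ε, ε i = true → z ε = z' ε) :
    stack i (fun ε => z' (update ε i false)) w ∈ W := by
  have hs : srcSet i (FullCubic.invSet i W) = tgtSet i (FullCubic.invSet i V) := by
    rw [srcSet_invSet_self, tgtSet_invSet_self, h]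
  have := hW.invSet_self.stack_mem hs (flipAt_mem_invSet hw) (flipAt_mem_invSet hz)
    (flipAt_mem_invSet hz') (fun ε => by simpa [flipAt] using (hzw ε).symm)
    (fun ε hε => by simpa [flipAt, hε] using hzz (update ε i true) (by simp))
  have h2 : flipAt i (stack i (flipAt i w) fun ε => flipAt i z' (update ε i true)) ∈ W := this
  convert h2 using 1
  funext ε
  have he : ε i = false → update ε i false = ε := fun hε => by rw [← hε, update_eq_self]
  cases hε : ε i <;> simp [stack, flipAt, hε, he]

theorem isLowerSet_update_mem {R : Set (D → Bool)} (hR : IsLowerSet R) (k : D) :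
    IsLowerSet {ε | update ε k true ∈ R} := fun ε ε' h hε =>
  hR (update_le_update_iff.2 ⟨le_rfl, fun j _ => h j⟩) hε

theorem isLowerSet_face (k : D) : IsLowerSet {ε : D → Bool | ε k = false} := fun ε ε' h hε => by
  have := h k
  rw [mem_ofPred_eq] at hε
  rw [hε] at this
  exact le_bot_iff.1 this

theorem mem_of_update_true {R : Set (D → Bool)} (hR : IsLowerSet R) {k : D} {ε : D → Bool}
    (h : update ε k true ∈ R) : ε ∈ R := hR (le_update_iff.2 ⟨Bool.le_true _, fun _ _ => le_rfl⟩) h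

/-- The face along which two factors meet is invisible in their product, so the factorizations of
two products that agree on `R ∩ R'` need not agree there. The coset property allows `y' ∗ z'` to be
refactored so that the hidden faces agree where required. After that, the factors are glued
separately, and the glued left factor is corrected to match the glued right one. -/
theorem Gluable.mulSet {k : D} {Y W : Set ((D → Bool) → Z)} (hY : Gluable Y) (hW : Gluable W)
    (hc : IsCoset k Y) (h : srcSet k Y = tgtSet k W) : Gluable (mulSet k Y W) := by
  rintro R R' hR hR' _ ⟨y, hy, z, hz, hyz, rfl⟩ _ ⟨y', hy', z', hz', hyz', rfl⟩ hx
  have hf : ∀ ε : D → Bool, ε k = false → update ε k false = ε := fun ε hε => by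
    rw [← hε, update_eq_self]
  have ht : ∀ ε : D → Bool, ε k = true → update ε k true = ε := fun ε hε => by
    rw [← hε, update_eq_self]
  -- change the decomposition of the second product
  obtain ⟨z₂, hz₂, h₂, h₂'⟩ := hW {ε | ε k = false}
    ({ε | update ε k true ∈ R} ∩ {ε | update ε k true ∈ R'}) (isLowerSet_face k)
    ((isLowerSet_update_mem hR k).inter (isLowerSet_update_mem hR' k)) z' hz' z hz
    (fun ε hε hε' => by
      have := hx ε (mem_of_update_true hR hε'.1) (mem_of_update_true hR' hε'.2)
      rw [mem_ofPred_eq] at hε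
      simpa [stack, hε] using this.symm)
  have hy₂ := hc.stack_mem h hy' hz' hz₂ hyz' fun ε hε => (h₂ ε hε).symm
  set y₂ := stack k y' fun ε => z₂ (update ε k true) with hy₂def
  -- Glue the right factors. Their vertices with `ε k = true` are hidden, which is why `z₂` was
  -- chosen to agree with `z` at those lying in both lower sets.
  obtain ⟨q, hq, hqR, hqR'⟩ := hW R R' hR hR' z hz z₂ hz₂ (fun ε hε hε' => by
    cases hk : ε k
    · rw [h₂ ε hk]; simpa [stack, hk] using hx ε hε hε'
    · exact (h₂' ε ⟨by simpa [ht ε hk] using hε, by simpa [ht ε hk] using hε'⟩).symm)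
  obtain ⟨p₁, hp₁, hp₁R, hp₁R'⟩ := hY _ _ (isLowerSet_update_mem hR k)
    (isLowerSet_update_mem hR' k) y hy y₂ hy₂ (fun ε hε hε' => by
      cases hk : ε k
      · have := hyz ε
        rw [hf ε hk] at this
        simp only [hy₂def, stack, hk]
        rw [this, h₂' _ ⟨by simpa using hε, by simpa using hε'⟩]
        simp
      · rw [mem_ofPred_eq, ht ε hk] at hε hε'
        simpa [hy₂def, stack, hk] using hx ε hε hε')
  -- The glued left factor `p₁` matches `q` only over the given lower sets. An element `p₂` whose
  -- whole source is the target of `q` is glued to it along the face `k = 0`.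
  obtain ⟨p₂, hp₂, _, -, -, hp₂q, -⟩ := exists_of_srcSet_eq h hq hq fun _ _ => rfl
  obtain ⟨p, hp, hpp₁, hpp₂⟩ := hY _ _
    ((isLowerSet_update_mem hR k).union (isLowerSet_update_mem hR' k)) (isLowerSet_face k)
    p₁ hp₁ p₂ hp₂ (fun ε hε hk => by
      rw [mem_ofPred_eq] at hk
      rw [hp₂q ε hk]
      rcases hε with hε | hε
      · have := hyz ε
        rw [hf ε hk] at this
        rw [hp₁R ε hε, hqR _ hε, this]
      · rw [hp₁R' ε hε, hqR' _ hε]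
        simp [hy₂def, stack, hk])
  refine ⟨_, ⟨p, hp, q, hq, fun ε => ?_, rfl⟩, fun ε hε => ?_, fun ε hε => ?_⟩
  · rw [hpp₂ _ (by simp), hp₂q _ (by simp)]; simp
  · cases hk : ε k
    · simpa [stack, hk] using hqR ε hε
    · have : update ε k true ∈ R := by rwa [ht ε hk]
      simp only [stack, hk, if_true]
      rw [hpp₁ ε (Or.inl this), hp₁R ε this]
  · cases hk : ε k
    · simpa [stack, hk, h₂ ε hk] using hqR' ε hε
    · have : update ε k true ∈ R' := by rwa [ht ε hk]
      simp only [stack, hk, if_true]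
      rw [hpp₁ ε (Or.inr this), hp₁R' ε this]
      simp [hy₂def, stack, hk]

theorem Gluable.corner {X : Set ((D → Bool) → Z)} (h : Gluable X) (i j : D) {x x' : (D → Bool) → Z}
    (hx : x ∈ X) (hx' : x' ∈ X) (hxx : ∀ ε, ε i = false → ε j = false → x ε = x' ε) :
    ∃ z ∈ X, (∀ ε, ε i = false → z ε = x ε) ∧ ∀ ε, ε j = false → z ε = x' ε :=
  h _ _ (isLowerSet_face i) (isLowerSet_face j) x hx x' hx' hxx

/-- Reflecting in both `i` and `j` turns upper faces into lower faces. This is why regularity asks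
that all reflections of `X` be gluable. -/
theorem IsRegular.corner {X : Set ((D → Bool) → Z)} (h : IsRegular X) {i j : D} (hij : i ≠ j)
    {x x' : (D → Bool) → Z} (hx : x ∈ X) (hx' : x' ∈ X)
    (hxx : ∀ ε, ε i = true → ε j = true → x ε = x' ε) :
    ∃ z ∈ X, (∀ ε, ε i = true → z ε = x ε) ∧ ∀ ε, ε j = true → z ε = x' ε := by
  have hm : ∀ {y}, y ∈ X → flipAt j (flipAt i y) ∈ FullCubic.invSet j (FullCubic.invSet i X) :=
    fun hy => flipAt_mem_invSet (flipAt_mem_invSet hy)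
  have hv : ∀ (y : (D → Bool) → Z) ε, flipAt j (flipAt i y) ε
      = y (update (update ε j (!ε j)) i (!ε i)) := fun y ε => by
    simp [flipAt, update_of_ne hij]
  obtain ⟨z, hz, h₁, h₂⟩ := (h.gluable [i, j]).corner i j (hm hx) (hm hx') (fun ε hi hj => by
    rw [hv, hv]
    exact hxx _ (by simp [hi]) (by simp [update_of_ne hij.symm, hj]))
  refine ⟨_, hz, fun ε hε => ?_, fun ε hε => ?_⟩
  · simp only [flipAt, update_of_ne hij.symm]
    rw [h₁ _ (by simp [update_of_ne hij, hε]), hv]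
    congr 1
    funext k
    by_cases hk : k = i
    · subst hk; simp [update_of_ne hij]
    · by_cases hk' : k = j
      · subst hk'; simp [update_of_ne hij.symm]
      · simp [update_of_ne hk, update_of_ne hk']
  · simp only [flipAt, update_of_ne hij.symm]
    rw [h₂ _ (by simp [hε]), hv]
    congr 1
    funext k
    by_cases hk : k = i
    · subst hk; simp [update_of_ne hij]
    · by_cases hk' : k = j
      · subst hk'; simp [update_of_ne hij.symm]
      · simp [update_of_ne hk, update_of_ne hk']

/-- The hypothesis matches `x ∗ y` with `v ∗ w` only on their outer halves; the inner faces, where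
`x` meets `y` and `v` meets `w`, need not match in direction `i`. The pair `(v, w)` is replaced by
`(v', w')` with the same product in direction `j`, where `v'` has as its target in direction `i` the
source of `x`, and `w' = v'⁻¹ ∗ v ∗ w`. -/
theorem interchange_subset {i j : D} (hij : i ≠ j) {X Y V W : Set ((D → Bool) → Z)}
    (hV : IsRegular V) (hW : IsCoset j W) (hXV : srcSet i X = tgtSet i V)
    (hVW : srcSet j V = tgtSet j W) :
    mulSet i (mulSet j X Y) (mulSet j V W) ⊆ mulSet j (mulSet i X V) (mulSet i Y W) := by
  rintro _ ⟨_, ⟨x, hx, y, hy, hxy, rfl⟩, _, ⟨v, hv, w, hw, hvw, rfl⟩, h, rfl⟩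
  have hx' : flipAt i x ∈ FullCubic.invSet i X := flipAt_mem_invSet hx
  have hs : srcSet i (FullCubic.invSet i V) = tgtSet i (FullCubic.invSet i X) := by
    rw [srcSet_invSet_self, tgtSet_invSet_self, hXV]
  obtain ⟨v₁', hv₁', _, -, -, hv₁x', -⟩ := exists_of_srcSet_eq hs hx' hx' fun _ _ => rfl
  have hv₁x : ∀ ε, ε i = true → flipAt i v₁' ε = x (update ε i false) := fun ε hε => by
    have := hv₁x' (update ε i false) (by simp)
    simpa [flipAt, hε] using this
  -- `flipAt i v₁'` has the required target in direction `i`. It is joined with the visible face `j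
  -- = 1` of `v`; the two agree on the common edge because `x ∗ y` and `v ∗ w` are composable.
  obtain ⟨v', hv', hv'i, hv'j⟩ := hV.corner hij (x := flipAt i v₁') hv₁' hv (fun ε hi hj => by
    rw [hv₁x ε hi]
    have := h ε
    simp only [stack, update_of_ne hij.symm, hj, if_true] at this
    rw [this, ← hi, update_eq_self])
  have hw' := hW.stack_mem' hVW hv hv' hw hvw fun ε hε => (hv'j ε hε).symm
  set w' := stack j (fun ε => v' (update ε j false)) w with hw'def
  have hxv : Composable i x v' := fun ε => by
    rw [hv'i _ (by simp), hv₁x _ (by simp)]; simp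
  have hyw : Composable i y w' := fun ε => by
    cases hj : ε j
    · have := h ε
      simpa [stack, update_of_ne hij.symm, hj, hw'def] using this
    · simp only [hw'def, stack, update_of_ne hij.symm, hj, if_true]
      rw [update_comm hij, ← hxv, update_comm hij.symm, hxy, update_comm hij, ← hj,
        update_eq_self]
  refine ⟨_, ⟨x, hx, v', hv', hxv, rfl⟩, _, ⟨y, hy, w', hw', hyw, rfl⟩, fun ε => ?_, ?_⟩
  · simp only [stack, update_of_ne hij]
    split_ifs
    · exact hxy ε
    · simp [hw'def, stack]
  · funext ε
    simp only [stack]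
    cases hi : ε i <;> cases hj : ε j <;> simp [hw'def, stack, hj]
    exact (hv'j ε hj).symm

/-- A reflection of a product is a product of reflections, in reversed order if the reflection is in
direction `k`, so gluability follows by induction on the list of reflections. For `i ≠ k`, the coset
property follows factor by factor through two applications of interchange. -/
theorem IsRegular.mulSet {k : D} {Y W : Set ((D → Bool) → Z)} (hY : IsRegular Y) (hW : IsRegular W)
    (h : srcSet k Y = tgtSet k W) : IsRegular (mulSet k Y W) := by
  refine ⟨fun l => ?_, fun i => ?_⟩
  · induction l generalizing Y W with
    | nil => exact (hY.gluable []).mulSet (hW.gluable []) (hY.isCoset k) h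
    | cons i l ih =>
      simp only [List.foldl_cons]
      rcases eq_or_ne k i with rfl | hki
      · rw [invSet_mulSet_self]
        exact ih (hW.invSet k) (hY.invSet k) (by rw [srcSet_invSet_self, tgtSet_invSet_self, h])
      · rw [invSet_mulSet hki]
        exact ih (hY.invSet i) (hW.invSet i) (by rw [srcSet_invSet hki, tgtSet_invSet hki, h])
  · rcases eq_or_ne i k with rfl | hik
    · exact (hY.isCoset i).mulSet_self h
    · have h₁ : tgtSet i (FullCubic.mulSet k Y W)
          ⊆ FullCubic.mulSet k (tgtSet i Y) (tgtSet i W) := by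
        rw [tgtSet, invSet_mulSet hik.symm]
        exact interchange_subset hik (hY.invSet i) ((hW.isCoset k).invSet i)
          (tgtSet_invSet_self i Y).symm (by rw [srcSet_invSet hik.symm, tgtSet_invSet hik.symm, h])
      refine (mulSet_mono h₁ Subset.rfl).trans ?_
      refine (interchange_subset hik hY (hW.isCoset k) (hY.isCoset i).srcSet_tgtSet h).trans ?_
      exact mulSet_mono (hY.isCoset i) (hW.isCoset i)

theorem mulSet_interchange {i j : D} (hij : i ≠ j) {X Y V W : Set ((D → Bool) → Z)}
    (hY : IsRegular Y) (hV : IsRegular V) (hW : IsRegular W) (hXV : srcSet i X = tgtSet i V)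
    (hYW : srcSet i Y = tgtSet i W) (hXY : srcSet j X = tgtSet j Y)
    (hVW : srcSet j V = tgtSet j W) :
    mulSet i (mulSet j X Y) (mulSet j V W) = mulSet j (mulSet i X V) (mulSet i Y W) :=
  Subset.antisymm (interchange_subset hij hV (hW.isCoset j) hXV hVW)
    (interchange_subset hij.symm hY (hW.isCoset i) hXY hYW)

/-- An instance of interchange for the array formed by `X`, `Y` and their reflections in `i`; the
matching conditions between a set and its own reflection are automatic. -/
theorem srcSet_mulSet {i j : D} (hij : i ≠ j) {X Y : Set ((D → Bool) → Z)} (hX : IsRegular X)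
    (hY : IsRegular Y) (h : srcSet j X = tgtSet j Y) :
    srcSet i (mulSet j X Y) = mulSet j (srcSet i X) (srcSet i Y) := by
  rw [srcSet, invSet_mulSet hij.symm, mulSet_interchange hij (hY.invSet i) hX hY
    (srcSet_invSet_self i X) (srcSet_invSet_self i Y)
    (by rw [srcSet_invSet hij.symm, tgtSet_invSet hij.symm, h]) h]
  rfl

theorem tgtSet_mulSet {i j : D} (hij : i ≠ j) {X Y : Set ((D → Bool) → Z)} (hX : IsRegular X)
    (hY : IsRegular Y) (h : srcSet j X = tgtSet j Y) :
    tgtSet i (mulSet j X Y) = mulSet j (tgtSet i X) (tgtSet i Y) := by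
  rw [tgtSet, invSet_mulSet hij.symm, mulSet_interchange hij hY (hX.invSet i) (hY.invSet i)
    (tgtSet_invSet_self i X).symm (tgtSet_invSet_self i Y).symm h
    (by rw [srcSet_invSet hij.symm, tgtSet_invSet hij.symm, h])]
  rfl

theorem srcSet_srcSet {i j : D} (hij : i ≠ j) {X : Set ((D → Bool) → Z)} (hX : IsRegular X) :
    srcSet j (srcSet i X) = srcSet i (srcSet j X) := by
  rw [srcSet, srcSet, ← srcSet, srcSet_mulSet hij.symm (hX.invSet i) hX (srcSet_invSet_self i X),
    srcSet_invSet hij.symm]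
  rfl

theorem srcSet_tgtSet {i j : D} (hij : i ≠ j) {X : Set ((D → Bool) → Z)} (hX : IsRegular X) :
    srcSet j (tgtSet i X) = tgtSet i (srcSet j X) := by
  rw [tgtSet, srcSet_mulSet hij.symm hX (hX.invSet i) (tgtSet_invSet_self i X).symm,
    srcSet_invSet hij.symm]
  rfl

theorem tgtSet_tgtSet {i j : D} (hij : i ≠ j) {X : Set ((D → Bool) → Z)} (hX : IsRegular X) :
    tgtSet j (tgtSet i X) = tgtSet i (tgtSet j X) := by
  rw [tgtSet, tgtSet, ← tgtSet, tgtSet_mulSet hij.symm hX (hX.invSet i)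
    (tgtSet_invSet_self i X).symm, tgtSet_invSet hij.symm]
  rfl

end cubeSets

/-! ### Combinatorics of the hypercube -/

/-- The directions `1, …, n`. -/
inductive Dir : ℕ → Type
  | last {n : ℕ} : Dir (n + 1)
  | prev {n : ℕ} : Dir n → Dir (n + 1)
  deriving DecidableEq

/-- The direction of an edge. -/
def Edge.dir : {n : ℕ} → {B A : Vtx n} → Edge B A → Dir n
  | _, _, _, .last _ => .last
  | _, _, _, .old e => .prev e.dir
  | _, _, _, .new e => .prev e.dir

/-- The two-dimensional faces of the hypercube, with `e` parallel to `e'` and `f` to `f'`. -/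
inductive Face : {n : ℕ} → {D C B A : Vtx n} → Edge B A → Edge C A → Edge D B → Edge D C → Prop
  | lastNew {n : ℕ} {C A : Vtx n} (f : Edge C A) : Face (.last A) (.new f) (.old f) (.last C)
  | newLast {n : ℕ} {B A : Vtx n} (e : Edge B A) : Face (.new e) (.last A) (.last B) (.old e)
  | old {n : ℕ} {D C B A : Vtx n} {e : Edge B A} {f : Edge C A} {f' : Edge D B} {e' : Edge D C} :
      Face e f f' e' → Face (.old e) (.old f) (.old f') (.old e')
  | new {n : ℕ} {D C B A : Vtx n} {e : Edge B A} {f : Edge C A} {f' : Edge D B} {e' : Edge D C} :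
      Face e f f' e' → Face (.new e) (.new f) (.new f') (.new e')

theorem Edge.eq_of_same_ends : ∀ {n : ℕ} {B A : Vtx n} (e f : Edge B A), e = f
  | _, _, _, .last _, .last _ => rfl
  | _, _, _, .old e, .old f => by rw [eq_of_same_ends e f]
  | _, _, _, .new e, .new f => by rw [eq_of_same_ends e f]

/-- Squares of edges with `B ≠ C` are generated by those involving the last direction and by copies
of lower squares. Face laws can therefore be proved by induction on `Face`. -/
theorem face_of_ne : ∀ {n : ℕ} {D C B A : Vtx n} (e : Edge B A) (f : Edge C A) (f' : Edge D B)
    (e' : Edge D C), B ≠ C → Face e f f' e'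
  | _, _, _, _, _, .last _, .last _, _, _, h => (h rfl).elim
  | _, _, _, _, _, .last _, .new f, .old f', .last _, _ => by
    rw [Edge.eq_of_same_ends f' f]; exact .lastNew f
  | _, _, _, _, _, .new e, .last _, .last _, .old e', _ => by
    rw [Edge.eq_of_same_ends e' e]; exact .newLast e
  | _, _, _, _, _, .new e, .new f, .new f', .new e', h =>
    .new (face_of_ne e f f' e' fun hh => h (by rw [hh]))
  | _, _, _, _, _, .new e, .new f, .last _, .last _, h => (h rfl).elim
  | _, _, _, _, _, .old e, .old f, .old f', .old e', h =>
    .old (face_of_ne e f f' e' fun hh => h (by rw [hh]))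

theorem exists_face_of_ne : ∀ {n : ℕ} {C B A : Vtx n} (e : Edge B A) (f : Edge C A), B ≠ C →
    ∃ (D : Vtx n) (f' : Edge D B) (e' : Edge D C), Face e f f' e'
  | _, _, _, _, .last _, .last _, h => (h rfl).elim
  | _, _, _, _, .last _, .new f, _ => ⟨_, _, _, .lastNew f⟩
  | _, _, _, _, .new e, .last _, _ => ⟨_, _, _, .newLast e⟩
  | _, _, _, _, .new e, .new f, h =>
    let ⟨_, _, _, hF⟩ := exists_face_of_ne e f fun hh => h (by rw [hh])
    ⟨_, _, _, .new hF⟩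
  | _, _, _, _, .old e, .old f, h =>
    let ⟨_, _, _, hF⟩ := exists_face_of_ne e f fun hh => h (by rw [hh])
    ⟨_, _, _, .old hF⟩

theorem exists_face_of_path : ∀ {n : ℕ} {D B A : Vtx n} (e : Edge B A) (f' : Edge D B),
    ∃ (C : Vtx n) (f : Edge C A) (e' : Edge D C), Face e f f' e'
  | _, _, _, _, .last _, .old f => ⟨_, _, _, .lastNew f⟩
  | _, _, _, _, .new e, .last _ => ⟨_, _, _, .newLast e⟩
  | _, _, _, _, .new e, .new f =>
    let ⟨_, _, _, hF⟩ := exists_face_of_path e f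
    ⟨_, _, _, .new hF⟩
  | _, _, _, _, .old e, .old f =>
    let ⟨_, _, _, hF⟩ := exists_face_of_path e f
    ⟨_, _, _, .old hF⟩

section
variable {n : ℕ} {D C B A : Vtx n} {e : Edge B A} {f : Edge C A} {f' : Edge D B} {e' : Edge D C}

theorem Face.symm (h : Face e f f' e') : Face f e e' f' := by
  induction h with
  | lastNew f => exact .newLast f
  | newLast e => exact .lastNew e
  | old _ ih => exact .old ih
  | new _ ih => exact .new ih

theorem Face.dir_eq (h : Face e f f' e') : e.dir = e'.dir := by
  induction h with
  | lastNew f => rfl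
  | newLast e => rfl
  | old _ ih => exact congrArg Dir.prev ih
  | new _ ih => exact congrArg Dir.prev ih

theorem Face.dir_ne (h : Face e f f' e') : e.dir ≠ f.dir := by
  induction h with
  | lastNew f => simp [Edge.dir]
  | newLast e => simp [Edge.dir]
  | old _ ih => simpa [Edge.dir] using ih
  | new _ ih => simpa [Edge.dir] using ih

end

theorem Vtx.isEmpty_edge_bot : ∀ {n : ℕ} {B : Vtx n}, Edge B (Vtx.bot n) → False
  | _ + 1, _, .old e => isEmpty_edge_bot e

/-! ### Lifting to a ring where a given scalar is regular -/

section regular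

open Polynomial

theorem Amb.map_surjective {K L V W : Type u} (g : K → L) (h : V → W) (hg : Function.Surjective g)
    (hh : Function.Surjective h) : ∀ {n : ℕ} (A : Vtx n), Function.Surjective (Amb.map g h A)
  | _, .empty => hh
  | _, .old A => fun (y, t) => by
    obtain ⟨y', rfl⟩ := Amb.map_surjective g h hg hh A y
    obtain ⟨t', rfl⟩ := hg t
    exact ⟨(y', t'), rfl⟩
  | _, .new A => fun (y, w, t) => by
    obtain ⟨y', rfl⟩ := Amb.map_surjective g h hg hh A y
    obtain ⟨w', rfl⟩ := Amb.map_surjective g h hg hh A w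
    obtain ⟨t', rfl⟩ := hg t
    exact ⟨(y', w', t'), rfl⟩

theorem Amb.eq_zero_of_smul {K V : Type u} [CommRing K] [AddCommGroup V] [Module K V] {t : K}
    (hK : ∀ s : K, t * s = 0 → s = 0) (hV : ∀ v : V, t • v = 0 → v = 0) :
    ∀ {n : ℕ} (A : Vtx n) (y : Amb K V A), t • y = 0 → y = 0
  | _, .empty => hV
  | _, .old A => fun (y, s) h =>
    Prod.ext (Amb.eq_zero_of_smul hK hV A y (congrArg Prod.fst h)) (hK s (congrArg Prod.snd h))
  | _, .new A => fun (y, w, s) h => by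
    have h2 := congrArg Prod.snd h
    exact Prod.ext (Amb.eq_zero_of_smul hK hV A y (congrArg Prod.fst h))
      (Prod.ext (Amb.eq_zero_of_smul hK hV A w (congrArg Prod.fst h2))
        (hK s (congrArg Prod.snd h2)))

/-- The multiplier is monic, so the top nonzero coefficient of `v` reappears one degree higher in
the product. -/
theorem X_add_C_smul_eq_zero {K V : Type u} [CommRing K] [AddCommGroup V] [Module K V] (t : K)
    (v : PolynomialModule K V) (h : (X + C t : K[X]) • v = 0) : v = 0 := by
  by_contra hv
  have hne : v.coeff.support.Nonempty :=
    Finsupp.support_nonempty_iff.2 fun h => hv (PolynomialModule.coeff_eq_zero.1 h)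
  have hN := v.coeff.support.max'_mem hne
  set N := v.coeff.support.max' hne
  have h1 : ((X + C t : K[X]) • v).coeff (N + 1) = v.coeff N + t • v.coeff (N + 1) := by
    rw [add_smul, PolynomialModule.coeff_add, ← monomial_one_one_eq_X, ← monomial_zero_left,
      Finsupp.add_apply, PolynomialModule.monomial_smul_apply,
      PolynomialModule.monomial_smul_apply]
    simp
  have h2 : v.coeff (N + 1) = 0 := by
    by_contra h3
    have := v.coeff.support.le_max' (N + 1) (Finsupp.mem_support_iff.2 h3)
    omega
  rw [h, h2, smul_zero, add_zero] at h1
  exact (Finsupp.mem_support_iff.1 hN) h1.symm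

/-- Every scalar can be lifted to a regular scalar. -/
theorem exists_regular_lift (K V : Type u) [CommRing K] [AddCommGroup V] [Module K V] (t : K) :
    ∃ (L W : Type u) (_ : CommRing L) (_ : AddCommGroup W) (_ : Module L W) (g : L →+* K)
      (h : W →+ V) (s : L), (∀ (r : L) (w : W), h (r • w) = g r • h w) ∧ Function.Surjective g ∧
      Function.Surjective h ∧ g s = t ∧ (∀ r : L, s * r = 0 → r = 0) ∧
      ∀ w : W, s • w = 0 → w = 0 := by
  -- Evaluation at `X = 0` sends the regular polynomial `X + t` to `t`.
  refine ⟨K[X], PolynomialModule K V, inferInstance, inferInstance, inferInstance,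
    evalRingHom 0, (PolynomialModule.eval (0 : K)).toAddMonoidHom, X + C t, ?_, ?_, ?_, ?_, ?_, ?_⟩
  · intro r w; exact PolynomialModule.eval_smul r w 0
  · intro a; exact ⟨C a, by simp⟩
  · intro v; exact ⟨PolynomialModule.single K 0 v, by simp⟩
  · simp
  · intro r hr
    exact ((monic_X_add_C t).isRegular.left) (by simpa using hr)
  · exact X_add_C_smul_eq_zero t

end regular

/-! ### The laws of the structure maps -/

section laws

/-! ### Structure maps and scalar extension -/

section
variable {K V : Type u} [CommRing K] [AddCommGroup V] [Module K V]

theorem Amb.im_join (t : K) : ∀ {n : ℕ} (A : Vtx n) (y w : Amb K V A),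
    Amb.im t A (Amb.join t A y w) = w
  | _, .empty => fun _ _ => rfl
  | _, .old A => fun (y, _) (w, _) => Prod.ext (Amb.im_join t A y w) rfl
  | _, .new A => fun (y, y', _) (w, w', _) => Prod.ext (Amb.im_join t A y w)
      (Prod.ext (Amb.im_join t A y' w') rfl)

theorem Amb.join_im (t : K) : ∀ {n : ℕ} (A : Vtx n) (z : Amb (QuadraticAlgebra K 0 t) (Tw t V) A),
    Amb.join t A (Amb.map (evalZ t) (twEvalZ t) A z) (Amb.im t A z) = z
  | _, .empty => fun _ => rfl
  | _, .old A => fun (z, _) => Prod.ext (Amb.join_im t A z) rfl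
  | _, .new A => fun (z, z', _) => Prod.ext (Amb.join_im t A z)
      (Prod.ext (Amb.join_im t A z') rfl)

theorem srcMap_join (t : K) : ∀ {n : ℕ} {B A : Vtx n} (e : Edge B A) (y w : Amb K V A),
    srcMap (QuadraticAlgebra K 0 t) (Tw t V) e (Amb.join t A y w)
      = Amb.join t B (srcMap K V e y) (srcMap K V e w)
  | _, _, _, .last _ => fun (_, _, _) (_, _, _) => rfl
  | _, _, _, .old e => fun (y, _) (w, _) => Prod.ext (srcMap_join t e y w) rfl
  | _, _, _, .new e => fun (y, y', _) (w, w', _) => Prod.ext (srcMap_join t e y w)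
      (Prod.ext (srcMap_join t e y' w') rfl)

theorem Amb.join_zero (t : K) : ∀ {n : ℕ} (A : Vtx n),
    Amb.join t A (0 : Amb K V A) 0 = 0
  | _, .empty => rfl
  | _, .old A => Prod.ext (Amb.join_zero t A) rfl
  | _, .new A => Prod.ext (Amb.join_zero t A) (Prod.ext (Amb.join_zero t A) rfl)

theorem Amb.join_add (t : K) : ∀ {n : ℕ} (A : Vtx n) (y y' w w' : Amb K V A),
    Amb.join t A (y + y') (w + w') = Amb.join t A y w + Amb.join t A y' w'
  | _, .empty => fun _ _ _ _ => rfl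
  | _, .old A => fun (y, _) (y', _) (w, _) (w', _) => Prod.ext (Amb.join_add t A y y' w w') rfl
  | _, .new A => fun (y, x, _) (y', x', _) (w, z, _) (w', z', _) =>
    Prod.ext (Amb.join_add t A y y' w w') (Prod.ext (Amb.join_add t A x x' z z') rfl)

theorem oneMap_join (t : K) : ∀ {n : ℕ} {B A : Vtx n} (e : Edge B A) (y w : Amb K V B),
    oneMap (QuadraticAlgebra K 0 t) (Tw t V) e (Amb.join t B y w)
      = Amb.join t A (oneMap K V e y) (oneMap K V e w)
  | _, _, _, .last A => fun (_, _) (_, _) =>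
    Prod.ext rfl (Prod.ext (Amb.join_zero t A).symm rfl)
  | _, _, _, .old e => fun (y, _) (w, _) => Prod.ext (oneMap_join t e y w) rfl
  | _, _, _, .new e => fun (y, y', _) (w, w', _) => Prod.ext (oneMap_join t e y w)
      (Prod.ext (oneMap_join t e y' w') rfl)

theorem compMap_join (t : K) : ∀ {n : ℕ} {B A : Vtx n} (e : Edge B A) (y' w' y w : Amb K V A),
    compMap (QuadraticAlgebra K 0 t) (Tw t V) e (Amb.join t A y' w') (Amb.join t A y w)
      = Amb.join t A (compMap K V e y' y) (compMap K V e w' w)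
  | _, _, _, .last A => fun (_, _, _) (_, _, _) (_, _, _) (_, _, _) =>
    Prod.ext rfl (Prod.ext (Amb.join_add t A _ _ _ _).symm rfl)
  | _, _, _, .old e => fun (y', _) (w', _) (y, _) (w, _) =>
    Prod.ext (compMap_join t e y' w' y w) rfl
  | _, _, _, .new e => fun (y', x', _) (w', z', _) (y, x, _) (w, z, _) =>
    Prod.ext (compMap_join t e y' w' y w) (Prod.ext (compMap_join t e x' z' x z) rfl)

/-- By naturality along `ε ↦ 0`, the constant part of the extended target is the ordinary target.
Thus the pair `(β, β^[1])` is the same datum as `β` over the extended ring, and a law over that ring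
yields the derived law by taking the coefficient of `ε`. -/
theorem tgtMap_join (t : K) {n : ℕ} {B A : Vtx n} (e : Edge B A) (y w : Amb K V A) :
    Amb.join t B (tgtMap e K V y)
        (Amb.im t B (tgtMap e (QuadraticAlgebra K 0 t) (Tw t V) (Amb.join t A y w)))
      = tgtMap e (QuadraticAlgebra K 0 t) (Tw t V) (Amb.join t A y w) := by
  conv_rhs => rw [← Amb.join_im t B (tgtMap e _ _ _),
    ← tgtMap_map e _ _ _ _ (evalZ t) (twEvalZ t) (twEvalZ_smul t), Amb.evalZ_join]

theorem invMap_join (t : K) {n : ℕ} {B A : Vtx n} (e : Edge B A) (y w : Amb K V A) :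
    Amb.join t A (invMap e K V y)
        (Amb.im t A (invMap e (QuadraticAlgebra K 0 t) (Tw t V) (Amb.join t A y w)))
      = invMap e (QuadraticAlgebra K 0 t) (Tw t V) (Amb.join t A y w) := by
  conv_rhs => rw [← Amb.join_im t A (invMap e _ _ _),
    ← invMap_map e _ _ _ _ (evalZ t) (twEvalZ t) (twEvalZ_smul t), Amb.evalZ_join]

theorem srcMap_im (t : K) {n : ℕ} {B A : Vtx n} (e : Edge B A)
    (z : Amb (QuadraticAlgebra K 0 t) (Tw t V) A) :
    srcMap K V e (Amb.im t A z) = Amb.im t B (srcMap (QuadraticAlgebra K 0 t) (Tw t V) e z) := by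
  conv_rhs => rw [← Amb.join_im t A z, srcMap_join, Amb.im_join]

theorem oneMap_im (t : K) {n : ℕ} {B A : Vtx n} (e : Edge B A)
    (z : Amb (QuadraticAlgebra K 0 t) (Tw t V) B) :
    oneMap K V e (Amb.im t B z) = Amb.im t A (oneMap (QuadraticAlgebra K 0 t) (Tw t V) e z) := by
  conv_rhs => rw [← Amb.join_im t B z, oneMap_join, Amb.im_join]

theorem compMap_im (t : K) {n : ℕ} {B A : Vtx n} (e : Edge B A)
    (z z' : Amb (QuadraticAlgebra K 0 t) (Tw t V) A) :
    compMap K V e (Amb.im t A z) (Amb.im t A z')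
      = Amb.im t A (compMap (QuadraticAlgebra K 0 t) (Tw t V) e z z') := by
  conv_rhs => rw [← Amb.join_im t A z, ← Amb.join_im t A z', compMap_join, Amb.im_join]

theorem srcMap_add {n : ℕ} {B A : Vtx n} (e : Edge B A) (y w : Amb K V A) :
    srcMap K V e (y + w) = srcMap K V e y + srcMap K V e w := by
  simpa using srcMap_add_smul e y w 1

theorem oneMap_add {n : ℕ} {B A : Vtx n} (e : Edge B A) (y w : Amb K V B) :
    oneMap K V e (y + w) = oneMap K V e y + oneMap K V e w := by
  simpa using oneMap_add_smul e y w 1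

theorem compMap_add {n : ℕ} {B A : Vtx n} (e : Edge B A) (y z w x : Amb K V A) :
    compMap K V e (y + w) (z + x) = compMap K V e y z + compMap K V e w x := by
  simpa using compMap_add_smul e y z w x 1

theorem srcMap_zero {n : ℕ} {B A : Vtx n} (e : Edge B A) : srcMap K V e (0 : Amb K V A) = 0 := by
  simpa using srcMap_add e (0 : Amb K V A) 0

theorem oneMap_zero {n : ℕ} {B A : Vtx n} (e : Edge B A) : oneMap K V e (0 : Amb K V B) = 0 := by
  simpa using oneMap_add e (0 : Amb K V B) 0

theorem compMap_zero {n : ℕ} {B A : Vtx n} (e : Edge B A) :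
    compMap K V e (0 : Amb K V A) 0 = 0 := by
  simpa using compMap_add e (0 : Amb K V A) 0 0 0

/-- The derived target map is a cocycle. -/
theorem tgtMap_cocycle {n : ℕ} {B A : Vtx n} (e : Edge B A) (y w w' : Amb K V A) (t : K) :
    Amb.im t B (tgtMap e (QuadraticAlgebra K 0 t) (Tw t V) (Amb.join t A y (w' + w)))
      = Amb.im t B (tgtMap e (QuadraticAlgebra K 0 t) (Tw t V) (Amb.join t A (y + t • w) w'))
        + Amb.im t B (tgtMap e (QuadraticAlgebra K 0 t) (Tw t V) (Amb.join t A y w)) := by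
  -- Expanding `β (y + t (w' + w))` in one step and in two steps gives the identity multiplied by
  -- `t`. By naturality it may be checked over a ring in which the lift of `t` can be cancelled.
  obtain ⟨L, W, _, _, _, g, h, s, hh, hg', hh', rfl, h1, h2⟩ := exists_regular_lift K V t
  obtain ⟨y, rfl⟩ := Amb.map_surjective g h hg' hh' A y
  obtain ⟨w, rfl⟩ := Amb.map_surjective g h hg' hh' A w
  obtain ⟨w', rfl⟩ := Amb.map_surjective g h hg' hh' A w'
  have key : ∀ a b : Amb L W A, Amb.im (g s) B (tgtMap e (QuadraticAlgebra K 0 (g s)) (Tw (g s) V)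
      (Amb.join (g s) A (Amb.map g h A a) (Amb.map g h A b)))
      = Amb.map g h B (Amb.im s B (tgtMap e (QuadraticAlgebra L 0 s) (Tw s W)
        (Amb.join s A a b))) := fun a b => by
    rw [Amb.join_map, tgtMap_map e _ _ _ _ (quadMap g s) (twMap h s (g s)) (twMap_smul g h hh s),
      Amb.im_map]
  rw [← Amb.map_smul g h hh, ← Amb.map_add, ← Amb.map_add, key, key, key, ← Amb.map_add]
  congr 1
  rw [← sub_eq_zero]
  apply Amb.eq_zero_of_smul h1 h2
  have e1 := tgtMap_add_smul e y (w' + w) s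
  have e2 := tgtMap_add_smul e (y + s • w) w' s
  have e3 := tgtMap_add_smul e y w s
  rw [smul_sub, smul_add, sub_eq_zero]
  have : y + s • (w' + w) = y + s • w + s • w' := by module
  rw [this, e2, e3] at e1
  rw [add_assoc] at e1
  rw [← add_left_cancel e1, add_comm]

/-- The cocycle identity at `w = w' = 0` reads `c = c + c`. -/
theorem tgtMap_join_zero {n : ℕ} {B A : Vtx n} (e : Edge B A) (y : Amb K V A) (t : K) :
    Amb.im t B (tgtMap e (QuadraticAlgebra K 0 t) (Tw t V) (Amb.join t A y 0)) = 0 := by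
  simpa using tgtMap_cocycle e y 0 0 t

end

/-! ### Groupoid laws along a single edge -/

theorem srcMap_compMap : ∀ {n : ℕ} {B A : Vtx n} (e : Edge B A) (K V : Type u)
    [CommRing K] [AddCommGroup V] [Module K V] (a b : Amb K V A),
    srcMap K V e (compMap K V e a b) = srcMap K V e b
  | _, _, _, .last _ => fun K V _ _ _ (_, _, _) (_, _, _) => rfl
  | _, _, _, .old e => fun K V _ _ _ (a, _) (b, _) => Prod.ext (srcMap_compMap e K V a b) rfl
  | _, _, _, .new e => fun K V _ _ _ (a, a', _) (b, b', _) =>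
    Prod.ext (srcMap_compMap e K V a b) (Prod.ext (srcMap_compMap e K V a' b') rfl)

/-- On a new edge this is the coefficient of `ε` of the same law over `K[ε]/(ε² - tε)`. This is why
`K` and `V` are quantified inside the recursion here and in the other laws. -/
theorem tgtMap_compMap : ∀ {n : ℕ} {B A : Vtx n} (e : Edge B A) (K V : Type u)
    [CommRing K] [AddCommGroup V] [Module K V] (a b : Amb K V A),
    srcMap K V e a = tgtMap e K V b → tgtMap e K V (compMap K V e a b) = tgtMap e K V a
  | _, _, _, .last _ => fun K V _ _ _ (x, w', s) (y, w, t) h => by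
    obtain ⟨h₁, h₂⟩ := Prod.mk.inj h
    obtain rfl : x = y + t • w := h₁
    obtain rfl : s = t := h₂
    refine Prod.ext ?_ rfl
    change y + s • (w' + w) = y + s • w + s • w'
    module
  | _, _, _, .old e => fun K V _ _ _ (x, s) (y, t) h => by
    obtain ⟨h₁, h₂⟩ := Prod.mk.inj h
    obtain rfl : s = t := h₂
    exact Prod.ext (tgtMap_compMap e K V x y h₁) rfl
  | _, _, _, .new e => fun K V _ _ _ (x, w', s) (y, w, t) h => by
    obtain ⟨h₁, h₂⟩ := Prod.mk.inj h
    obtain ⟨h₂, h₃⟩ := Prod.mk.inj h₂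
    obtain rfl : s = t := h₃
    refine Prod.ext (tgtMap_compMap e K V x y h₁) (Prod.ext ?_ rfl)
    refine congrArg (Amb.im s _) ?_
    rw [← compMap_join]
    refine tgtMap_compMap e _ _ _ _ ?_
    rw [srcMap_join, h₁, h₂, tgtMap_join]

theorem compMap_assoc : ∀ {n : ℕ} {B A : Vtx n} (e : Edge B A) (K V : Type u)
    [CommRing K] [AddCommGroup V] [Module K V] (a b c : Amb K V A),
    compMap K V e (compMap K V e a b) c = compMap K V e a (compMap K V e b c)
  | _, _, _, .last _ => fun K V _ _ _ (_, _, _) (_, _, _) (_, _, _) =>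
    Prod.ext rfl (Prod.ext (add_assoc _ _ _) rfl)
  | _, _, _, .old e => fun K V _ _ _ (a, _) (b, _) (c, _) =>
    Prod.ext (compMap_assoc e K V a b c) rfl
  | _, _, _, .new e => fun K V _ _ _ (a, a', _) (b, b', _) (c, c', _) =>
    Prod.ext (compMap_assoc e K V a b c) (Prod.ext (compMap_assoc e K V a' b' c') rfl)

theorem srcMap_oneMap : ∀ {n : ℕ} {B A : Vtx n} (e : Edge B A) (K V : Type u)
    [CommRing K] [AddCommGroup V] [Module K V] (b : Amb K V B),
    srcMap K V e (oneMap K V e b) = b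
  | _, _, _, .last _ => fun K V _ _ _ (_, _) => rfl
  | _, _, _, .old e => fun K V _ _ _ (b, _) => Prod.ext (srcMap_oneMap e K V b) rfl
  | _, _, _, .new e => fun K V _ _ _ (b, b', _) =>
    Prod.ext (srcMap_oneMap e K V b) (Prod.ext (srcMap_oneMap e K V b') rfl)

theorem tgtMap_oneMap : ∀ {n : ℕ} {B A : Vtx n} (e : Edge B A) (K V : Type u)
    [CommRing K] [AddCommGroup V] [Module K V] (b : Amb K V B),
    tgtMap e K V (oneMap K V e b) = b
  | _, _, _, .last A => fun K V _ _ _ (y, t) => Prod.ext (by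
      change y + t • (0 : Amb K V A) = y
      rw [smul_zero, add_zero]) rfl
  | _, _, _, .old e => fun K V _ _ _ (b, _) => Prod.ext (tgtMap_oneMap e K V b) rfl
  | _, _, _, .new e => fun K V _ _ _ (b, b', t) =>
    Prod.ext (tgtMap_oneMap e K V b) (Prod.ext (by
      refine Eq.trans (congrArg (Amb.im t _) ?_) (Amb.im_join t _ b b')
      rw [← oneMap_join, tgtMap_oneMap e]) rfl)

theorem compMap_one_src : ∀ {n : ℕ} {B A : Vtx n} (e : Edge B A) (K V : Type u)
    [CommRing K] [AddCommGroup V] [Module K V] (a : Amb K V A),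
    compMap K V e a (oneMap K V e (srcMap K V e a)) = a
  | _, _, _, .last _ => fun K V _ _ _ (_, _, _) => Prod.ext rfl (Prod.ext (add_zero _) rfl)
  | _, _, _, .old e => fun K V _ _ _ (a, _) => Prod.ext (compMap_one_src e K V a) rfl
  | _, _, _, .new e => fun K V _ _ _ (a, a', _) =>
    Prod.ext (compMap_one_src e K V a) (Prod.ext (compMap_one_src e K V a') rfl)

theorem compMap_one_left : ∀ {n : ℕ} {B A : Vtx n} (e : Edge B A) (K V : Type u)
    [CommRing K] [AddCommGroup V] [Module K V] (b : Amb K V B) (a : Amb K V A),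
    compMap K V e (oneMap K V e b) a = a
  | _, _, _, .last _ => fun K V _ _ _ (_, _) (_, _, _) => Prod.ext rfl (Prod.ext (zero_add _) rfl)
  | _, _, _, .old e => fun K V _ _ _ (b, _) (a, _) => Prod.ext (compMap_one_left e K V b a) rfl
  | _, _, _, .new e => fun K V _ _ _ (b, b', _) (a, a', _) =>
    Prod.ext (compMap_one_left e K V b a) (Prod.ext (compMap_one_left e K V b' a') rfl)

theorem srcMap_invMap : ∀ {n : ℕ} {B A : Vtx n} (e : Edge B A) (K V : Type u)
    [CommRing K] [AddCommGroup V] [Module K V] (a : Amb K V A),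
    srcMap K V e (invMap e K V a) = tgtMap e K V a
  | _, _, _, .last _ => fun K V _ _ _ (_, _, _) => rfl
  | _, _, _, .old e => fun K V _ _ _ (a, _) => Prod.ext (srcMap_invMap e K V a) rfl
  | _, _, _, .new e => fun K V _ _ _ (a, a', t) =>
    Prod.ext (srcMap_invMap e K V a) (Prod.ext (by
      refine (srcMap_im t e _).trans (congrArg (Amb.im t _) ?_)
      rw [srcMap_invMap e]) rfl)

theorem tgtMap_invMap : ∀ {n : ℕ} {B A : Vtx n} (e : Edge B A) (K V : Type u)
    [CommRing K] [AddCommGroup V] [Module K V] (a : Amb K V A),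
    tgtMap e K V (invMap e K V a) = srcMap K V e a
  | _, _, _, .last _ => fun K V _ _ _ (y, w, t) => Prod.ext (by
      change y + t • w + t • (-w) = y
      module) rfl
  | _, _, _, .old e => fun K V _ _ _ (a, _) => Prod.ext (tgtMap_invMap e K V a) rfl
  | _, _, _, .new e => fun K V _ _ _ (a, a', t) =>
    Prod.ext (tgtMap_invMap e K V a) (Prod.ext (by
      refine Eq.trans (congrArg (Amb.im t _) ?_) (Amb.im_join t _ (srcMap K V e a) _)
      rw [invMap_join, tgtMap_invMap e]
      exact srcMap_join t e a a') rfl)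

theorem compMap_invMap : ∀ {n : ℕ} {B A : Vtx n} (e : Edge B A) (K V : Type u)
    [CommRing K] [AddCommGroup V] [Module K V] (a : Amb K V A),
    compMap K V e a (invMap e K V a) = oneMap K V e (tgtMap e K V a)
  | _, _, _, .last _ => fun K V _ _ _ (_, _, _) => Prod.ext rfl (Prod.ext (add_neg_cancel _) rfl)
  | _, _, _, .old e => fun K V _ _ _ (a, _) => Prod.ext (compMap_invMap e K V a) rfl
  | _, _, _, .new e => fun K V _ _ _ (a, a', t) =>
    Prod.ext (compMap_invMap e K V a) (Prod.ext (by
      refine Eq.trans ?_ (oneMap_im t e _).symm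
      rw [← compMap_invMap e, ← compMap_im, Amb.im_join]
      rfl) rfl)

theorem invMap_compMap : ∀ {n : ℕ} {B A : Vtx n} (e : Edge B A) (K V : Type u)
    [CommRing K] [AddCommGroup V] [Module K V] (a : Amb K V A),
    compMap K V e (invMap e K V a) a = oneMap K V e (srcMap K V e a)
  | _, _, _, .last _ => fun K V _ _ _ (_, _, _) => Prod.ext rfl (Prod.ext (neg_add_cancel _) rfl)
  | _, _, _, .old e => fun K V _ _ _ (a, _) => Prod.ext (invMap_compMap e K V a) rfl
  | _, _, _, .new (B := B) (A := A) e => fun K V _ _ _ (a, a', t) =>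
    Prod.ext (invMap_compMap e K V a) (Prod.ext (by
      have h := congrArg (Amb.im t A) (invMap_compMap e _ _ (Amb.join t A a a'))
      rw [← compMap_im, Amb.im_join, srcMap_join, oneMap_join, Amb.im_join] at h
      exact h) rfl)

theorem invMap_invMap : ∀ {n : ℕ} {B A : Vtx n} (e : Edge B A) (K V : Type u)
    [CommRing K] [AddCommGroup V] [Module K V] (a : Amb K V A),
    invMap e K V (invMap e K V a) = a
  | _, _, _, .last _ => fun K V _ _ _ (y, w, t) => Prod.ext (by
      change y + t • w + t • (-w) = y
      module) (Prod.ext (neg_neg _) rfl)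
  | _, _, _, .old e => fun K V _ _ _ (a, _) => Prod.ext (invMap_invMap e K V a) rfl
  | _, _, _, .new e => fun K V _ _ _ (a, a', t) =>
    Prod.ext (invMap_invMap e K V a) (Prod.ext (by
      refine Eq.trans (congrArg (Amb.im t _) ?_) (Amb.im_join t _ a _)
      rw [invMap_join, invMap_invMap e]) rfl)

/-! ### Double groupoid laws in the two-dimensional faces -/

section faces

theorem srcMap_srcMap : ∀ {n : ℕ} {D C B A : Vtx n} {e : Edge B A} {f : Edge C A} {f' : Edge D B}
    {e' : Edge D C}, Face e f f' e' → ∀ (K V : Type u) [CommRing K] [AddCommGroup V] [Module K V]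
    (a : Amb K V A), srcMap K V f' (srcMap K V e a) = srcMap K V e' (srcMap K V f a)
  | _, _, _, _, _, _, _, _, _, .lastNew f => fun K V _ _ _ (_, _, _) => rfl
  | _, _, _, _, _, _, _, _, _, .newLast e => fun K V _ _ _ (_, _, _) => rfl
  | _, _, _, _, _, _, _, _, _, .old h => fun K V _ _ _ (a, _) =>
    Prod.ext (srcMap_srcMap h K V a) rfl
  | _, _, _, _, _, _, _, _, _, .new h => fun K V _ _ _ (a, a', _) =>
    Prod.ext (srcMap_srcMap h K V a) (Prod.ext (srcMap_srcMap h K V a') rfl)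

theorem srcMap_tgtMap : ∀ {n : ℕ} {D C B A : Vtx n} {e : Edge B A} {f : Edge C A} {f' : Edge D B}
    {e' : Edge D C}, Face e f f' e' → ∀ (K V : Type u) [CommRing K] [AddCommGroup V] [Module K V]
    (a : Amb K V A), srcMap K V f' (tgtMap e K V a) = tgtMap e' K V (srcMap K V f a)
  | _, _, _, _, _, _, _, _, _, .lastNew f => fun K V _ _ _ (y, w, t) =>
    Prod.ext (srcMap_add_smul f y w t) rfl
  | _, _, _, _, _, _, _, _, _, .newLast e => fun K V _ _ _ (_, _, _) => rfl
  | _, _, _, _, _, _, _, _, _, .old h => fun K V _ _ _ (a, _) =>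
    Prod.ext (srcMap_tgtMap h K V a) rfl
  | _, _, _, _, _, _, _, _, _, .new h => fun K V _ _ _ (a, a', t) =>
    Prod.ext (srcMap_tgtMap h K V a) (Prod.ext (by
      refine (srcMap_im t _ _).trans (congrArg (Amb.im t _) ?_)
      rw [srcMap_tgtMap h, srcMap_join]) rfl)

/-- In a face containing the last direction, this is exactly the difference quotient property `β (y
+ tw) = β y + t β^[1] (y, w, t)`. -/
theorem tgtMap_tgtMap : ∀ {n : ℕ} {D C B A : Vtx n} {e : Edge B A} {f : Edge C A} {f' : Edge D B}
    {e' : Edge D C}, Face e f f' e' → ∀ (K V : Type u) [CommRing K] [AddCommGroup V] [Module K V]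
    (a : Amb K V A), tgtMap f' K V (tgtMap e K V a) = tgtMap e' K V (tgtMap f K V a)
  | _, _, _, _, _, _, _, _, _, .lastNew f => fun K V _ _ _ (y, w, t) =>
    Prod.ext (tgtMap_add_smul f y w t) rfl
  | _, _, _, _, _, _, _, _, _, .newLast e => fun K V _ _ _ (y, w, t) =>
    Prod.ext (tgtMap_add_smul e y w t).symm rfl
  | _, _, _, _, _, _, _, _, _, .old h => fun K V _ _ _ (a, _) =>
    Prod.ext (tgtMap_tgtMap h K V a) rfl
  | _, _, _, _, _, _, _, _, _, .new h => fun K V _ _ _ (a, a', t) =>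
    Prod.ext (tgtMap_tgtMap h K V a) (Prod.ext (by
      refine congrArg (Amb.im t _) ?_
      rw [tgtMap_join, tgtMap_join, tgtMap_tgtMap h]) rfl)

theorem srcMap_oneMap_face : ∀ {n : ℕ} {D C B A : Vtx n} {e : Edge B A} {f : Edge C A}
    {f' : Edge D B} {e' : Edge D C}, Face e f f' e' → ∀ (K V : Type u) [CommRing K]
    [AddCommGroup V] [Module K V] (c : Amb K V C),
    srcMap K V e (oneMap K V f c) = oneMap K V f' (srcMap K V e' c)
  | _, _, _, _, _, _, _, _, _, .lastNew f => fun K V _ _ _ (_, _, _) => rfl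
  | _, _, _, _, _, _, _, _, _, .newLast e => fun K V _ _ _ (_, _) =>
    Prod.ext rfl (Prod.ext (srcMap_zero e) rfl)
  | _, _, _, _, _, _, _, _, _, .old h => fun K V _ _ _ (a, _) =>
    Prod.ext (srcMap_oneMap_face h K V a) rfl
  | _, _, _, _, _, _, _, _, _, .new h => fun K V _ _ _ (a, a', _) =>
    Prod.ext (srcMap_oneMap_face h K V a) (Prod.ext (srcMap_oneMap_face h K V a') rfl)

theorem tgtMap_oneMap_face : ∀ {n : ℕ} {D C B A : Vtx n} {e : Edge B A} {f : Edge C A}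
    {f' : Edge D B} {e' : Edge D C}, Face e f f' e' → ∀ (K V : Type u) [CommRing K]
    [AddCommGroup V] [Module K V] (c : Amb K V C),
    tgtMap e K V (oneMap K V f c) = oneMap K V f' (tgtMap e' K V c)
  | _, _, _, _, _, _, _, _, _, .lastNew f => fun K V _ _ _ (y, w, t) =>
    Prod.ext (oneMap_add_smul f y w t).symm rfl
  | _, _, _, _, _, _, _, _, _, .newLast e => fun K V _ _ _ (y, t) =>
    Prod.ext rfl (Prod.ext (tgtMap_join_zero e y t) rfl)
  | _, _, _, _, _, _, _, _, _, .old h => fun K V _ _ _ (a, _) =>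
    Prod.ext (tgtMap_oneMap_face h K V a) rfl
  | _, _, _, _, _, _, _, _, _, .new h => fun K V _ _ _ (a, a', t) =>
    Prod.ext (tgtMap_oneMap_face h K V a) (Prod.ext (by
      refine Eq.trans (congrArg (Amb.im t _) ?_) (oneMap_im t _ _).symm
      rw [← oneMap_join, tgtMap_oneMap_face h]) rfl)

theorem srcMap_compMap_face : ∀ {n : ℕ} {D C B A : Vtx n} {e : Edge B A} {f : Edge C A}
    {f' : Edge D B} {e' : Edge D C}, Face e f f' e' → ∀ (K V : Type u) [CommRing K]
    [AddCommGroup V] [Module K V] (a b : Amb K V A),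
    srcMap K V e (compMap K V f a b) = compMap K V f' (srcMap K V e a) (srcMap K V e b)
  | _, _, _, _, _, _, _, _, _, .lastNew f => fun K V _ _ _ (_, _, _) (_, _, _) => rfl
  | _, _, _, _, _, _, _, _, _, .newLast e => fun K V _ _ _ (_, _, _) (_, _, _) =>
    Prod.ext rfl (Prod.ext (srcMap_add e _ _) rfl)
  | _, _, _, _, _, _, _, _, _, .old h => fun K V _ _ _ (a, _) (b, _) =>
    Prod.ext (srcMap_compMap_face h K V a b) rfl
  | _, _, _, _, _, _, _, _, _, .new h => fun K V _ _ _ (a, a', _) (b, b', _) =>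
    Prod.ext (srcMap_compMap_face h K V a b) (Prod.ext (srcMap_compMap_face h K V a' b') rfl)

/-- When the product is in the last direction, this is the cocycle identity for the derived target
map. -/
theorem tgtMap_compMap_face : ∀ {n : ℕ} {D C B A : Vtx n} {e : Edge B A} {f : Edge C A}
    {f' : Edge D B} {e' : Edge D C}, Face e f f' e' → ∀ (K V : Type u) [CommRing K]
    [AddCommGroup V] [Module K V] (a b : Amb K V A), srcMap K V f a = tgtMap f K V b →
    tgtMap e K V (compMap K V f a b) = compMap K V f' (tgtMap e K V a) (tgtMap e K V b)
  | _, _, _, _, _, _, _, _, _, .lastNew f => fun K V _ _ _ (x, w', s) (y, w, t) h => by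
    obtain rfl : s = t := congrArg (fun p => p.2.2) h
    exact Prod.ext (compMap_add_smul f x y w' w s).symm rfl
  | _, _, _, _, _, _, _, _, _, .newLast e => fun K V _ _ _ (x, w', s) (y, w, t) h => by
    obtain ⟨h₁, h₂⟩ := Prod.mk.inj h
    obtain rfl : x = y + t • w := h₁
    obtain rfl : s = t := h₂
    exact Prod.ext rfl (Prod.ext (tgtMap_cocycle e y w w' s) rfl)
  | _, _, _, _, _, _, _, _, _, .old hF => fun K V _ _ _ (x, s) (y, t) h =>
    Prod.ext (tgtMap_compMap_face hF K V x y (congrArg Prod.fst h)) rfl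
  | _, _, _, _, _, _, _, _, _, .new hF => fun K V _ _ _ (x, w', s) (y, w, t) h => by
    obtain ⟨h₁, h₂⟩ := Prod.mk.inj h
    obtain ⟨h₂, h₃⟩ := Prod.mk.inj h₂
    obtain rfl : s = t := h₃
    refine Prod.ext (tgtMap_compMap_face hF K V x y h₁) (Prod.ext ?_ rfl)
    refine Eq.trans (congrArg (Amb.im s _) ?_) (compMap_im s _ _ _).symm
    rw [← compMap_join]
    refine tgtMap_compMap_face hF _ _ _ _ ?_
    rw [srcMap_join, h₁, h₂, tgtMap_join]

theorem oneMap_oneMap : ∀ {n : ℕ} {D C B A : Vtx n} {e : Edge B A} {f : Edge C A}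
    {f' : Edge D B} {e' : Edge D C}, Face e f f' e' → ∀ (K V : Type u) [CommRing K]
    [AddCommGroup V] [Module K V] (d : Amb K V D),
    oneMap K V e (oneMap K V f' d) = oneMap K V f (oneMap K V e' d)
  | _, _, _, _, _, _, _, _, _, .lastNew f => fun K V _ _ _ (_, _) =>
    Prod.ext rfl (Prod.ext (oneMap_zero f).symm rfl)
  | _, _, _, _, _, _, _, _, _, .newLast e => fun K V _ _ _ (_, _) =>
    Prod.ext rfl (Prod.ext (oneMap_zero e) rfl)
  | _, _, _, _, _, _, _, _, _, .old h => fun K V _ _ _ (a, _) =>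
    Prod.ext (oneMap_oneMap h K V a) rfl
  | _, _, _, _, _, _, _, _, _, .new h => fun K V _ _ _ (a, a', _) =>
    Prod.ext (oneMap_oneMap h K V a) (Prod.ext (oneMap_oneMap h K V a') rfl)

theorem oneMap_compMap : ∀ {n : ℕ} {D C B A : Vtx n} {e : Edge B A} {f : Edge C A}
    {f' : Edge D B} {e' : Edge D C}, Face e f f' e' → ∀ (K V : Type u) [CommRing K]
    [AddCommGroup V] [Module K V] (a b : Amb K V B),
    oneMap K V e (compMap K V f' a b) = compMap K V f (oneMap K V e a) (oneMap K V e b)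
  | _, _, _, _, _, _, _, _, _, .lastNew f => fun K V _ _ _ (_, _) (_, _) =>
    Prod.ext rfl (Prod.ext (compMap_zero f).symm rfl)
  | _, _, _, _, _, _, _, _, _, .newLast e => fun K V _ _ _ (_, _, _) (_, _, _) =>
    Prod.ext rfl (Prod.ext (oneMap_add e _ _) rfl)
  | _, _, _, _, _, _, _, _, _, .old h => fun K V _ _ _ (a, _) (b, _) =>
    Prod.ext (oneMap_compMap h K V a b) rfl
  | _, _, _, _, _, _, _, _, _, .new h => fun K V _ _ _ (a, a', _) (b, b', _) =>
    Prod.ext (oneMap_compMap h K V a b) (Prod.ext (oneMap_compMap h K V a' b') rfl)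

/-- In the last direction the product adds the vector components, so interchange amounts to
additivity of the other product. On the ambient modules no composability is needed. -/
theorem compMap_compMap : ∀ {n : ℕ} {D C B A : Vtx n} {e : Edge B A} {f : Edge C A}
    {f' : Edge D B} {e' : Edge D C}, Face e f f' e' → ∀ (K V : Type u) [CommRing K]
    [AddCommGroup V] [Module K V] (a b c d : Amb K V A),
    compMap K V e (compMap K V f a c) (compMap K V f b d)
      = compMap K V f (compMap K V e a b) (compMap K V e c d)
  | _, _, _, _, _, _, _, _, _, .lastNew f => fun K V _ _ _ (_, _, _) (_, _, _) (_, _, _) (_, _, _) =>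
    Prod.ext rfl (Prod.ext (compMap_add f _ _ _ _).symm rfl)
  | _, _, _, _, _, _, _, _, _, .newLast e => fun K V _ _ _ (_, _, _) (_, _, _) (_, _, _) (_, _, _) =>
    Prod.ext rfl (Prod.ext (compMap_add e _ _ _ _) rfl)
  | _, _, _, _, _, _, _, _, _, .old h => fun K V _ _ _ (a, _) (b, _) (c, _) (d, _) =>
    Prod.ext (compMap_compMap h K V a b c d) rfl
  | _, _, _, _, _, _, _, _, _, .new h => fun K V _ _ _ (a, a', _) (b, b', _) (c, c', _) (d, d', _) =>
    Prod.ext (compMap_compMap h K V a b c d) (Prod.ext (compMap_compMap h K V a' b' c' d') rfl)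

end faces

end laws

/-! ### Topology of the ambient modules -/

section ambTopology

variable {K V : Type u} [CommRing K] [AddCommGroup V] [Module K V]

instance instIsTopologicalAddGroupAmb [TopologicalSpace K] [TopologicalSpace V]
    [IsTopologicalAddGroup K] [IsTopologicalAddGroup V] :
    {n : ℕ} → (A : Vtx n) → IsTopologicalAddGroup (Amb K V A)
  | _, .empty => inferInstanceAs (IsTopologicalAddGroup V)
  | _, .old A =>
    letI := instIsTopologicalAddGroupAmb A
    inferInstanceAs (IsTopologicalAddGroup (Amb K V A × K))
  | _, .new A =>
    letI := instIsTopologicalAddGroupAmb A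
    inferInstanceAs (IsTopologicalAddGroup (Amb K V A × Amb K V A × K))

instance instContinuousSMulAmb [TopologicalSpace K] [TopologicalSpace V]
    [IsTopologicalRing K] [ContinuousSMul K V] :
    {n : ℕ} → (A : Vtx n) → ContinuousSMul K (Amb K V A)
  | _, .empty => inferInstanceAs (ContinuousSMul K V)
  | _, .old A =>
    letI := instContinuousSMulAmb A
    inferInstanceAs (ContinuousSMul K (Amb K V A × K))
  | _, .new A =>
    letI := instContinuousSMulAmb A
    inferInstanceAs (ContinuousSMul K (Amb K V A × Amb K V A × K))

variable [TopologicalSpace K] [TopologicalSpace V]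

theorem continuous_srcMap : ∀ {n : ℕ} {B A : Vtx n} (e : Edge B A), Continuous (srcMap K V e)
  | _, _, _, .last A => by
    change Continuous fun p : Amb K V A × Amb K V A × K => (p.1, p.2.2)
    fun_prop
  | _, _, _, .old (A := A) e => by
    have := continuous_srcMap e
    change Continuous fun p : Amb K V A × K => (srcMap K V e p.1, p.2)
    fun_prop
  | _, _, _, .new (A := A) e => by
    have := continuous_srcMap e
    change Continuous fun p : Amb K V A × Amb K V A × K =>
      (srcMap K V e p.1, srcMap K V e p.2.1, p.2.2)
    fun_prop

theorem continuous_oneMap : ∀ {n : ℕ} {B A : Vtx n} (e : Edge B A), Continuous (oneMap K V e)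
  | _, _, _, .last A => by
    change Continuous fun p : Amb K V A × K => (p.1, (0 : Amb K V A), p.2)
    fun_prop
  | _, _, _, .old (B := A) e => by
    have := continuous_oneMap e
    change Continuous fun p : Amb K V A × K => (oneMap K V e p.1, p.2)
    fun_prop
  | _, _, _, .new (B := A) e => by
    have := continuous_oneMap e
    change Continuous fun p : Amb K V A × Amb K V A × K =>
      (oneMap K V e p.1, oneMap K V e p.2.1, p.2.2)
    fun_prop

theorem continuous_compMap [IsTopologicalAddGroup K] [IsTopologicalAddGroup V] :
    ∀ {n : ℕ} {B A : Vtx n} (e : Edge B A),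
    Continuous fun p : Amb K V A × Amb K V A => compMap K V e p.1 p.2
  | _, _, _, .last A => by
    change Continuous fun p : (Amb K V A × Amb K V A × K) × (Amb K V A × Amb K V A × K) =>
      (p.2.1, p.1.2.1 + p.2.2.1, p.2.2.2)
    fun_prop
  | _, _, _, .old (A := A) e => by
    have := continuous_compMap e
    change Continuous fun p : (Amb K V A × K) × (Amb K V A × K) =>
      (compMap K V e p.1.1 p.2.1, p.2.2)
    exact (this.comp (f := fun p : (Amb K V A × K) × (Amb K V A × K) => (p.1.1, p.2.1))
      (by fun_prop)).prodMk (by fun_prop)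
  | _, _, _, .new (A := A) e => by
    have := continuous_compMap e
    change Continuous fun p : (Amb K V A × Amb K V A × K) × (Amb K V A × Amb K V A × K) =>
      (compMap K V e p.1.1 p.2.1, compMap K V e p.1.2.1 p.2.2.1, p.2.2.2)
    exact (this.comp (f := fun p : (Amb K V A × Amb K V A × K) × (Amb K V A × Amb K V A × K) =>
      (p.1.1, p.2.1)) (by fun_prop)).prodMk ((this.comp
      (f := fun p : (Amb K V A × Amb K V A × K) × (Amb K V A × Amb K V A × K) =>
      (p.1.2.1, p.2.2.1)) (by fun_prop)).prodMk (by fun_prop))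

/-! The target and inversion maps are polynomial. That they are continuous is seen by applying them
to the generic point, over the ring of continuous functions on the ambient module. -/

section universal

variable [IsTopologicalRing K] [IsTopologicalAddGroup V] [ContinuousSMul K V]
  {X : Type u} [TopologicalSpace X]

/-- Evaluation at a point, of continuous scalar functions. -/
def evalScal (x : X) : C(X, K) →+* K where
  toFun f := f x
  map_one' := rfl
  map_mul' _ _ := rfl
  map_zero' := rfl
  map_add' _ _ := rfl

/-- Evaluation at a point, of continuous vector valued functions. -/
def evalVec (x : X) : C(X, V) →+ V where
  toFun f := f x
  map_zero' := rfl
  map_add' _ _ := rfl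

theorem evalVec_smul (x : X) (r : C(X, K)) (v : C(X, V)) :
    evalVec x (r • v) = evalScal x r • evalVec x v := rfl

theorem continuous_eval_map : ∀ {n : ℕ} (A : Vtx n) (z : Amb C(X, K) C(X, V) A),
    Continuous fun x => Amb.map (evalScal (K := K) x) (evalVec (V := V) x) A z
  | _, .empty => fun z => ContinuousMap.continuous (show C(X, V) from z)
  | _, .old A => fun (z, t) => (continuous_eval_map A z).prodMk t.continuous
  | _, .new A => fun (z, w, t) => (continuous_eval_map A z).prodMk
      ((continuous_eval_map A w).prodMk t.continuous)

theorem exists_generic : ∀ {n : ℕ} (A : Vtx n) (y : X → Amb K V A), Continuous y →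
    ∃ z : Amb C(X, K) C(X, V) A,
      ∀ x, Amb.map (evalScal (K := K) x) (evalVec (V := V) x) A z = y x
  | _, .empty => fun y hy => ⟨(⟨y, hy⟩ : C(X, V)), fun _ => rfl⟩
  | _, .old A => fun y hy => by
    have hy' : Continuous fun x => ((y x : Amb K V A × K)) := hy
    obtain ⟨z, hz⟩ := exists_generic A _ (continuous_fst.comp hy')
    exact ⟨(z, ⟨_, continuous_snd.comp hy'⟩), fun x => Prod.ext (hz x) rfl⟩
  | _, .new A => fun y hy => by
    have hy' : Continuous fun x => ((y x : Amb K V A × Amb K V A × K)) := hy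
    obtain ⟨z, hz⟩ := exists_generic A _ (continuous_fst.comp hy')
    obtain ⟨w, hw⟩ := exists_generic A _ ((continuous_fst.comp continuous_snd).comp hy')
    exact ⟨(z, w, ⟨_, (continuous_snd.comp continuous_snd).comp hy'⟩),
      fun x => Prod.ext (hz x) (Prod.ext (hw x) rfl)⟩

theorem continuous_tgtMap {n : ℕ} {B A : Vtx n} (e : Edge B A) : Continuous (tgtMap e K V) := by
  obtain ⟨z, hz⟩ := exists_generic A (fun y : Amb K V A => y) continuous_id
  have : tgtMap e K V = fun x => Amb.map (evalScal (K := K) x) (evalVec (V := V) x) B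
      (tgtMap e C(Amb K V A, K) C(Amb K V A, V) z) := by
    funext x
    rw [← tgtMap_map e _ _ _ _ _ _ (evalVec_smul x), hz]
  rw [this]
  exact continuous_eval_map B _

theorem continuous_invMap {n : ℕ} {B A : Vtx n} (e : Edge B A) : Continuous (invMap e K V) := by
  obtain ⟨z, hz⟩ := exists_generic A (fun y : Amb K V A => y) continuous_id
  have : invMap e K V = fun x => Amb.map (evalScal (K := K) x) (evalVec (V := V) x) A
      (invMap e C(Amb K V A, K) C(Amb K V A, V) z) := by
    funext x
    rw [← invMap_map e _ _ _ _ _ _ (evalVec_smul x), hz]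
  rw [this]
  exact continuous_eval_map A _

end universal

end ambTopology

/-! ### Scalars -/

section scalars

variable {K V : Type u} [CommRing K] [AddCommGroup V] [Module K V]

/-- The scalar components of an element of an ambient module. -/
def scal {n : ℕ} (A : Vtx n) (y : Amb K V A) : Amb K PUnit.{u + 1} A :=
  Amb.map (RingHom.id K) (0 : V →+ PUnit.{u + 1}) A y

theorem scal_add {n : ℕ} (A : Vtx n) (y z : Amb K V A) : scal A (y + z) = scal A y + scal A z :=
  Amb.map_add _ _ _ _ _

theorem scal_smul {n : ℕ} (A : Vtx n) (r : K) (y : Amb K V A) :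
    scal A (r • y) = r • scal A y :=
  Amb.map_smul (RingHom.id K) (0 : V →+ PUnit.{u + 1}) (fun _ _ => rfl) _ _ _

theorem scal_srcMap : ∀ {n : ℕ} {B A : Vtx n} (e : Edge B A) (y : Amb K V A),
    scal B (srcMap K V e y) = srcMap K PUnit.{u + 1} e (scal A y)
  | _, _, _, .last _ => fun (_, _, _) => rfl
  | _, _, _, .old e => fun (y, _) => Prod.ext (scal_srcMap e y) rfl
  | _, _, _, .new e => fun (y, w, _) =>
    Prod.ext (scal_srcMap e y) (Prod.ext (scal_srcMap e w) rfl)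

theorem scal_zero {n : ℕ} (A : Vtx n) : scal A (0 : Amb K V A) = 0 := by
  simpa using scal_add A (0 : Amb K V A) 0

theorem scal_oneMap : ∀ {n : ℕ} {B A : Vtx n} (e : Edge B A) (y : Amb K V B),
    scal A (oneMap K V e y) = oneMap K PUnit.{u + 1} e (scal B y)
  | _, _, _, .last A => fun (_, _) => Prod.ext rfl (Prod.ext (scal_zero A) rfl)
  | _, _, _, .old e => fun (y, _) => Prod.ext (scal_oneMap e y) rfl
  | _, _, _, .new e => fun (y, w, _) =>
    Prod.ext (scal_oneMap e y) (Prod.ext (scal_oneMap e w) rfl)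

theorem scal_compMap : ∀ {n : ℕ} {B A : Vtx n} (e : Edge B A) (y z : Amb K V A),
    scal A (compMap K V e y z) = compMap K PUnit.{u + 1} e (scal A y) (scal A z)
  | _, _, _, .last A => fun (_, _, _) (_, _, _) =>
    Prod.ext rfl (Prod.ext (scal_add A _ _) rfl)
  | _, _, _, .old e => fun (y, _) (z, _) => Prod.ext (scal_compMap e y z) rfl
  | _, _, _, .new e => fun (y, w, _) (z, x, _) =>
    Prod.ext (scal_compMap e y z) (Prod.ext (scal_compMap e w x) rfl)

theorem scal_tgtMap {n : ℕ} {B A : Vtx n} (e : Edge B A) (y : Amb K V A) :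
    scal B (tgtMap e K V y) = tgtMap e K PUnit.{u + 1} (scal A y) :=
  (tgtMap_map e K V K PUnit (RingHom.id K) 0 (fun _ _ => rfl) y).symm

/-- Topology separates only the components in `V`, since no separation is assumed of `K`; the scalar
components have to be compared by hand. -/
theorem eq_of_inseparable [TopologicalSpace K] [TopologicalSpace V] [T0Space V] :
    ∀ {n : ℕ} (A : Vtx n) (y z : Amb K V A), Inseparable y z → scal A y = scal A z → y = z
  | _, .empty => fun y z h _ => Inseparable.eq (X := V) h
  | _, .old A => fun (y, t) (z, s) h hs =>
    Prod.ext (eq_of_inseparable A y z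
      (h.map (f := Prod.fst (α := Amb K V A) (β := K)) continuous_fst) (congrArg Prod.fst hs))
      (show t = s from congrArg (Prod.snd (α := Amb K PUnit.{u + 1} A) (β := K)) hs)
  | _, .new A => fun (y, w, t) (z, x, s) h hs => by
    have h2 := h.map (f := Prod.snd (α := Amb K V A) (β := Amb K V A × K)) continuous_snd
    have hs2 : (scal A w, t) = (scal A x, s) := congrArg (Prod.snd (α := Amb K PUnit.{u + 1} A)
      (β := Amb K PUnit.{u + 1} A × K)) hs
    exact Prod.ext (eq_of_inseparable A y z (h.map
      (f := Prod.fst (α := Amb K V A) (β := Amb K V A × K)) continuous_fst) (congrArg Prod.fst hs))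
      (Prod.ext (eq_of_inseparable A w x (h2.map
      (f := Prod.fst (α := Amb K V A) (β := K)) continuous_fst) (congrArg Prod.fst hs2))
        (show t = s from congrArg (Prod.snd (α := Amb K PUnit.{u + 1} A) (β := K)) hs2))

end scalars

/-! ### Vertices -/

section vertices

open Function

/-- Extension of a vertex of the cube by a coordinate in the last direction. -/
def consDir {n : ℕ} (b : Bool) (η : Dir n → Bool) : Dir (n + 1) → Bool
  | .last => b
  | .prev i => η i

theorem consDir_eta {n : ℕ} (ε : Dir (n + 1) → Bool) :
    consDir (ε .last) (fun i => ε (.prev i)) = ε := by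
  funext i; cases i <;> rfl

theorem consDir_le {n : ℕ} {b b' : Bool} {η η' : Dir n → Bool} (h : b ≤ b') (h' : η ≤ η') :
    consDir b η ≤ consDir b' η' := by
  intro i; cases i
  · exact h
  · exact h' _

/-- The face of a set of vertices in the last direction. -/
def faceLast {n : ℕ} (b : Bool) (D : Set (Dir (n + 1) → Bool)) : Set (Dir n → Bool) :=
  {η | consDir b η ∈ D}

theorem isLowerSet_faceLast {n : ℕ} {D : Set (Dir (n + 1) → Bool)} (hD : IsLowerSet D) (b : Bool) :
    IsLowerSet (faceLast b D) := fun _ _ h hη => hD (consDir_le le_rfl h) hη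

theorem faceLast_subset {n : ℕ} {D : Set (Dir (n + 1) → Bool)} (hD : IsLowerSet D) :
    faceLast true D ⊆ faceLast false D := fun _ hη => hD (consDir_le (Bool.false_le _) le_rfl) hη

theorem update_last_prev {n : ℕ} (ε : Dir (n + 1) → Bool) (b : Bool) :
    (fun i => update ε .last b (.prev i)) = fun i => ε (.prev i) := by
  funext i; simp

theorem update_prev_prev {n : ℕ} (ε : Dir (n + 1) → Bool) (j : Dir n) (b : Bool) :
    (fun i => update ε (.prev j) b (.prev i)) = update (fun i => ε (.prev i)) j b := by
  funext i; simp [update_apply]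

theorem update_prev_last {n : ℕ} (ε : Dir (n + 1) → Bool) (j : Dir n) (b : Bool) :
    update ε (.prev j) b .last = ε .last := by simp

variable {K V : Type u} [CommRing K] [AddCommGroup V] [Module K V]

/-- The vertices of a cell: its iterated sources and targets. -/
def vtx : {n : ℕ} → (A : Vtx n) → Amb K V A → (Dir n → Bool) → Amb K V (Vtx.bot n)
  | _, .empty => fun y _ => y
  | _, .old A => fun (y, t) ε => (vtx A y fun i => ε (.prev i), t)
  | _, .new A => fun (y, w, t) ε =>
    (vtx A (if ε .last then y + t • w else y) fun i => ε (.prev i), t)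

/-- In a derived direction, the structure map commutes with both endpoints `y` and `y + tw` by its
difference quotient property. So on vertices it acts as in the pair groupoid, and likewise for the
other structure maps. -/
theorem vtx_srcMap : ∀ {n : ℕ} {B A : Vtx n} (e : Edge B A) (y : Amb K V A) (ε : Dir n → Bool),
    vtx B (srcMap K V e y) ε = vtx A y (update ε e.dir false)
  | _, _, _, .last A => fun (y, w, t) ε => Prod.ext (by
      change vtx A y _ = vtx A (if update ε .last false .last then y + t • w else y)
          fun i => update ε .last false (.prev i)
      rw [update_last_prev, update_self, if_neg (by simp)]) rfl
  | _, _, _, .old (A := A) e => fun (y, t) ε => Prod.ext (by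
      refine (vtx_srcMap e y _).trans (congrArg (vtx A y) ?_)
      exact (update_prev_prev ε _ _).symm) rfl
  | _, _, _, .new (B := B) (A := A) e => fun (y, w, t) ε => Prod.ext (by
      change vtx B (if ε .last then srcMap K V e y + t • srcMap K V e w else srcMap K V e y) _
        = vtx A (if update ε (.prev e.dir) false .last then y + t • w else y) _
      rw [update_prev_last, ← srcMap_add_smul, ← apply_ite (srcMap K V e), vtx_srcMap e,
        ← update_prev_prev]
      rfl) rfl

theorem vtx_tgtMap : ∀ {n : ℕ} {B A : Vtx n} (e : Edge B A) (y : Amb K V A) (ε : Dir n → Bool),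
    vtx B (tgtMap e K V y) ε = vtx A y (update ε e.dir true)
  | _, _, _, .last A => fun (y, w, t) ε => Prod.ext (by
      change vtx A (y + t • w) _ = vtx A (if update ε .last true .last then y + t • w else y)
          fun i => update ε .last true (.prev i)
      rw [update_last_prev, update_self, if_pos rfl]) rfl
  | _, _, _, .old (A := A) e => fun (y, t) ε => Prod.ext (by
      refine (vtx_tgtMap e y _).trans (congrArg (vtx A y) ?_)
      exact (update_prev_prev ε _ _).symm) rfl
  | _, _, _, .new (B := B) (A := A) e => fun (y, w, t) ε => Prod.ext (by
      change vtx B (if ε .last then tgtMap e K V y + t • Amb.im t B (tgtMap e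
        (QuadraticAlgebra K 0 t) (Tw t V) (Amb.join t A y w)) else tgtMap e K V y) _
        = vtx A (if update ε (.prev e.dir) true .last then y + t • w else y) _
      rw [update_prev_last, ← tgtMap_add_smul, ← apply_ite (tgtMap e K V), vtx_tgtMap e,
        ← update_prev_prev]
      rfl) rfl

theorem vtx_oneMap : ∀ {n : ℕ} {B A : Vtx n} (e : Edge B A) (y : Amb K V B) (ε : Dir n → Bool),
    vtx A (oneMap K V e y) ε = vtx B y ε
  | _, _, _, .last A => fun (y, t) ε => Prod.ext (by
      change vtx A (if ε .last then y + t • (0 : Amb K V A) else y) _ = vtx A y _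
      rw [smul_zero, add_zero, ite_self]) rfl
  | _, _, _, .old e => fun (y, t) ε => Prod.ext (vtx_oneMap e y _) rfl
  | _, _, _, .new (B := B) (A := A) e => fun (y, w, t) ε => Prod.ext (by
      change vtx A (if ε .last then oneMap K V e y + t • oneMap K V e w else oneMap K V e y) _
        = vtx B (if ε .last then y + t • w else y) _
      rw [← oneMap_add_smul, ← apply_ite (oneMap K V e), vtx_oneMap e]) rfl

theorem vtx_invMap : ∀ {n : ℕ} {B A : Vtx n} (e : Edge B A) (y : Amb K V A) (ε : Dir n → Bool),
    vtx A (invMap e K V y) ε = vtx A y (update ε e.dir (!ε e.dir))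
  | _, _, _, .last A => fun (y, w, t) ε => Prod.ext (by
      change vtx A (if ε .last then y + t • w + t • (-w) else y + t • w) _
        = vtx A (if update ε .last (!ε .last) .last then y + t • w else y)
          fun i => update ε .last (!ε .last) (.prev i)
      rw [update_last_prev, update_self, smul_neg, add_neg_cancel_right]
      cases ε .last <;> simp) rfl
  | _, _, _, .old (A := A) e => fun (y, t) ε => Prod.ext (by
      refine (vtx_invMap e y _).trans (congrArg (vtx A y) ?_)
      exact (update_prev_prev ε _ _).symm) rfl
  | _, _, _, .new (B := B) (A := A) e => fun (y, w, t) ε => Prod.ext (by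
      change vtx A (if ε .last then invMap e K V y + t • Amb.im t A (invMap e
        (QuadraticAlgebra K 0 t) (Tw t V) (Amb.join t A y w)) else invMap e K V y) _
        = vtx A (if update ε (.prev e.dir) (!ε (.prev e.dir)) .last then y + t • w else y) _
      rw [update_prev_last, ← invMap_add_smul, ← apply_ite (invMap e K V), vtx_invMap e,
        ← update_prev_prev]
      rfl) rfl

theorem vtx_compMap : ∀ {n : ℕ} {B A : Vtx n} (e : Edge B A) (a b : Amb K V A)
    (_ : srcMap K V e a = tgtMap e K V b) (ε : Dir n → Bool),
    (ε e.dir = true → vtx A (compMap K V e a b) ε = vtx A a ε) ∧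
      (ε e.dir = false → vtx A (compMap K V e a b) ε = vtx A b ε)
  | _, _, _, .last A => fun (x, w', s) (y, w, t) h ε => by
    obtain ⟨h₁, h₂⟩ := Prod.mk.inj h
    obtain rfl : x = y + t • w := h₁
    obtain rfl : s = t := h₂
    have : y + s • (w' + w) = y + s • w + s • w' := by module
    refine ⟨fun hε => Prod.ext ?_ rfl, fun hε => Prod.ext ?_ rfl⟩
    · change ε .last = true at hε
      change vtx A (if ε .last then y + s • (w' + w) else y) _
        = vtx A (if ε .last then y + s • w + s • w' else y + s • w) _
      rw [this, if_pos hε, if_pos hε]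
    · change ε .last = false at hε
      change vtx A (if ε .last then y + s • (w' + w) else y) _
        = vtx A (if ε .last then y + s • w else y) _
      rw [if_neg (by simp [hε]), if_neg (by simp [hε])]
  | _, _, _, .old e => fun (x, s) (y, t) h ε => by
    obtain ⟨h₁, h₂⟩ := Prod.mk.inj h
    obtain rfl : s = t := h₂
    have := vtx_compMap e x y h₁ fun i => ε (.prev i)
    exact ⟨fun hε => Prod.ext (this.1 hε) rfl, fun hε => Prod.ext (this.2 hε) rfl⟩
  | _, _, _, .new (A := A) e => fun (x, w', s) (y, w, t) h ε => by
    obtain ⟨h₁, h₂⟩ := Prod.mk.inj h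
    obtain ⟨h₂, h₃⟩ := Prod.mk.inj h₂
    obtain rfl : s = t := h₃
    have h0 := vtx_compMap e x y h₁ fun i => ε (.prev i)
    have h1 := vtx_compMap e (x + s • w') (y + s • w)
      (by rw [srcMap_add_smul, tgtMap_add_smul, h₁, h₂]) fun i => ε (.prev i)
    rw [compMap_add_smul] at h1
    refine ⟨fun hε => Prod.ext ?_ rfl, fun hε => Prod.ext ?_ rfl⟩
    · change vtx A (if ε .last then compMap K V e x y + s • compMap K V e w' w
        else compMap K V e x y) _ = vtx A (if ε .last then x + s • w' else x) _
      split_ifs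
      · exact h1.1 hε
      · exact h0.1 hε
    · change vtx A (if ε .last then compMap K V e x y + s • compMap K V e w' w
        else compMap K V e x y) _ = vtx A (if ε .last then y + s • w else y) _
      split_ifs
      · exact h1.2 hε
      · exact h0.2 hε

/-- The conditions `y ∈ U^{A;n}` and `y + tw ∈ U^{A;n}` split the vertex conditions according to the
last coordinate. -/
theorem mem_ext_iff {U : Set V} : ∀ {n : ℕ} (A : Vtx n) (y : Amb K V A),
    y ∈ ext K U A ↔ ∀ ε, vtx A y ε ∈ ext K U (Vtx.bot n)
  | _, .empty => fun y => ⟨fun h _ => h, fun h => h fun i => nomatch i⟩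
  | _, .old A => fun (y, t) => (mem_ext_iff A y).trans
      ⟨fun h ε => h fun i => ε (.prev i), fun h η => h (consDir false η)⟩
  | _, .new A => fun (y, w, t) => by
    refine (and_congr (mem_ext_iff A y) (mem_ext_iff A (y + t • w))).trans
      ⟨fun h ε => ?_, fun h => ⟨fun η => ?_, fun η => ?_⟩⟩
    · change vtx A (if ε .last then y + t • w else y) _ ∈ ext K U _
      split_ifs
      · exact h.2 _
      · exact h.1 _
    · exact h (consDir false η)
    · exact h (consDir true η)

theorem mem_finExt_iff {U : Set V} : ∀ {n : ℕ} (A : Vtx n) (y : Amb K V A),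
    y ∈ finExt K U A ↔ ∀ ε, vtx A y ε ∈ finExt K U (Vtx.bot n)
  | _, .empty => fun y => ⟨fun h _ => h, fun h => h fun i => nomatch i⟩
  | _, .old A => fun (y, t) => (and_congr_left' (mem_finExt_iff A y)).trans
      ⟨fun h ε => ⟨h.1 fun i => ε (.prev i), h.2⟩,
        fun h => ⟨fun η => (h (consDir false η)).1, (h fun _ => false).2⟩⟩
  | _, .new A => fun (y, w, t) => by
    refine (and_congr_left' (and_congr (mem_finExt_iff A y)
      (mem_finExt_iff A (y + t • w)))).trans
      ⟨fun h ε => ⟨?_, h.2⟩, fun h => ⟨⟨fun η => ?_, fun η => ?_⟩, (h fun _ => false).2⟩⟩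
    · change vtx A (if ε .last then y + t • w else y) _ ∈ finExt K U _
      split_ifs
      · exact h.1.2 _
      · exact h.1.1 _
    · exact (h (consDir false η)).1
    · exact (h (consDir true η)).1

theorem mem_finExt_iff_and {U : Set V} : ∀ {n : ℕ} (A : Vtx n) (y : Amb K V A),
    y ∈ finExt K U A ↔ y ∈ ext K U A ∧ y ∈ finExt K univ A
  | _, .empty => fun y => ⟨fun h => ⟨h, trivial⟩, fun h => h.1⟩
  | _, .old A => fun (y, t) => (and_congr_left' (mem_finExt_iff_and A y)).trans and_assoc
  | _, .new A => fun (y, w, t) => by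
    refine (and_congr_left' (and_congr (mem_finExt_iff_and A y)
      (mem_finExt_iff_and A (y + t • w)))).trans ?_
    change _ ↔ (_ ∧ _) ∧ (_ ∧ _) ∧ _
    tauto

/-- The endpoints `y` and `y + tw` are recovered by induction, and then `w` by dividing by the unit
`t`. Finiteness of one element suffices, because the scalars can be read off from the vertices. -/
theorem vtx_injective : ∀ {n : ℕ} (A : Vtx n) (y y' : Amb K V A), y ∈ finExt K univ A →
    (∀ ε, vtx A y ε = vtx A y' ε) → y = y'
  | _, .empty => fun y y' _ h => h fun i => nomatch i
  | _, .old A => fun (y, t) (y', t') hy h =>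
    Prod.ext (vtx_injective A y y' hy.1 fun η => congrArg Prod.fst (h (consDir false η)))
      (show t = t' from congrArg (Prod.snd (α := Amb K V (Vtx.bot _)) (β := K))
        (h fun _ => false))
  | _, .new A => fun (y, w, t) (y', w', t') hy h => by
    obtain rfl : y = y' :=
      vtx_injective A y y' hy.1.1 fun η => congrArg Prod.fst (h (consDir false η))
    obtain rfl : t = t' := congrArg (Prod.snd (α := Amb K V (Vtx.bot _)) (β := K))
        (h fun _ => false)
    have h2 : y + t • w = y + t • w' :=
      vtx_injective A _ _ hy.1.2 fun η => congrArg Prod.fst (h (consDir true η))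
    obtain rfl : w = w' := by
      obtain ⟨s, hs⟩ : ∃ s, s * t = 1 := hy.2.exists_left_inv
      have h3 := congrArg (s • ·) (add_left_cancel h2)
      simpa [smul_smul, hs] using h3
    rfl

theorem continuous_vtx [TopologicalSpace K] [TopologicalSpace V] [IsTopologicalRing K]
    [IsTopologicalAddGroup V] [ContinuousSMul K V] : ∀ {n : ℕ} (A : Vtx n) (ε : Dir n → Bool),
    Continuous fun y : Amb K V A => vtx A y ε
  | _, .empty => fun _ => continuous_id
  | _, .old A => fun ε => ((continuous_vtx A _).comp
      (continuous_fst (X := Amb K V A) (Y := K))).prodMk continuous_snd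
  | _, .new A => fun ε => by
    refine Continuous.prodMk (f := fun p : Amb K V A × Amb K V A × K =>
      vtx A (if ε .last then p.1 + p.2.2 • p.2.1 else p.1) fun i => ε (.prev i)) ?_
      (continuous_snd.comp continuous_snd)
    refine (continuous_vtx A _).comp ?_
    split_ifs <;> fun_prop

theorem vtx_bot : ∀ (n : ℕ) (p : Amb K V (Vtx.bot n)) (ε : Dir n → Bool),
    vtx (Vtx.bot n) p ε = p
  | 0 => fun _ _ => rfl
  | n + 1 => fun p _ => Prod.ext (vtx_bot n (Prod.fst (α := Amb K V (Vtx.bot n)) (β := K) p) _) rfl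

theorem isOpen_ext [TopologicalSpace K] [TopologicalSpace V] [IsTopologicalRing K]
    [IsTopologicalAddGroup V] [ContinuousSMul K V] {U : Set V} (hU : IsOpen U) :
    ∀ {n : ℕ} (A : Vtx n), IsOpen (ext K U A)
  | _, .empty => hU
  | _, .old A => (isOpen_ext hU A).preimage (continuous_fst (X := Amb K V A) (Y := K))
  | _, .new A => ((isOpen_ext hU A).preimage (continuous_fst (X := Amb K V A)
      (Y := Amb K V A × K))).inter ((isOpen_ext hU A).preimage
      (f := fun p : Amb K V A × Amb K V A × K => p.1 + p.2.2 • p.2.1) (by fun_prop))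

end vertices

/-! ### Elements which vanish on a set of vertices -/

section vanish

open Function

variable {K V : Type u} [CommRing K] [AddCommGroup V] [Module K V]

/-- The components of `y` on which the vertices in the lower set `D` depend are zero. -/
def VanishOn : {n : ℕ} → (A : Vtx n) → Set (Dir n → Bool) → Amb K V A → Prop
  | _, .empty => fun D y => D.Nonempty → (show V from y) = 0
  | _, .old A => fun D (y, t) => VanishOn A (faceLast false D) y ∧ (D.Nonempty → t = 0)
  | _, .new A => fun D (y, w, t) => VanishOn A (faceLast false D) y ∧
      VanishOn A (faceLast true D) w ∧ (D.Nonempty → t = 0)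

theorem vanishOn_add : ∀ {n : ℕ} (A : Vtx n) (D : Set (Dir n → Bool)) (y z : Amb K V A),
    VanishOn A D y → VanishOn A D z → VanishOn A D (y + z)
  | _, .empty => fun D y z hy hz hD => by
    have h1 : (show V from y) = 0 := hy hD
    have h2 : (show V from z) = 0 := hz hD
    change (show V from y) + (show V from z) = 0
    rw [h1, h2, add_zero]
  | _, .old A => fun D (y, t) (z, s) hy hz => ⟨vanishOn_add A _ y z hy.1 hz.1, fun hD => by
      change t + s = 0
      rw [hy.2 hD, hz.2 hD, add_zero]⟩
  | _, .new A => fun D (y, w, t) (z, x, s) hy hz =>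
    ⟨vanishOn_add A _ y z hy.1 hz.1, vanishOn_add A _ w x hy.2.1 hz.2.1, fun hD => by
      change t + s = 0
      rw [hy.2.2 hD, hz.2.2 hD, add_zero]⟩

theorem VanishOn.add {n : ℕ} {A : Vtx n} {D : Set (Dir n → Bool)} {y z : Amb K V A}
    (hy : VanishOn A D y) (hz : VanishOn A D z) : VanishOn A D (y + z) :=
  vanishOn_add A D y z hy hz

theorem vanishOn_smul : ∀ {n : ℕ} (A : Vtx n) (D : Set (Dir n → Bool)) (y : Amb K V A) (r : K),
    VanishOn A D y → VanishOn A D (r • y)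
  | _, .empty => fun D y r hy hD => by
    have h1 : (show V from y) = 0 := hy hD
    change r • (show V from y) = 0
    rw [h1, smul_zero]
  | _, .old A => fun D (y, t) r hy => ⟨vanishOn_smul A _ y r hy.1, fun hD => by
      change r * t = 0
      rw [hy.2 hD, mul_zero]⟩
  | _, .new A => fun D (y, w, t) r hy =>
    ⟨vanishOn_smul A _ y r hy.1, vanishOn_smul A _ w r hy.2.1, fun hD => by
      change r * t = 0
      rw [hy.2.2 hD, mul_zero]⟩

theorem VanishOn.smul {n : ℕ} {A : Vtx n} {D : Set (Dir n → Bool)} {y : Amb K V A} (r : K)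
    (hy : VanishOn A D y) : VanishOn A D (r • y) := vanishOn_smul A D y r hy

theorem VanishOn.zero {n : ℕ} (A : Vtx n) (D : Set (Dir n → Bool)) :
    VanishOn A D (0 : Amb K V A) := by
  induction A with
  | empty => exact fun _ => rfl
  | old A ih => exact ⟨ih _, fun _ => rfl⟩
  | new A ih => exact ⟨ih _, ih _, fun _ => rfl⟩

theorem VanishOn.neg {n : ℕ} {A : Vtx n} {D : Set (Dir n → Bool)} {y : Amb K V A}
    (h : VanishOn A D y) : VanishOn A D (-y) := by
  simpa using h.smul (-1)

theorem VanishOn.sub {n : ℕ} {A : Vtx n} {D : Set (Dir n → Bool)} {y z : Amb K V A}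
    (h : VanishOn A D y) (h' : VanishOn A D z) : VanishOn A D (y - z) := by
  simpa [sub_eq_add_neg] using h.add h'.neg

theorem VanishOn.mono {n : ℕ} {A : Vtx n} {D D' : Set (Dir n → Bool)} (hD : D' ⊆ D)
    {y : Amb K V A} (h : VanishOn A D y) : VanishOn A D' y := by
  induction A with
  | empty => exact fun hD' => h (hD'.mono hD)
  | old A ih => exact ⟨ih (fun _ hη => hD hη) h.1, fun hD' => h.2 (hD'.mono hD)⟩
  | new A ih => exact ⟨ih (fun _ hη => hD hη) h.1, ih (fun _ hη => hD hη) h.2.1,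
      fun hD' => h.2.2 (hD'.mono hD)⟩

theorem vanishOn_of_empty {n : ℕ} {A : Vtx n} {D : Set (Dir n → Bool)} (hD : ¬ D.Nonempty)
    (y : Amb K V A) : VanishOn A D y := by
  induction A with
  | empty => exact fun h => absurd h hD
  | old A ih => exact ⟨ih (fun ⟨η, hη⟩ => hD ⟨_, hη⟩) _, fun h => absurd h hD⟩
  | new A ih => exact ⟨ih (fun ⟨η, hη⟩ => hD ⟨_, hη⟩) _, ih (fun ⟨η, hη⟩ => hD ⟨_, hη⟩) _,
      fun h => absurd h hD⟩

/-- The vertices in `D` are determined by the components belonging to `D`. -/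
theorem vtx_eq_of_vanishOn : ∀ {n : ℕ} (A : Vtx n) {D : Set (Dir n → Bool)} (_ : IsLowerSet D)
    {z z' : Amb K V A}, VanishOn A D (z - z') → ∀ ε ∈ D, vtx A z ε = vtx A z' ε
  | _, .empty => fun hD z z' h ε hε => sub_eq_zero.mp (h ⟨ε, hε⟩)
  | _, .old A => fun hD (y, t) (y', t') h ε hε => by
    obtain rfl : t = t' := sub_eq_zero.mp (h.2 ⟨ε, hε⟩)
    refine Prod.ext (vtx_eq_of_vanishOn A (isLowerSet_faceLast hD false) h.1 _ ?_) rfl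
    refine hD ?_ hε
    conv_rhs => rw [← consDir_eta ε]
    exact consDir_le (Bool.false_le _) le_rfl
  | _, .new A => fun hD (y, w, t) (y', w', t') h ε hε => by
    obtain rfl : t = t' := sub_eq_zero.mp (h.2.2 ⟨ε, hε⟩)
    refine Prod.ext ?_ rfl
    change vtx A (if ε .last then y + t • w else y) _ = vtx A (if ε .last then y' + t • w' else y') _
    have hε' := hε
    rw [← consDir_eta ε] at hε'
    cases hl : ε .last
    · rw [hl] at hε'
      exact vtx_eq_of_vanishOn A (isLowerSet_faceLast hD false) h.1 _ hε'
    · rw [hl] at hε'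
      refine vtx_eq_of_vanishOn A (isLowerSet_faceLast hD true) ?_ _ hε'
      have : (y + t • w) - (y' + t • w') = (y - y') + t • (w - w') := by module
      simp only [if_true, this]
      exact (h.1.mono (faceLast_subset hD)).add (h.2.1.smul t)

/-- A localized form of `vtx_injective`. Because `D` is a lower set, its face at `1` is contained in
its face at `0`; hence wherever `w` matters, `y` is already known and `w` is obtained by division by
`t`. -/
theorem vanishOn_of_vtx_eq : ∀ {n : ℕ} (A : Vtx n) (D : Set (Dir n → Bool)) (_ : IsLowerSet D)
    (z z' : Amb K V A), z ∈ finExt K univ A → (∀ ε ∈ D, vtx A z ε = vtx A z' ε) →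
    VanishOn A D (z - z')
  | _, .empty => fun D hD z z' _ h ⟨ε, hε⟩ => sub_eq_zero.mpr (h ε hε)
  | _, .old A => fun D hD (y, t) (y', t') hz h =>
    ⟨vanishOn_of_vtx_eq A _ (isLowerSet_faceLast hD false) _ _ hz.1
      fun η hη => congrArg (Prod.fst (α := Amb K V (Vtx.bot _)) (β := K)) (h _ hη),
      fun ⟨ε, hε⟩ => sub_eq_zero.mpr
        (congrArg (Prod.snd (α := Amb K V (Vtx.bot _)) (β := K)) (h ε hε))⟩
  | _, .new A => fun D hD (y, w, t) (y', w', t') hz h => by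
    have ht : D.Nonempty → t = t' := fun ⟨ε, hε⟩ =>
      congrArg (Prod.snd (α := Amb K V (Vtx.bot _)) (β := K)) (h ε hε)
    have h0 : VanishOn A (faceLast false D) (y - y') :=
      vanishOn_of_vtx_eq A _ (isLowerSet_faceLast hD false) _ _ hz.1.1
        fun η hη => congrArg (Prod.fst (α := Amb K V (Vtx.bot _)) (β := K)) (h _ hη)
    refine ⟨h0, ?_, fun hD' => sub_eq_zero.mpr (ht hD')⟩
    change VanishOn A (faceLast true D) (w - w')
    by_cases hD1 : (faceLast true D).Nonempty
    · obtain rfl := ht (hD1.elim fun _ hη => ⟨_, hη⟩)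
      have h1 : VanishOn A (faceLast true D) ((y + t • w) - (y' + t • w')) :=
        vanishOn_of_vtx_eq A _ (isLowerSet_faceLast hD true) _ _ hz.1.2
          fun η hη => congrArg (Prod.fst (α := Amb K V (Vtx.bot _)) (β := K)) (h _ hη)
      obtain ⟨s, hs⟩ : ∃ s, s * t = 1 := hz.2.exists_left_inv
      have h2 := (h1.sub (h0.mono (faceLast_subset hD))).smul s
      have : s • ((y + t • w) - (y' + t • w') - (y - y')) = w - w' := by
        have : (y + t • w) - (y' + t • w') - (y - y') = t • (w - w') := by module
        rw [this, smul_smul, hs, one_smul]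
      rwa [this] at h2
    · exact vanishOn_of_empty hD1 _

open Classical in
/-- The element with the components of `z` belonging to `D`, and those of `z'` otherwise. -/
noncomputable def mix : {n : ℕ} → (A : Vtx n) → Set (Dir n → Bool) → Amb K V A → Amb K V A →
    Amb K V A
  | _, .empty => fun D z z' => if D.Nonempty then z else z'
  | _, .old A => fun D (y, t) (y', t') =>
    (mix A (faceLast false D) y y', if D.Nonempty then t else t')
  | _, .new A => fun D (y, w, t) (y', w', t') =>
    (mix A (faceLast false D) y y', mix A (faceLast true D) w w', if D.Nonempty then t else t')

open Classical in
theorem vanishOn_mix_sub_left : ∀ {n : ℕ} (A : Vtx n) (D : Set (Dir n → Bool)) (z z' : Amb K V A),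
    VanishOn A D (mix A D z z' - z)
  | _, .empty => fun D z z' h => sub_eq_zero.mpr (if_pos h)
  | _, .old A => fun D (y, t) (y', t') =>
    ⟨vanishOn_mix_sub_left A _ y y', fun h => sub_eq_zero.mpr (if_pos h)⟩
  | _, .new A => fun D (y, w, t) (y', w', t') => ⟨vanishOn_mix_sub_left A _ y y',
      vanishOn_mix_sub_left A _ w w', fun h => sub_eq_zero.mpr (if_pos h)⟩

theorem inter_nonempty_of_isLowerSet {D : Type*} {R R' : Set (D → Bool)} (hR : IsLowerSet R)
    (hR' : IsLowerSet R') (h : R.Nonempty) (h' : R'.Nonempty) : (R ∩ R').Nonempty :=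
  ⟨fun _ => false, h.elim fun _ hε => hR (fun _ => Bool.false_le _) hε,
    h'.elim fun _ hε => hR' (fun _ => Bool.false_le _) hε⟩

theorem ite_sub_eq_zero {E : Type*} [AddGroup E] {p q : Prop} [Decidable p] {a b : E}
    (h : p → q → a - b = 0) (hq : q) : (if p then a else b) - b = 0 := by
  split_ifs with hp
  · exact h hp hq
  · exact sub_self b

open Classical in
-- Two nonempty lower sets share the vertex `0`, so a component that matters for both of them
-- matters for their intersection, where `z` and `z'` agree.
theorem vanishOn_mix_sub_right : ∀ {n : ℕ} (A : Vtx n) {D D' : Set (Dir n → Bool)}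
    (_ : IsLowerSet D) (_ : IsLowerSet D') {z z' : Amb K V A}, VanishOn A (D ∩ D') (z - z') →
    VanishOn A D' (mix A D z z' - z')
  | _, .empty => fun hD hD' z z' h h' =>
    ite_sub_eq_zero (E := V) (fun h₁ h₂ => h (inter_nonempty_of_isLowerSet hD hD' h₁ h₂)) h'
  | _, .old A => fun hD hD' (y, t) (y', t') h =>
    ⟨vanishOn_mix_sub_right A (isLowerSet_faceLast hD _) (isLowerSet_faceLast hD' _) h.1,
      fun h' => ite_sub_eq_zero (fun h₁ h₂ => h.2 (inter_nonempty_of_isLowerSet hD hD' h₁ h₂)) h'⟩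
  | _, .new A => fun hD hD' (y, w, t) (y', w', t') h =>
    ⟨vanishOn_mix_sub_right A (isLowerSet_faceLast hD _) (isLowerSet_faceLast hD' _) h.1,
      vanishOn_mix_sub_right A (isLowerSet_faceLast hD _) (isLowerSet_faceLast hD' _) h.2.1,
      fun h' => ite_sub_eq_zero (fun h₁ h₂ => h.2.2 (inter_nonempty_of_isLowerSet hD hD' h₁ h₂)) h'⟩

open Classical in
theorem mix_self : ∀ {n : ℕ} (A : Vtx n) (D : Set (Dir n → Bool)) (z : Amb K V A), mix A D z z = z
  | _, .empty => fun D z => ite_self _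
  | _, .old A => fun D (y, t) => Prod.ext (mix_self A _ y) (ite_self _)
  | _, .new A => fun D (y, w, t) =>
    Prod.ext (mix_self A _ y) (Prod.ext (mix_self A _ w) (ite_self _))

/-! ### Approximation by finite elements -/

section topology

variable [TopologicalSpace K] [TopologicalSpace V]

open Classical in
theorem continuous_ite_fst_snd {E : Type*} [TopologicalSpace E] (p : Prop) :
    Continuous fun x : E × E => if p then x.1 else x.2 := by
  split_ifs <;> fun_prop

open Classical in
theorem continuous_mix : ∀ {n : ℕ} (A : Vtx n) (D : Set (Dir n → Bool)),
    Continuous fun p : Amb K V A × Amb K V A => mix A D p.1 p.2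
  | _, .empty => fun D => continuous_ite_fst_snd (E := V) _
  | _, .old A => fun D => by
    have h1 := (continuous_mix A (faceLast false D)).comp
      (f := fun p : (Amb K V A × K) × (Amb K V A × K) => (p.1.1, p.2.1)) (by fun_prop)
    have h3 := (continuous_ite_fst_snd (E := K) D.Nonempty).comp
      (f := fun p : (Amb K V A × K) × (Amb K V A × K) => (p.1.2, p.2.2)) (by fun_prop)
    exact h1.prodMk h3
  | _, .new A => fun D => by
    have h1 := (continuous_mix A (faceLast false D)).comp
      (f := fun p : (Amb K V A × Amb K V A × K) × (Amb K V A × Amb K V A × K) => (p.1.1, p.2.1))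
      (by fun_prop)
    have h2 := (continuous_mix A (faceLast true D)).comp
      (f := fun p : (Amb K V A × Amb K V A × K) × (Amb K V A × Amb K V A × K) =>
        (p.1.2.1, p.2.2.1)) (by fun_prop)
    have h3 := (continuous_ite_fst_snd (E := K) D.Nonempty).comp
      (f := fun p : (Amb K V A × Amb K V A × K) × (Amb K V A × Amb K V A × K) =>
        (p.1.2.2, p.2.2.2)) (by fun_prop)
    exact h1.prodMk (h2.prodMk h3)

variable [IsTopologicalRing K] [IsTopologicalAddGroup V] [ContinuousSMul K V]

theorem mem_closure_unit (hK : Dense {t : K | IsUnit t}) {p : Prop} {t : K} (h : p → IsUnit t) :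
    t ∈ closure {s : K | IsUnit s ∧ (p → s - t = 0)} := by
  by_cases hp : p
  · exact subset_closure ⟨h hp, fun _ => sub_self t⟩
  · have : {s : K | IsUnit s ∧ (p → s - t = 0)} = {s : K | IsUnit s} := by
      ext s; simp [hp]
    rw [this]
    exact hK t

/-- If the vertices of `z` in `D` are finite, then `z` can be approximated by finite elements with
the same components belonging to `D`. -/
theorem mem_closure_finExt (hK : Dense {t : K | IsUnit t}) : ∀ {n : ℕ} (A : Vtx n)
    (D : Set (Dir n → Bool)) (_ : IsLowerSet D) (z : Amb K V A),
    (∀ ε ∈ D, vtx A z ε ∈ finExt K univ (Vtx.bot n)) →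
    z ∈ closure {z' | z' ∈ finExt K univ A ∧ VanishOn A D (z' - z)}
  | _, .empty => fun D hD z _ => subset_closure ⟨trivial, by rw [sub_self]; exact VanishOn.zero _ _⟩
  | _, .old A => fun D hD (y, t) h => by
    have hy := mem_closure_finExt hK A _ (isLowerSet_faceLast hD false) y fun η hη => (h _ hη).1
    have ht := mem_closure_unit hK (p := D.Nonempty) (t := t) fun ⟨ε, hε⟩ => (h ε hε).2
    have := mk_mem_prod hy ht
    rw [← closure_prod_eq] at this
    refine closure_mono (s := _ ×ˢ _) ?_ this
    rintro ⟨y', t'⟩ ⟨hy', ht'⟩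
    exact ⟨⟨hy'.1, ht'.1⟩, hy'.2, ht'.2⟩
  | _, .new A => fun D hD (y, w, t) h => by
    have hy := mem_closure_finExt hK A _ (isLowerSet_faceLast hD false) y fun η hη => (h _ hη).1
    have ht := mem_closure_unit hK (p := D.Nonempty) (t := t) fun ⟨ε, hε⟩ => (h ε hε).2
    have hyt := mk_mem_prod hy ht
    rw [← closure_prod_eq] at hyt
    -- The approximation has two stages: first `y` and `t` are moved with `w` fixed, so that the
    -- scalar becomes invertible; then `w` is moved.
    have hc : Continuous fun p : Amb K V A × K => ((p.1, w, p.2) : Amb K V A × Amb K V A × K) := by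
      fun_prop
    have := hc.continuousOn.image_closure ⟨_, hyt, rfl⟩
    refine closure_minimal ?_ isClosed_closure this
    rintro _ ⟨⟨y', t'⟩, ⟨⟨hy'1, hy'2⟩, ht'1, ht'2⟩, rfl⟩
    -- With `t'` invertible, the second endpoint `x` can be chosen freely near `y' + t'w`, and the
    -- new vector component is `t'⁻¹ (x - y')`.
    have hw : y' + t' • w ∈ closure {x | x ∈ finExt K univ A ∧
        VanishOn A (faceLast true D) (x - (y' + t' • w))} := by
      refine mem_closure_finExt hK A _ (isLowerSet_faceLast hD true) _ fun η hη => ?_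
      -- If `D` reaches this face, then it is nonempty and the scalar has not been changed.
      obtain rfl : t' = t := sub_eq_zero.mp (ht'2 ⟨_, hη⟩)
      have h1 : VanishOn A (faceLast true D) (y' + t' • w - (y + t' • w)) := by
        rw [add_sub_add_right_eq_sub]
        exact hy'2.mono (faceLast_subset hD)
      rw [vtx_eq_of_vanishOn A (isLowerSet_faceLast hD true) h1 η hη]
      exact (h _ hη).1
    obtain ⟨s, hs⟩ : ∃ s, s * t' = 1 := ht'1.exists_left_inv
    have hs' : t' * s = 1 := by rw [mul_comm, hs]
    have hc : Continuous fun x : Amb K V A =>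
        ((y', s • (x - y'), t') : Amb K V A × Amb K V A × K) := by fun_prop
    have := hc.continuousOn.image_closure ⟨_, hw, rfl⟩
    have hws : s • (y' + t' • w - y') = w := by
      rw [add_sub_cancel_left, smul_smul, hs, one_smul]
    simp only [hws] at this
    refine closure_mono ?_ this
    rintro _ ⟨x, ⟨hx1, hx2⟩, rfl⟩
    refine ⟨⟨⟨hy'1, ?_⟩, ht'1⟩, hy'2, ?_, ht'2⟩
    · change y' + t' • s • (x - y') ∈ finExt K univ A
      rwa [smul_smul, hs', one_smul, add_sub_cancel]
    · change VanishOn A (faceLast true D) (s • (x - y') - w)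
      have : s • (x - y') - w = s • (x - (y' + t' • w)) := by
        rw [sub_add_eq_sub_sub, smul_sub, smul_sub s _ (t' • w), smul_smul, hs, one_smul, smul_sub]
      rw [this]
      exact hx2.smul s

theorem dense_finExt (hK : Dense {t : K | IsUnit t}) {n : ℕ} (A : Vtx n) :
    Dense (finExt K (univ : Set V) A) := fun z =>
  closure_mono (fun _ h => h.1)
    (mem_closure_finExt hK A ∅ (fun _ _ _ h => h) z fun _ h => h.elim)

/-- The finite part of `U^n` is dense in `U^n`, if `U` is open. -/
theorem ext_subset_closure_finExt (hK : Dense {t : K | IsUnit t}) {U : Set V} (hU : IsOpen U)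
    {n : ℕ} (A : Vtx n) : ext K U A ⊆ closure (finExt K U A) := fun z hz => by
  have := (dense_finExt hK A).open_subset_closure_inter (isOpen_ext hU A) hz
  refine closure_mono (fun y hy => (mem_finExt_iff_and A y).mpr hy) this

end topology

end vanish

/-! ### The top cell -/

section top

open Function

/-- The vertex `{1, …, n}`. -/
def Vtx.top : (n : ℕ) → Vtx n
  | 0 => .empty
  | n + 1 => .new (Vtx.top n)

/-- The complement of a direction. -/
def topErase : {n : ℕ} → Dir n → Vtx n
  | n + 1, .last => .old (Vtx.top n)
  | _ + 1, .prev i => .new (topErase i)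

/-- The edge to the top vertex in a given direction. -/
def topEdge : {n : ℕ} → (i : Dir n) → Edge (topErase i) (Vtx.top n)
  | n + 1, .last => .last (Vtx.top n)
  | _ + 1, .prev i => .new (topEdge i)

theorem topEdge_dir : ∀ {n : ℕ} (i : Dir n), (topEdge i).dir = i
  | _ + 1, .last => rfl
  | _ + 1, .prev i => congrArg Dir.prev (topEdge_dir i)

/-- Every vertex of the hypercube is reached from the top vertex by descending along edges. -/
theorem vtx_induction : ∀ {n : ℕ} {P : Vtx n → Prop}
    (_ : ∀ {B A : Vtx n}, Edge B A → P A → P B) (_ : P (Vtx.top n)) (A : Vtx n), P A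
  | 0, _ => fun _ h A => match A with
    | .empty => h
  | _ + 1, P => fun he h A => match A with
    | .old A => he (.last A) <| vtx_induction (P := fun A => P (.new A)) (fun e => he (.new e)) h A
    | .new A => vtx_induction (P := fun A => P (.new A)) (fun e => he (.new e)) h A

variable {K V : Type u} [CommRing K] [AddCommGroup V] [Module K V]

/-- The degenerate top cell given by a cell. -/
def up : {n : ℕ} → (A : Vtx n) → Amb K V A → Amb K V (Vtx.top n)
  | _, .empty => fun y => y
  | _, .old A => fun (y, t) => (up A y, 0, t)
  | _, .new A => fun (y, w, t) => (up A y, up A w, t)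

/-- A left inverse of `up`. -/
def down {K V : Type u} : {n : ℕ} → (A : Vtx n) → Amb K V (Vtx.top n) → Amb K V A
  | _, .empty => fun y => y
  | _, .old A => fun (y, _, t) => (down A y, t)
  | _, .new A => fun (y, w, t) => (down A y, down A w, t)

theorem down_up : ∀ {n : ℕ} (A : Vtx n) (y : Amb K V A), down A (up A y) = y
  | _, .empty => fun _ => rfl
  | _, .old A => fun (y, t) => Prod.ext (down_up A y) rfl
  | _, .new A => fun (y, w, t) => Prod.ext (down_up A y) (Prod.ext (down_up A w) rfl)

theorem up_zero : ∀ {n : ℕ} (A : Vtx n), up A (0 : Amb K V A) = 0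
  | _, .empty => rfl
  | _, .old A => Prod.ext (up_zero A) rfl
  | _, .new A => Prod.ext (up_zero A) (Prod.ext (up_zero A) rfl)

theorem up_add : ∀ {n : ℕ} (A : Vtx n) (y z : Amb K V A), up A (y + z) = up A y + up A z
  | _, .empty => fun _ _ => rfl
  | _, .old A => fun (y, t) (z, s) => Prod.ext (up_add A y z) (Prod.ext (add_zero _).symm rfl)
  | _, .new A => fun (y, w, t) (z, x, s) => Prod.ext (up_add A y z) (Prod.ext (up_add A w x) rfl)

theorem up_smul : ∀ {n : ℕ} (A : Vtx n) (r : K) (y : Amb K V A), up A (r • y) = r • up A y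
  | _, .empty => fun _ _ => rfl
  | _, .old A => fun r (y, t) => Prod.ext (up_smul A r y) (Prod.ext (smul_zero _).symm rfl)
  | _, .new A => fun r (y, w, t) => Prod.ext (up_smul A r y) (Prod.ext (up_smul A r w) rfl)

theorem up_join (t : K) : ∀ {n : ℕ} (A : Vtx n) (y w : Amb K V A),
    up A (Amb.join t A y w) = Amb.join t (Vtx.top n) (up A y) (up A w)
  | _, .empty => fun _ _ => rfl
  | _, .old A => fun (y, _) (w, _) =>
    Prod.ext (up_join t A y w) (Prod.ext (Amb.join_zero t _).symm rfl)
  | _, .new A => fun (y, y', _) (w, w', _) =>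
    Prod.ext (up_join t A y w) (Prod.ext (up_join t A y' w') rfl)

theorem Amb.im_zero (t : K) {n : ℕ} (A : Vtx n) :
    Amb.im t A (0 : Amb (QuadraticAlgebra K 0 t) (Tw t V) A) = 0 := by
  rw [← Amb.join_zero, Amb.im_join]

theorem up_im (t : K) : ∀ {n : ℕ} (A : Vtx n) (z : Amb (QuadraticAlgebra K 0 t) (Tw t V) A),
    up A (Amb.im t A z) = Amb.im t (Vtx.top n) (up A z)
  | _, .empty => fun _ => rfl
  | _, .old A => fun (z, _) => Prod.ext (up_im t A z) (Prod.ext (Amb.im_zero t _).symm rfl)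
  | _, .new A => fun (z, z', _) => Prod.ext (up_im t A z) (Prod.ext (up_im t A z') rfl)

/-- A cell and its unit have the same degenerate top cell. For this reason units act as the identity
on sets of nets. -/
theorem up_oneMap : ∀ {n : ℕ} {B A : Vtx n} (e : Edge B A) (y : Amb K V B),
    up A (oneMap K V e y) = up B y
  | _, _, _, .last A => fun (y, t) => Prod.ext rfl (Prod.ext (up_zero A) rfl)
  | _, _, _, .old e => fun (y, t) => Prod.ext (up_oneMap e y) rfl
  | _, _, _, .new e => fun (y, w, t) => Prod.ext (up_oneMap e y) (Prod.ext (up_oneMap e w) rfl)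

theorem up_srcMap : ∀ {n : ℕ} {B A : Vtx n} (e : Edge B A) (y : Amb K V A),
    up B (srcMap K V e y)
      = oneMap K V (topEdge e.dir) (srcMap K V (topEdge e.dir) (up A y))
  | _, _, _, .last A => fun (y, w, t) => rfl
  | _, _, _, .old (B := B) (A := A) e => fun (y, t) => Prod.ext (up_srcMap e y) (Prod.ext (by
      change (0 : Amb K V (Vtx.top _))
        = oneMap K V (topEdge e.dir) (srcMap K V (topEdge e.dir) 0)
      rw [srcMap_zero, oneMap_zero]) rfl)
  | _, _, _, .new e => fun (y, w, t) => Prod.ext (up_srcMap e y) (Prod.ext (up_srcMap e w) rfl)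

theorem up_tgtMap : ∀ {n : ℕ} {B A : Vtx n} (e : Edge B A) (K V : Type u) [CommRing K]
    [AddCommGroup V] [Module K V] (y : Amb K V A),
    up B (tgtMap e K V y)
      = oneMap K V (topEdge e.dir) (tgtMap (topEdge e.dir) K V (up A y))
  | _, _, _, .last A => fun K V _ _ _ (y, w, t) => Prod.ext (by
      change up A (y + t • w) = up A y + t • up A w
      rw [up_add, up_smul]) rfl
  | _, _, _, .old (B := B) (A := A) e => fun K V _ _ _ (y, t) =>
    Prod.ext (up_tgtMap e K V y) (Prod.ext (by
      change (0 : Amb K V (Vtx.top _)) = oneMap K V (topEdge e.dir)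
        (Amb.im t _ (tgtMap (topEdge e.dir) (QuadraticAlgebra K 0 t) (Tw t V)
          (Amb.join t _ (up A y) 0)))
      rw [tgtMap_join_zero, oneMap_zero]) rfl)
  | _, _, _, .new (B := B) (A := A) e => fun K V _ _ _ (y, w, t) =>
    Prod.ext (up_tgtMap e K V y) (Prod.ext (by
      change up B (Amb.im t B (tgtMap e (QuadraticAlgebra K 0 t) (Tw t V)
          (Amb.join t A y w))) = oneMap K V (topEdge e.dir)
        (Amb.im t _ (tgtMap (topEdge e.dir) (QuadraticAlgebra K 0 t) (Tw t V)
          (Amb.join t _ (up A y) (up A w))))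
      rw [up_im, up_tgtMap e, up_join, oneMap_im]) rfl)

theorem Amb.join_zero_eq_map (t : K) : ∀ {n : ℕ} (A : Vtx n) (y : Amb K V A),
    Amb.join t A y 0 = Amb.map (algebraMap K (QuadraticAlgebra K 0 t))
      (fun v => ((v, 0) : V × V)) A y
  | _, .empty => fun _ => rfl
  | _, .old A => fun (y, _) => Prod.ext (join_zero_eq_map t A y) rfl
  | _, .new A => fun (y, w, _) =>
    Prod.ext (join_zero_eq_map t A y) (Prod.ext (join_zero_eq_map t A w) rfl)

/-- For `w = 0` the point `y + εw` comes from `K`, and inversion commutes with the inclusion of `K`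
into the extended ring. -/
theorem invMap_join_zero {n : ℕ} {B A : Vtx n} (e : Edge B A) (y : Amb K V A) (t : K) :
    Amb.im t A (invMap e (QuadraticAlgebra K 0 t) (Tw t V) (Amb.join t A y 0)) = 0 := by
  have := invMap_map e K V (QuadraticAlgebra K 0 t) (Tw t V) (algebraMap K (QuadraticAlgebra K 0 t))
    (AddMonoidHom.inl V V) (fun r v => Prod.ext rfl (by
      change (0 : V) = r • 0 + (0 : K) • v + (t * 0) • (0 : V)
      simp)) y
  rw [Amb.join_zero_eq_map]
  refine (congrArg (Amb.im t A) this).trans ?_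
  change Amb.im t A (Amb.map (algebraMap K (QuadraticAlgebra K 0 t))
      (fun v => ((v, 0) : V × V)) A (invMap e K V y)) = 0
  rw [← Amb.join_zero_eq_map, Amb.im_join]

theorem up_invMap : ∀ {n : ℕ} {B A : Vtx n} (e : Edge B A) (K V : Type u) [CommRing K]
    [AddCommGroup V] [Module K V] (y : Amb K V A),
    up A (invMap e K V y) = invMap (topEdge e.dir) K V (up A y)
  | _, _, _, .last A => fun K V _ _ _ (y, w, t) => Prod.ext (by
      change up A (y + t • w) = up A y + t • up A w
      rw [up_add, up_smul]) (Prod.ext (by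
      change up A (-w) = - up A w
      rw [← neg_one_smul K, up_smul, neg_one_smul]) rfl)
  | _, _, _, .old (B := B) (A := A) e => fun K V _ _ _ (y, t) =>
    Prod.ext (up_invMap e K V y) (Prod.ext (by
      change (0 : Amb K V (Vtx.top _)) =
        (Amb.im t _ (invMap (topEdge e.dir) (QuadraticAlgebra K 0 t) (Tw t V)
          (Amb.join t _ (up A y) 0)))
      rw [invMap_join_zero]) rfl)
  | _, _, _, .new (B := B) (A := A) e => fun K V _ _ _ (y, w, t) =>
    Prod.ext (up_invMap e K V y) (Prod.ext (by
      change up A (Amb.im t A (invMap e (QuadraticAlgebra K 0 t) (Tw t V)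
          (Amb.join t A y w))) =
        (Amb.im t _ (invMap (topEdge e.dir) (QuadraticAlgebra K 0 t) (Tw t V)
          (Amb.join t _ (up A y) (up A w))))
      rw [up_im, up_invMap e, up_join]) rfl)

theorem up_compMap : ∀ {n : ℕ} {B A : Vtx n} (e : Edge B A) (a b : Amb K V A),
    up A (compMap K V e a b) = compMap K V (topEdge e.dir) (up A a) (up A b)
  | _, _, _, .last A => fun (x, w', s) (y, w, t) => Prod.ext rfl (Prod.ext (up_add A w' w) rfl)
  | _, _, _, .old (B := B) (A := A) e => fun (x, s) (y, t) =>
    Prod.ext (up_compMap e x y) (Prod.ext (compMap_zero (topEdge e.dir)).symm rfl)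
  | _, _, _, .new (B := B) (A := A) e => fun (x, w', s) (y, w, t) =>
    Prod.ext (up_compMap e x y) (Prod.ext (up_compMap e w' w) rfl)

theorem vtx_up : ∀ {n : ℕ} (A : Vtx n) (y : Amb K V A) (ε : Dir n → Bool),
    vtx (Vtx.top n) (up A y) ε = vtx A y ε
  | _, .empty => fun _ _ => rfl
  | _, .old A => fun (y, t) ε => Prod.ext (by
      change vtx (Vtx.top _) (if ε .last then up A y + t • (0 : Amb K V (Vtx.top _)) else up A y) _
        = vtx A y _
      rw [smul_zero, add_zero, ite_self, vtx_up A]) rfl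
  | _, .new A => fun (y, w, t) ε => Prod.ext (by
      change vtx (Vtx.top _) (if ε .last then up A y + t • up A w else up A y) _
        = vtx A (if ε .last then y + t • w else y) _
      rw [← up_smul, ← up_add, ← apply_ite (up A), vtx_up A]) rfl

theorem up_mem_ext {U : Set V} {n : ℕ} (A : Vtx n) (y : Amb K V A) :
    up A y ∈ ext K U (Vtx.top n) ↔ y ∈ ext K U A := by
  rw [mem_ext_iff, mem_ext_iff]
  simp only [vtx_up]

theorem continuous_down [TopologicalSpace K] [TopologicalSpace V] : ∀ {n : ℕ} (A : Vtx n),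
    Continuous (down A : Amb K V (Vtx.top n) → Amb K V A)
  | _, .empty => continuous_id
  | _, .old A => by
    have := continuous_down A
    change Continuous fun p : Amb K V (Vtx.top _) × Amb K V (Vtx.top _) × K => (down A p.1, p.2.2)
    fun_prop
  | _, .new A => by
    have := continuous_down A
    change Continuous fun p : Amb K V (Vtx.top _) × Amb K V (Vtx.top _) × K =>
      (down A p.1, down A p.2.1, p.2.2)
    fun_prop

end top

/-! ### Calculus of maps of class `C^n` -/

section isC

variable {K : Type u} [CommRing K] [TopologicalSpace K]
  {V V' W W' : Type u} [AddCommGroup V] [Module K V] [TopologicalSpace V]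
  [AddCommGroup V'] [Module K V'] [TopologicalSpace V']
  [AddCommGroup W] [Module K W] [TopologicalSpace W]
  [AddCommGroup W'] [Module K W'] [TopologicalSpace W']

/-- The scalar `1` is a unit, so `f y = f x + f^[1] (x, y - x, 1)`. -/
theorem IsC.continuousOn [IsTopologicalAddGroup V] [IsTopologicalAddGroup W] {n : ℕ} {U : Set V}
    {f : V → W} (h : IsC K n U f) : ContinuousOn f U := by
  cases n with
  | zero => exact h
  | succ n =>
    obtain ⟨g, hg, hgf, -⟩ := h
    intro x hx
    have h1 : ContinuousOn (fun y => g (x, y - x, 1)) U := by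
      refine hg.comp (by fun_prop) fun y hy => ⟨hx, ?_⟩
      simpa using hy
    have h2 : EqOn f (fun y => f x + g (x, y - x, 1)) U := fun y hy => by
      have := hgf x (y - x) 1 ⟨hx, by simpa using hy⟩
      simp only [Units.val_one, inv_one, one_smul, add_sub_cancel] at this
      simp [this]
    exact ((continuousOn_const.add h1).congr h2) x hx

theorem IsC.of_succ [IsTopologicalRing K] [IsTopologicalAddGroup V] [IsTopologicalAddGroup W]
    {n : ℕ} {U : Set V} {f : V → W} (h : IsC K (n + 1) U f) : IsC K n U f := by
  induction n generalizing V with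
  | zero => exact h.continuousOn
  | succ n ih =>
    obtain ⟨g, hg, hgf, hg'⟩ := h
    exact ⟨g, hg, hgf, ih hg'⟩

theorem IsC.clm_comp (L : W →L[K] W') {n : ℕ} {U : Set V} {f : V → W} (h : IsC K n U f) :
    IsC K n U fun x => L (f x) := by
  induction n generalizing V with
  | zero => exact L.continuous.comp_continuousOn h
  | succ n ih =>
    obtain ⟨g, hg, hgf, hg'⟩ := h
    refine ⟨fun p => L (g p), L.continuous.comp_continuousOn hg, fun x v t hx => ?_, ih hg'⟩
    simp only [hgf x v t hx, map_smul, map_sub]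

theorem IsC.comp_clm {n : ℕ} {U : Set V} {U' : Set V'} {f : V → W} (h : IsC K n U f)
    (L : V' →L[K] V) (hL : MapsTo L U' U) : IsC K n U' fun x => f (L x) := by
  induction n generalizing V V' with
  | zero => exact ContinuousOn.comp h L.continuous.continuousOn hL
  | succ n ih =>
    obtain ⟨g, hg, hgf, hg'⟩ := h
    let L' : (V' × V' × K) →L[K] (V × V × K) := L.prodMap (L.prodMap (.id K K))
    have hL' : MapsTo L' (extDom K U') (extDom K U) := fun p hp =>
      ⟨hL hp.1, by simpa [L'] using hL hp.2⟩
    refine ⟨fun p => g (L' p), ContinuousOn.comp hg L'.continuous.continuousOn hL',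
      fun x v t hx => ?_, ih hg' L' hL'⟩
    refine (hgf _ _ _ (hL' hx)).trans ?_
    simp

theorem IsC.prodMk {n : ℕ} {U : Set V} {f : V → W} {f' : V → W'} (h : IsC K n U f)
    (h' : IsC K n U f') : IsC K n U fun x => (f x, f' x) := by
  induction n generalizing V with
  | zero => exact ContinuousOn.prodMk h h'
  | succ n ih =>
    obtain ⟨g, hg, hgf, hgn⟩ := h
    obtain ⟨g', hg', hgf', hgn'⟩ := h'
    exact ⟨fun p => (g p, g' p), hg.prodMk hg',
      fun x v t hx => Prod.ext (hgf x v t hx) (hgf' x v t hx), ih hgn hgn'⟩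

theorem isC_clm {n : ℕ} (U : Set V) (L : V →L[K] W) : IsC K n U L := by
  induction n generalizing V with
  | zero => exact L.continuous.continuousOn
  | succ n ih =>
    let L' : (V × V × K) →L[K] W := L.comp ((ContinuousLinearMap.fst K V K).comp
      (ContinuousLinearMap.snd K V (V × K)))
    refine ⟨L', L'.continuous.continuousOn, fun x v t _ => ?_, ih _ L'⟩
    change L v = _
    rw [map_add, add_sub_cancel_left, map_smul, smul_smul, Units.inv_mul, one_smul]

end isC

/-! ### Prolongation of maps of class `C^n` -/

section prolong

open Function

/-- Replace the scalar components of an element. -/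
def merge {K V : Type u} : {n : ℕ} → (A : Vtx n) → Amb K PUnit.{u + 1} A → Amb K V A → Amb K V A
  | _, .empty => fun _ y => y
  | _, .old A => fun (s, t) (y, _) => (merge A s y, t)
  | _, .new A => fun (s, r, t) (y, w, _) => (merge A s y, merge A r w, t)

variable {K V W : Type u} [CommRing K] [AddCommGroup V] [Module K V] [AddCommGroup W] [Module K W]

theorem scal_merge : ∀ {n : ℕ} (A : Vtx n) (s : Amb K PUnit.{u + 1} A) (y : Amb K V A),
    scal A (merge A s y) = s
  | _, .empty => fun _ _ => rfl
  | _, .old A => fun (s, _) (y, _) => Prod.ext (scal_merge A s y) rfl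
  | _, .new A => fun (s, r, _) (y, w, _) =>
    Prod.ext (scal_merge A s y) (Prod.ext (scal_merge A r w) rfl)

theorem merge_scal : ∀ {n : ℕ} (A : Vtx n) (y : Amb K V A), merge A (scal A y) y = y
  | _, .empty => fun _ => rfl
  | _, .old A => fun (y, _) => Prod.ext (merge_scal A y) rfl
  | _, .new A => fun (y, w, _) => Prod.ext (merge_scal A y) (Prod.ext (merge_scal A w) rfl)

theorem merge_add : ∀ {n : ℕ} (A : Vtx n) (s s' : Amb K PUnit.{u + 1} A) (y y' : Amb K V A),
    merge A (s + s') (y + y') = merge A s y + merge A s' y'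
  | _, .empty => fun _ _ _ _ => rfl
  | _, .old A => fun (s, _) (s', _) (y, _) (y', _) => Prod.ext (merge_add A s s' y y') rfl
  | _, .new A => fun (s, r, _) (s', r', _) (y, w, _) (y', w', _) =>
    Prod.ext (merge_add A s s' y y') (Prod.ext (merge_add A r r' w w') rfl)

theorem merge_smul : ∀ {n : ℕ} (A : Vtx n) (c : K) (s : Amb K PUnit.{u + 1} A) (y : Amb K V A),
    merge A (c • s) (c • y) = c • merge A s y
  | _, .empty => fun _ _ _ => rfl
  | _, .old A => fun c (s, _) (y, _) => Prod.ext (merge_smul A c s y) rfl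
  | _, .new A => fun c (s, r, _) (y, w, _) =>
    Prod.ext (merge_smul A c s y) (Prod.ext (merge_smul A c r w) rfl)

variable [TopologicalSpace K] [TopologicalSpace V] [TopologicalSpace W]

theorem continuous_merge : ∀ {n : ℕ} (A : Vtx n),
    Continuous fun p : Amb K PUnit.{u + 1} A × Amb K V A => merge A p.1 p.2
  | _, .empty => continuous_snd (X := PUnit.{u + 1}) (Y := V)
  | _, .old A => ((continuous_merge A).comp
      (f := fun p : (Amb K PUnit.{u + 1} A × K) × (Amb K V A × K) => (p.1.1, p.2.1))
      (by fun_prop)).prodMk (by fun_prop)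
  | _, .new A => ((continuous_merge A).comp
      (f := fun p : (Amb K PUnit.{u + 1} A × Amb K PUnit.{u + 1} A × K) ×
        (Amb K V A × Amb K V A × K) => (p.1.1, p.2.1))
      (by fun_prop)).prodMk (((continuous_merge A).comp
      (f := fun p : (Amb K PUnit.{u + 1} A × Amb K PUnit.{u + 1} A × K) ×
        (Amb K V A × Amb K V A × K) => (p.1.2.1, p.2.2.1))
      (by fun_prop)).prodMk (by fun_prop))

theorem continuous_scal : ∀ {n : ℕ} (A : Vtx n), Continuous (scal (K := K) (V := V) A)
  | _, .empty => continuous_const (X := V) (y := PUnit.unit)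
  | _, .old A => ((continuous_scal A).comp
      (f := fun p : Amb K V A × K => p.1) (by fun_prop)).prodMk continuous_snd
  | _, .new A => ((continuous_scal A).comp
      (f := fun p : Amb K V A × Amb K V A × K => p.1) (by fun_prop)).prodMk
      (((continuous_scal A).comp
      (f := fun p : Amb K V A × Amb K V A × K => p.2.1) (by fun_prop)).prodMk
      (continuous_snd.comp continuous_snd))

/-- `merge` as a linear map. -/
def mergeL {n : ℕ} (A : Vtx n) : (Amb K PUnit.{u + 1} A × Amb K W A) →L[K] Amb K W A where
  toFun p := merge A p.1 p.2
  map_add' _ _ := merge_add _ _ _ _ _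
  map_smul' _ _ := merge_smul _ _ _ _
  cont := continuous_merge A

/-- `scal` as a linear map. -/
def scalL {n : ℕ} (A : Vtx n) : Amb K V A →L[K] Amb K PUnit.{u + 1} A where
  toFun := scal A
  map_add' := scal_add A
  map_smul' := scal_smul A
  cont := continuous_scal A

theorem scal_sub {n : ℕ} (A : Vtx n) (y z : Amb K V A) : scal A (y - z) = scal A y - scal A z :=
  map_sub (scalL A) y z

variable [IsTopologicalRing K] [IsTopologicalAddGroup V] [ContinuousSMul K V]
  [IsTopologicalAddGroup W] [ContinuousSMul K W]

theorem finExt_subset_ext {U : Set V} {n : ℕ} (A : Vtx n) : finExt K U A ⊆ ext K U A :=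
  fun y hy => ((mem_finExt_iff_and A y).mp hy).1

/-- The prolongation of a map of class `C^(m+n)` to the vertex sets of the `n`-fold groupoid. -/
theorem exists_prolongation {U : Set V} {f : V → W} : ∀ {n : ℕ} (A : Vtx n) (m : ℕ),
    IsC K (m + n) U f → ∃ F : Amb K V A → Amb K W A, IsC K m (ext K U A) F ∧
      (∀ y, scal A (F y) = scal A y) ∧ ∀ y ∈ finExt K U A, F y = finMap K f A y
  | _, .empty => fun m h => ⟨f, h, fun _ => rfl, fun _ _ => rfl⟩
  | n + 1, .old A => fun m h => by
    obtain ⟨F, hF, hs, hfin⟩ := exists_prolongation A (m + 1) (by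
      rwa [add_right_comm, add_assoc])
    refine ⟨fun (y, t) => (F y, t), ?_, fun (y, t) => Prod.ext (hs y) rfl,
      fun (y, t) hy => Prod.ext (hfin y hy.1) rfl⟩
    have h1 : IsC K m {p : Amb K V A × K | p.1 ∈ ext K U A} fun p => F p.1 :=
      hF.of_succ.comp_clm (ContinuousLinearMap.fst K (Amb K V A) K) fun p hp => hp
    have h2 : IsC K m {p : Amb K V A × K | p.1 ∈ ext K U A} fun p => p.2 :=
      isC_clm _ (ContinuousLinearMap.snd K (Amb K V A) K)
    exact h1.prodMk h2
  | n + 1, .new A => fun m h => by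
    -- One order of differentiability is kept in reserve for the last direction, where `F` is
    -- replaced by its difference quotient.
    obtain ⟨F, hF, hs, hfin⟩ := exists_prolongation A (m + 1) (by
      rwa [add_right_comm, add_assoc])
    obtain ⟨g, hg, hgf, hgm⟩ := id hF
    -- The scalar part of `g` is overwritten by that of `w`. At invertible `t` nothing changes, but
    -- elsewhere a continuous extension to a non-Hausdorff `K` need not preserve scalars.
    refine ⟨fun (y, w, t) => (F y, merge A (scal A w) (g (y, w, t)), t), ?_,
      fun (y, w, t) => Prod.ext (hs y) (Prod.ext (scal_merge A _ _) rfl),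
      fun (y, w, t) hy => Prod.ext (hfin y hy.1.1) (Prod.ext ?_ rfl)⟩
    · have h1 : IsC K m (extDom K (ext K U A)) fun p => F p.1 :=
        hF.of_succ.comp_clm (ContinuousLinearMap.fst K (Amb K V A) (Amb K V A × K))
          fun p hp => hp.1
      have h2 : IsC K m (extDom K (ext K U A)) fun p => scal A p.2.1 :=
        isC_clm _ ((scalL A).comp ((ContinuousLinearMap.fst K (Amb K V A) K).comp
          (ContinuousLinearMap.snd K (Amb K V A) (Amb K V A × K))))
      have h3 : IsC K m (extDom K (ext K U A)) fun p => p.2.2 :=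
        isC_clm _ ((ContinuousLinearMap.snd K (Amb K V A) K).comp
          (ContinuousLinearMap.snd K (Amb K V A) (Amb K V A × K)))
      have h4 : IsC K m (extDom K (ext K U A)) fun p => merge A (scal A p.2.1) (g p) :=
        (h2.prodMk hgm).clm_comp (mergeL A)
      exact h1.prodMk (h4.prodMk h3)
    · obtain ⟨t, rfl⟩ := hy.2
      have hg1 := hgf y w t ⟨finExt_subset_ext A hy.1.1, finExt_subset_ext A hy.1.2⟩
      have hg2 : scal A (g (y, w, (t : K))) = scal A w := by
        rw [hg1, scal_smul, scal_sub, hs, hs, scal_add, add_sub_cancel_left, scal_smul, smul_smul,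
          Units.inv_mul, one_smul]
      change merge A (scal A w) (g (y, w, (t : K))) = Ring.inverse (t : K) •
        (finMap K f A (y + (t : K) • w) - finMap K f A y)
      rw [← hg2, merge_scal, hg1, Ring.inverse_unit, hfin _ hy.1.1, hfin _ hy.1.2]

end prolong

/-! ### Continuous morphisms given by maps of class `C^n` -/

section ground

variable {K V M N : Type u}

theorem groundPt_map (f : V → M) : ∀ (n : ℕ) (p : Amb K V (Vtx.bot n)),
    groundPt K M n (Amb.map id f (Vtx.bot n) p) = f (groundPt K V n p)
  | 0 => fun _ => rfl
  | n + 1 => fun (p, t) => groundPt_map f n p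

theorem groundScal_map (f : V → M) : ∀ (n : ℕ) (p : Amb K V (Vtx.bot n)),
    groundScal K M n (Amb.map id f (Vtx.bot n) p) = groundScal K V n p
  | 0 => fun _ => rfl
  | n + 1 => fun (p, t) => by
    change Fin.snoc (α := fun _ => K) (groundScal K M n (Amb.map id f (Vtx.bot n) p)) t
      = Fin.snoc (α := fun _ => K) (groundScal K V n p) t
    rw [groundScal_map f n p]

theorem ground_ext : ∀ (n : ℕ) (p q : Amb K V (Vtx.bot n)), groundPt K V n p = groundPt K V n q →
    groundScal K V n p = groundScal K V n q → p = q
  | 0 => fun _ _ h _ => h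
  | n + 1 => fun (p, t) (q, s) h h' => by
    obtain ⟨h1, h2⟩ := Fin.snoc_inj.mp h'
    exact Prod.ext (ground_ext n p q h h1) h2

theorem exists_ground : ∀ (n : ℕ) (x : V) (r : Fin n → K),
    ∃ p : Amb K V (Vtx.bot n), groundPt K V n p = x ∧ groundScal K V n p = r
  | 0 => fun x r => ⟨x, rfl, Subsingleton.elim _ _⟩
  | n + 1 => fun x r => by
    obtain ⟨p, hp, hr⟩ := exists_ground n x (Fin.init r)
    refine ⟨(p, r (Fin.last n)), hp, ?_⟩
    change Fin.snoc (α := fun _ => K) (groundScal K V n p) (r (Fin.last n)) = r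
    rw [hr, Fin.snoc_init_self]

theorem mem_ext_bot [CommRing K] [AddCommGroup V] [Module K V] {U : Set V} :
    ∀ (n : ℕ) (p : Amb K V (Vtx.bot n)), p ∈ ext K U (Vtx.bot n) ↔ groundPt K V n p ∈ U
  | 0 => fun _ => Iff.rfl
  | n + 1 => fun (p, t) => mem_ext_bot n p

theorem mem_finExt_bot [CommRing K] [AddCommGroup V] [Module K V] {U : Set V} :
    ∀ (n : ℕ) (p : Amb K V (Vtx.bot n)), p ∈ finExt K U (Vtx.bot n) ↔
      groundPt K V n p ∈ U ∧ ∀ i, IsUnit (groundScal K V n p i)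
  | 0 => fun _ => ⟨fun h => ⟨h, fun i => i.elim0⟩, fun h => h.1⟩
  | n + 1 => fun (p, t) => by
    change _ ∧ _ ↔ _ ∧ ∀ i, IsUnit (Fin.snoc (α := fun _ => K) (groundScal K V n p) t i)
    rw [mem_finExt_bot n p, and_assoc]
    refine and_congr_right' ⟨fun h i => ?_, fun h => ⟨fun i => ?_, ?_⟩⟩
    · refine Fin.lastCases ?_ (fun i => ?_) i
      · simpa using h.2
      · simpa using h.1 i
    · simpa using h i.castSucc
    · simpa using h (Fin.last n)

theorem continuousOn_groundMap [CommRing K] [AddCommGroup V] [Module K V] [TopologicalSpace K]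
    [TopologicalSpace V] [TopologicalSpace M] {f : V → M} {U : Set V} (hf : ContinuousOn f U) :
    ∀ n : ℕ, ContinuousOn (Amb.map (K := K) id f (Vtx.bot n)) (ext K U (Vtx.bot n))
  | 0 => hf
  | n + 1 => by
    have h1 := (continuousOn_groundMap hf n).comp (t := ext K U (Vtx.bot n))
      (s := {p : Amb K V (Vtx.bot n) × K | p.1 ∈ ext K U (Vtx.bot n)})
      (f := Prod.fst) continuous_fst.continuousOn (fun p hp => hp)
    exact h1.prodMk continuous_snd.continuousOn

end ground

/-! ### Functoriality of finite prolongations and its passage to the limit -/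

section morphism

open Function

variable {K V W : Type u} [CommRing K] [AddCommGroup V] [Module K V] [AddCommGroup W] [Module K W]

/-- Multiplying the difference quotient by the unit `t` restores the image of the second endpoint.
So `f^n_fin` applies `f` to every vertex, and compatibility with the structure maps follows by
comparing vertices. -/
theorem vtx_finMap (f : V → W) : ∀ {n : ℕ} (A : Vtx n) (y : Amb K V A), y ∈ finExt K univ A →
    ∀ ε, vtx A (finMap K f A y) ε = Amb.map id f (Vtx.bot n) (vtx A y ε)
  | _, .empty => fun _ _ _ => rfl
  | _, .old A => fun (y, t) hy ε => Prod.ext (vtx_finMap f A y hy.1 _) rfl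
  | n + 1, .new A => fun (y, w, t) hy ε => Prod.ext (by
      change vtx A (if ε .last then finMap K f A y + t • (Ring.inverse t •
        (finMap K f A (y + t • w) - finMap K f A y)) else finMap K f A y) _
        = Amb.map id f (Vtx.bot n) (vtx A (if ε .last then y + t • w else y) _)
      rw [smul_smul, Ring.mul_inverse_cancel t hy.2, one_smul, add_sub_cancel]
      split_ifs
      · exact vtx_finMap f A _ hy.1.2 _
      · exact vtx_finMap f A _ hy.1.1 _) rfl

theorem scal_groundMap (f : V → W) : ∀ (n : ℕ) (p : Amb K V (Vtx.bot n)),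
    scal (Vtx.bot n) (Amb.map id f (Vtx.bot n) p) = scal (Vtx.bot n) p
  | 0 => fun _ => rfl
  | n + 1 => fun (p, t) => Prod.ext (scal_groundMap f n p) rfl

theorem scal_vtx : ∀ {n : ℕ} (A : Vtx n) (y : Amb K V A) (ε : Dir n → Bool),
    scal (Vtx.bot n) (vtx A y ε) = vtx A (scal A y) ε
  | _, .empty => fun _ _ => rfl
  | _, .old A => fun (y, t) ε => Prod.ext (scal_vtx A y _) rfl
  | n + 1, .new A => fun (y, w, t) ε => Prod.ext (by
      change scal _ (vtx A (if ε .last then y + t • w else y) _)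
        = vtx A (if ε .last then scal A y + t • scal A w else scal A y) _
      rw [scal_vtx, ← scal_smul, ← scal_add, ← apply_ite (scal A)]) rfl

theorem groundMap_mem_finExt (f : V → W) {U' : Set W} {n : ℕ} {p : Amb K V (Vtx.bot n)}
    (hp : p ∈ finExt K univ (Vtx.bot n)) (hf : f (groundPt K V n p) ∈ U') :
    Amb.map id f (Vtx.bot n) p ∈ finExt K U' (Vtx.bot n) := by
  rw [mem_finExt_bot] at hp ⊢
  rw [groundPt_map, groundScal_map]
  exact ⟨hf, hp.2⟩

theorem finMap_mem_finExt (f : V → W) {n : ℕ} {A : Vtx n} {y : Amb K V A}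
    (hy : y ∈ finExt K univ A) : finMap K f A y ∈ finExt K univ A := by
  rw [mem_finExt_iff]
  intro ε
  rw [vtx_finMap f A y hy]
  exact groundMap_mem_finExt f ((mem_finExt_iff A y).mp hy ε) (mem_univ _)

variable {U : Set V} {n : ℕ} {B A : Vtx n} (e : Edge B A)

theorem srcMap_mem_finExt {y : Amb K V A} (hy : y ∈ finExt K U A) :
    srcMap K V e y ∈ finExt K U B := by
  rw [mem_finExt_iff] at hy ⊢
  intro ε
  rw [vtx_srcMap]
  exact hy _

theorem tgtMap_mem_finExt {y : Amb K V A} (hy : y ∈ finExt K U A) :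
    tgtMap e K V y ∈ finExt K U B := by
  rw [mem_finExt_iff] at hy ⊢
  intro ε
  rw [vtx_tgtMap]
  exact hy _

theorem oneMap_mem_finExt {y : Amb K V B} (hy : y ∈ finExt K U B) :
    oneMap K V e y ∈ finExt K U A := by
  rw [mem_finExt_iff] at hy ⊢
  intro ε
  rw [vtx_oneMap]
  exact hy _

theorem invMap_mem_finExt {y : Amb K V A} (hy : y ∈ finExt K U A) :
    invMap e K V y ∈ finExt K U A := by
  rw [mem_finExt_iff] at hy ⊢
  intro ε
  rw [vtx_invMap]
  exact hy _

theorem compMap_mem_finExt {a b : Amb K V A} (ha : a ∈ finExt K U A) (hb : b ∈ finExt K U A)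
    (h : srcMap K V e a = tgtMap e K V b) : compMap K V e a b ∈ finExt K U A := by
  rw [mem_finExt_iff] at ha hb ⊢
  intro ε
  cases hε : ε e.dir
  · rw [(vtx_compMap e a b h ε).2 hε]; exact hb _
  · rw [(vtx_compMap e a b h ε).1 hε]; exact ha _

theorem finMap_srcMap (f : V → W) {y : Amb K V A} (hy : y ∈ finExt K univ A) :
    finMap K f B (srcMap K V e y) = srcMap K W e (finMap K f A y) := by
  refine vtx_injective B _ _ (finMap_mem_finExt f (srcMap_mem_finExt e hy)) fun ε => ?_
  rw [vtx_finMap f _ _ (srcMap_mem_finExt e hy), vtx_srcMap, vtx_srcMap, vtx_finMap f _ _ hy]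

theorem finMap_tgtMap (f : V → W) {y : Amb K V A} (hy : y ∈ finExt K univ A) :
    finMap K f B (tgtMap e K V y) = tgtMap e K W (finMap K f A y) := by
  refine vtx_injective B _ _ (finMap_mem_finExt f (tgtMap_mem_finExt e hy)) fun ε => ?_
  rw [vtx_finMap f _ _ (tgtMap_mem_finExt e hy), vtx_tgtMap, vtx_tgtMap, vtx_finMap f _ _ hy]

theorem finMap_oneMap (f : V → W) {y : Amb K V B} (hy : y ∈ finExt K univ B) :
    finMap K f A (oneMap K V e y) = oneMap K W e (finMap K f B y) := by
  refine vtx_injective A _ _ (finMap_mem_finExt f (oneMap_mem_finExt e hy)) fun ε => ?_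
  rw [vtx_finMap f _ _ (oneMap_mem_finExt e hy), vtx_oneMap, vtx_oneMap, vtx_finMap f _ _ hy]

theorem finMap_compMap (f : V → W) {a b : Amb K V A} (ha : a ∈ finExt K univ A)
    (hb : b ∈ finExt K univ A) (h : srcMap K V e a = tgtMap e K V b) :
    finMap K f A (compMap K V e a b) = compMap K W e (finMap K f A a) (finMap K f A b) := by
  have h' : srcMap K W e (finMap K f A a) = tgtMap e K W (finMap K f A b) := by
    rw [← finMap_srcMap e f ha, ← finMap_tgtMap e f hb, h]
  have hc := compMap_mem_finExt e ha hb h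
  refine vtx_injective A _ _ (finMap_mem_finExt f hc) fun ε => ?_
  rw [vtx_finMap f _ _ hc]
  cases hε : ε e.dir
  · rw [(vtx_compMap e a b h ε).2 hε, (vtx_compMap e _ _ h' ε).2 hε, vtx_finMap f _ _ hb]
  · rw [(vtx_compMap e a b h ε).1 hε, (vtx_compMap e _ _ h' ε).1 hε, vtx_finMap f _ _ ha]

theorem finExt_mono {U U' : Set V} (h : U ⊆ U') {n : ℕ} (A : Vtx n) :
    finExt K U A ⊆ finExt K U' A := fun y hy => by
  rw [mem_finExt_iff_and] at hy ⊢
  exact ⟨ext_mono h A hy.1, hy.2⟩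

theorem groundPt_mem_of_mem_ext {U : Set V} {n : ℕ} {A : Vtx n} {y : Amb K V A}
    (hy : y ∈ ext K U A) (ε : Dir n → Bool) : groundPt K V n (vtx A y ε) ∈ U :=
  (mem_ext_bot n _).mp ((mem_ext_iff A y).mp hy ε)

section topology

variable [TopologicalSpace K] [TopologicalSpace V] [TopologicalSpace W]
  [IsTopologicalRing K] [IsTopologicalAddGroup V] [ContinuousSMul K V]
  [IsTopologicalAddGroup W] [ContinuousSMul K W]

/-- Continuous maps with values in an ambient module that coincide on a dense subset and have the
same scalar components are equal. -/
theorem eqOn_of_dense [T0Space W] {X : Type*} [TopologicalSpace X] {n : ℕ} (B : Vtx n)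
    {S T : Set X} (hT : T ⊆ S) (hST : S ⊆ closure T) {g h : X → Amb K W B}
    (hg : ContinuousOn g S) (hh : ContinuousOn h S) (hs : ∀ x ∈ S, scal B (g x) = scal B (h x))
    (heq : EqOn g h T) : EqOn g h S := fun x hx => by
  have : (𝓝[T] x).NeBot := mem_closure_iff_nhdsWithin_neBot.mp (hST hx)
  refine eq_of_inseparable B _ _ ?_ (hs x hx)
  have h1 : Filter.Tendsto g (𝓝[T] x) (𝓝 (g x)) := (hg x hx).mono_left (nhdsWithin_mono x hT)
  have h2 : Filter.Tendsto h (𝓝[T] x) (𝓝 (h x)) := (hh x hx).mono_left (nhdsWithin_mono x hT)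
  exact tendsto_nhds_unique_inseparable h1
    (h2.congr' (eventually_nhdsWithin_of_forall fun y hy => (heq hy).symm))

/-- Composable pairs of finite elements are dense among all composable pairs. -/
theorem composable_subset_closure (hK : Dense {t : K | IsUnit t}) (hU : IsOpen U) :
    {p : Amb K V A × Amb K V A | p.1 ∈ ext K U A ∧ p.2 ∈ ext K U A ∧
      srcMap K V e p.1 = tgtMap e K V p.2} ⊆
    closure {p : Amb K V A × Amb K V A | p.1 ∈ finExt K U A ∧ p.2 ∈ finExt K U A ∧
      srcMap K V e p.1 = tgtMap e K V p.2} := by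
  rintro ⟨a, b⟩ ⟨ha, hb, hab⟩
  have hopen : IsOpen (ext K U A ×ˢ ext K U A) := (isOpen_ext hU A).prod (isOpen_ext hU A)
  suffices h : (a, b) ∈ closure {p : Amb K V A × Amb K V A | p.1 ∈ finExt K univ A ∧
      p.2 ∈ finExt K univ A ∧ srcMap K V e p.1 = tgtMap e K V p.2} by
    refine closure_mono ?_ (hopen.inter_closure ⟨⟨ha, hb⟩, h⟩)
    rintro ⟨x, y⟩ ⟨⟨hx, hy⟩, hx', hy', hxy⟩
    exact ⟨(mem_finExt_iff_and A x).mpr ⟨hx, hx'⟩, (mem_finExt_iff_and A y).mpr ⟨hy, hy'⟩, hxy⟩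
  -- When `b` moves to a finite `b'`, `a` is translated by a difference of units, so that its source
  -- follows the target of `b'`.
  let c : Amb K V A → Amb K V A := fun b' =>
    a - oneMap K V e (srcMap K V e a) + oneMap K V e (tgtMap e K V b')
  have hc : Continuous c :=
    continuous_const.add ((continuous_oneMap e).comp (continuous_tgtMap e))
  have hcb : c b = a := by simp only [c, ← hab, sub_add_cancel]
  have hsc : ∀ b', srcMap K V e (c b') = tgtMap e K V b' := fun b' => by
    have h1 : a - oneMap K V e (srcMap K V e a) + oneMap K V e (srcMap K V e a) = a :=
      sub_add_cancel _ _
    have h2 := congrArg (srcMap K V e) h1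
    rw [srcMap_add, srcMap_oneMap, add_eq_right] at h2
    simp only [c]
    rw [srcMap_add, h2, srcMap_oneMap, zero_add]
  have hcl := (hc.prodMk continuous_id).continuousOn.image_closure
    (s := finExt K univ A) ⟨b, dense_finExt hK A b, rfl⟩
  simp only [hcb, id] at hcl
  refine closure_minimal ?_ isClosed_closure hcl
  rintro _ ⟨b', hb', rfl⟩
  -- These are the source vertices. They are finite, as target vertices of `b'`, so the translated
  -- `a` can be made finite without moving its source.
  let D : Set (Dir n → Bool) := {ε | ε e.dir = false}
  have hD : IsLowerSet D := isLowerSet_face e.dir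
  have hvtx : ∀ z : Amb K V A, ∀ ε ∈ D, vtx A z ε = vtx B (srcMap K V e z) ε := fun z ε hε => by
    have hε : ε e.dir = false := hε
    rw [vtx_srcMap, ← hε, update_eq_self]
  have h1 := mem_closure_finExt hK A D hD (c b') fun ε hε => by
    rw [hvtx _ ε hε, hsc]
    exact (mem_finExt_iff _ _).mp (tgtMap_mem_finExt e hb') ε
  have h2 := (continuous_id.prodMk (continuous_const (y := b'))).continuousOn.image_closure
    ⟨_, h1, rfl⟩
  refine closure_mono ?_ h2
  rintro _ ⟨a', ⟨ha', hv⟩, rfl⟩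
  refine ⟨ha', hb', ?_⟩
  refine vtx_injective B _ _ (srcMap_mem_finExt e ha') fun ε => ?_
  have h3 : update ε e.dir false ∈ D := update_self _ _ _
  change vtx B (srcMap K V e a') ε = vtx B (tgtMap e K V b') ε
  rw [← hsc b', vtx_srcMap, vtx_srcMap, vtx_eq_of_vanishOn A hD hv _ h3]

/-- The prolongation of a map of class `C^n` as a continuous morphism of `n`-fold groupoids. -/
theorem exists_continuouslyExtends (hK : Dense {t : K | IsUnit t}) [T0Space W] (hU : IsOpen U)
    {U' : Set W} {f : V → W} (hf : IsC K n U f) (hUU' : MapsTo f U U') :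
    ∃ F : CubeHom (tangentCube K n U) (tangentCube K n U'), ContinuouslyExtends F f ∧
      (∀ (A : Vtx n) (p : ext K U A) ε, vtx A (val (F.map A p)) ε
        = Amb.map id f (Vtx.bot n) (vtx A p.1 ε)) ∧
      ∀ (A : Vtx n) (p : ext K U A), scal A (val (F.map A p)) = scal A p.1 := by
  choose F hFc hFs hFfin using fun A : Vtx n => exists_prolongation A 0 (by rwa [zero_add])
  have hd := fun A : Vtx n => ext_subset_closure_finExt (V := V) hK hU A
  have hsub := fun A : Vtx n => finExt_subset_ext (K := K) (U := U) A
  have hfin := fun A : Vtx n => finExt_mono (K := K) (subset_univ U) A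
  -- The vertex formula extends from finite cells by density, and it shows that the prolongation
  -- takes values in the cells over `U'`.
  have hFvtx : ∀ (A : Vtx n) (ε), EqOn (fun y => vtx A (F A y) ε)
      (fun y => Amb.map id f (Vtx.bot n) (vtx A y ε)) (ext K U A) := fun A ε => by
    refine eqOn_of_dense _ (hsub A) (hd A) ((continuous_vtx A ε).comp_continuousOn (hFc A))
      ((continuousOn_groundMap hf.continuousOn n).comp (continuous_vtx A ε).continuousOn
        fun y hy => (mem_ext_iff A y).mp hy ε) (fun y _ => ?_) fun y hy => ?_
    · rw [scal_vtx, hFs, scal_groundMap, scal_vtx]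
    · simp only [hFfin A y hy, vtx_finMap f A y (hfin A hy)]
  have hFmem : ∀ (A : Vtx n), ∀ y ∈ ext K U A, F A y ∈ ext K U' A := fun A y hy => by
    rw [mem_ext_iff]
    intro ε
    rw [show vtx A (F A y) ε = _ from hFvtx A ε hy, mem_ext_bot, groundPt_map]
    exact hUU' (groundPt_mem_of_mem_ext hy ε)
  refine ⟨⟨fun A p => ⟨F A p.1, hFmem A p.1 p.2⟩, fun {B A} e a => Subtype.ext ?_,
    fun {B A} e a => Subtype.ext ?_, fun {B A} e a => Subtype.ext ?_,
    fun {B A} e a b h h' => Subtype.ext ?_⟩,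
    ⟨fun A => (hFc A).domRestrict, fun A p hp => hFfin A p.1 hp⟩, fun A p ε => hFvtx A ε p.2, fun A p => hFs A p.1⟩
  · refine eqOn_of_dense B (hsub A) (hd A) (g := fun a => F B (srcMap K V e a))
      (h := fun a => srcMap K W e (F A a))
      (ContinuousOn.comp (hFc B) (continuous_srcMap e).continuousOn fun y hy => srcMap_mem e y hy)
      ((continuous_srcMap e).comp_continuousOn (hFc A)) (fun y _ => ?_) (fun y hy => ?_) a.2
    · rw [hFs, scal_srcMap, scal_srcMap, hFs]
    · simp only [hFfin B _ (srcMap_mem_finExt e hy), hFfin A _ hy, finMap_srcMap e f (hfin A hy)]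
  · refine eqOn_of_dense B (hsub A) (hd A) (g := fun a => F B (tgtMap e K V a))
      (h := fun a => tgtMap e K W (F A a))
      (ContinuousOn.comp (hFc B) (continuous_tgtMap e).continuousOn fun y hy => tgtMap_mem e y hy)
      ((continuous_tgtMap e).comp_continuousOn (hFc A)) (fun y _ => ?_) (fun y hy => ?_) a.2
    · rw [hFs, scal_tgtMap, scal_tgtMap, hFs]
    · simp only [hFfin B _ (tgtMap_mem_finExt e hy), hFfin A _ hy, finMap_tgtMap e f (hfin A hy)]
  · refine eqOn_of_dense A (hsub B) (hd B) (g := fun a => F A (oneMap K V e a))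
      (h := fun a => oneMap K W e (F B a))
      (ContinuousOn.comp (hFc A) (continuous_oneMap e).continuousOn fun y hy => oneMap_mem e y hy)
      ((continuous_oneMap e).comp_continuousOn (hFc B)) (fun y _ => ?_) (fun y hy => ?_) a.2
    · rw [hFs, scal_oneMap, scal_oneMap, hFs]
    · simp only [hFfin A _ (oneMap_mem_finExt e hy), hFfin B _ hy, finMap_oneMap e f (hfin B hy)]
  -- For products, density is needed within the composable pairs, which do not form an open set of
  -- pairs.
  · refine eqOn_of_dense A (X := Amb K V A × Amb K V A)
      (S := {p : Amb K V A × Amb K V A | p.1 ∈ ext K U A ∧ p.2 ∈ ext K U A ∧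
        srcMap K V e p.1 = tgtMap e K V p.2}) (fun p hp => ⟨hsub A hp.1, hsub A hp.2.1, hp.2.2⟩)
      (composable_subset_closure e hK hU)
      (g := fun p => F A (compMap K V e p.1 p.2)) (h := fun p => compMap K W e (F A p.1) (F A p.2))
      (ContinuousOn.comp (hFc A) (continuous_compMap e).continuousOn
        fun p hp => compMap_mem e p.1 p.2 hp.1 hp.2.1 hp.2.2)
      ((continuous_compMap e).comp_continuousOn
        ((ContinuousOn.comp (hFc A) continuousOn_fst fun p hp => hp.1).prodMk
          (ContinuousOn.comp (hFc A) continuousOn_snd fun p hp => hp.2.1)))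
      (fun p _ => ?_) (fun p hp => ?_) (x := (a.1, b.1)) ⟨a.2, b.2, congrArg Subtype.val h⟩
    · rw [hFs, scal_compMap, scal_compMap, hFs, hFs]
    · simp only [hFfin A _ (compMap_mem_finExt e hp.1 hp.2.1 hp.2.2), hFfin A _ hp.1,
        hFfin A _ hp.2.1, finMap_compMap e f (hfin A hp.1) (hfin A hp.2.1) hp.2.2]

end topology

end morphism

/-! ### Maps whose finite prolongations extend continuously are of class `C^n` -/

section converse

variable {K V W : Type u}

/-- The component of highest order. -/
def topComp : {n : ℕ} → (A : Vtx n) → Amb K W A → W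
  | _, .empty => fun y => y
  | _, .old A => fun (y, _) => topComp A y
  | _, .new A => fun (_, w, _) => topComp A w

/-- The vertex obtained by inserting a first direction. -/
def consNew : {n : ℕ} → Vtx n → Vtx (n + 1)
  | _, .empty => .new .empty
  | _, .old A => .old (consNew A)
  | _, .new A => .new (consNew A)

/-- Iterated prolongation can be started with the first step. -/
def consMap : {n : ℕ} → (A : Vtx n) → Amb K (V × V × K) A → Amb K V (consNew A)
  | _, .empty => fun y => y
  | _, .old A => fun (y, t) => (consMap A y, t)
  | _, .new A => fun (y, w, t) => (consMap A y, consMap A w, t)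

theorem continuous_topComp [TopologicalSpace K] [TopologicalSpace W] : ∀ {n : ℕ} (A : Vtx n),
    Continuous (topComp (K := K) (W := W) A)
  | _, .empty => continuous_id
  | _, .old A => (continuous_topComp A).comp (continuous_fst (X := Amb K W A) (Y := K))
  | _, .new A => (continuous_topComp A).comp
      (f := fun p : Amb K W A × Amb K W A × K => p.2.1) (by fun_prop)

variable [CommRing K] [AddCommGroup V] [Module K V] [AddCommGroup W] [Module K W]

theorem topComp_add : ∀ {n : ℕ} (A : Vtx n) (y z : Amb K W A),
    topComp A (y + z) = topComp A y + topComp A z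
  | _, .empty => fun _ _ => rfl
  | _, .old A => fun (y, _) (z, _) => topComp_add A y z
  | _, .new A => fun (_, y, _) (_, z, _) => topComp_add A y z

theorem topComp_smul : ∀ {n : ℕ} (A : Vtx n) (c : K) (y : Amb K W A),
    topComp A (c • y) = c • topComp A y
  | _, .empty => fun _ _ => rfl
  | _, .old A => fun c (y, _) => topComp_smul A c y
  | _, .new A => fun c (_, y, _) => topComp_smul A c y

theorem topComp_sub {n : ℕ} (A : Vtx n) (y z : Amb K W A) :
    topComp A (y - z) = topComp A y - topComp A z := by
  rw [eq_sub_iff_add_eq, ← topComp_add, sub_add_cancel]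

theorem consMap_add_smul : ∀ {n : ℕ} (A : Vtx n) (y w : Amb K (V × V × K) A) (t : K),
    consMap A (y + t • w) = consMap A y + t • consMap A w
  | _, .empty => fun _ _ _ => rfl
  | _, .old A => fun (y, _) (w, _) t => Prod.ext (consMap_add_smul A y w t) rfl
  | _, .new A => fun (y, y', _) (w, w', _) t => Prod.ext (consMap_add_smul A y w t)
      (Prod.ext (consMap_add_smul A y' w' t) rfl)

theorem consMap_mem {U : Set V} : ∀ {n : ℕ} (A : Vtx n) (y : Amb K (V × V × K) A),
    y ∈ ext K (extDom K U) A → consMap A y ∈ ext K U (consNew A)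
  | _, .empty => fun _ h => h
  | _, .old A => fun (y, _) h => consMap_mem A y h
  | _, .new A => fun (y, w, t) h => ⟨consMap_mem A y h.1, by
      change consMap A y + t • consMap A w ∈ ext K U (consNew A)
      rw [← consMap_add_smul]
      exact consMap_mem A _ h.2⟩

variable [TopologicalSpace K] [TopologicalSpace V] [TopologicalSpace W]

theorem continuous_consMap : ∀ {n : ℕ} (A : Vtx n), Continuous (consMap (K := K) (V := V) A)
  | _, .empty => continuous_id (X := V × V × K)
  | _, .old A => ((continuous_consMap A).comp
      (continuous_fst (X := Amb K (V × V × K) A) (Y := K))).prodMk continuous_snd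
  | _, .new A => ((continuous_consMap A).comp
      (f := fun p : Amb K (V × V × K) A × Amb K (V × V × K) A × K => p.1) (by fun_prop)).prodMk
      (((continuous_consMap A).comp
      (f := fun p : Amb K (V × V × K) A × Amb K (V × V × K) A × K => p.2.1) (by fun_prop)).prodMk
      (continuous_snd.comp continuous_snd))

variable (K) in
/-- The highest components of the finite prolongations of `f` extend continuously. -/
def Extends (n : ℕ) (U : Set V) (f : V → W) : Prop :=
  ∀ A : Vtx n, ∃ h : Amb K V A → W, ContinuousOn h (ext K U A) ∧
    ∀ p ∈ finExt K U A, h p = topComp A (finMap K f A p)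

/-- The `n`-cube is embedded as the slice of the old face on which the last scalar is `1`. -/
theorem Extends.of_succ {n : ℕ} {U : Set V} {f : V → W} (hf : Extends K (n + 1) U f) :
    Extends K n U f := fun A => by
  obtain ⟨h, hc, hfin⟩ := hf (.old A)
  refine ⟨fun y => h (y, 1), ?_, fun p hp => hfin (p, 1) ⟨hp, isUnit_one⟩⟩
  refine ContinuousOn.comp hc ?_ fun y hy => hy
  exact (continuous_id.prodMk (continuous_const (y := (1 : K)))).continuousOn

theorem Extends.one : ∀ {n : ℕ} {U : Set V} {f : V → W}, Extends K (n + 1) U f → Extends K 1 U f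
  | 0, _, _ => fun h => h
  | _ + 1, _, _ => fun h => h.of_succ.one

variable [IsTopologicalRing K] [IsTopologicalAddGroup V] [ContinuousSMul K V]
  [IsTopologicalAddGroup W] [ContinuousSMul K W] [T2Space W]

theorem isOpen_extDom {U : Set V} (hU : IsOpen U) : IsOpen (extDom K U) :=
  (hU.preimage continuous_fst).inter (hU.preimage (f := fun p : V × V × K => p.1 + p.2.2 • p.2.1)
    (by fun_prop))

/-- In the finite prolongations of `g = f^[1]` the first scalar may fail to be invertible, so they
are not literally part of those of `f`. The two agree when that scalar is invertible, and by density
and the Hausdorff property of `W` also otherwise. -/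
theorem extends_prolong (hK : Dense {t : K | IsUnit t}) {U : Set V} (hU : IsOpen U) {f : V → W}
    {g : V × V × K → W} (hg : ContinuousOn g (extDom K U))
    (hgf : ∀ (x v : V) (t : Kˣ), (x, v, (t : K)) ∈ extDom K U →
      g (x, v, (t : K)) = (↑t⁻¹ : K) • (f (x + (t : K) • v) - f x)) :
    ∀ {n : ℕ} (A : Vtx n), Extends K (n + 1) U f → ∀ h : Amb K V (consNew A) → W,
      ContinuousOn h (ext K U (consNew A)) →
      (∀ p ∈ finExt K U (consNew A), h p = topComp _ (finMap K f _ p)) →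
      ∀ p ∈ finExt K (extDom K U) A, h (consMap A p) = topComp A (finMap K g A p)
  | _, .empty => fun _ h hc hfin p hp => by
    have hd := ext_subset_closure_finExt (V := V) hK hU (.new .empty)
    refine Set.EqOn.of_subset_closure (s := finExt K U (.new .empty)) (t := ext K U (.new .empty))
      (f := h) (g := g) (fun q hq => ?_) hc hg (finExt_subset_ext _) hd hp
    obtain ⟨x, v, t⟩ := q
    obtain ⟨t, rfl⟩ := hq.2
    refine (hfin _ hq).trans ?_
    refine Eq.trans ?_ (hgf x v t hq.1).symm
    change Ring.inverse (t : K) • (f (x + (t : K) • v) - f x) = _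
    rw [Ring.inverse_unit]
    rfl
  | _, .old A => fun hE h hc hfin (p, t) hp => by
    refine extends_prolong hK hU hg hgf A hE.of_succ (fun q => h (q, t)) ?_
      (fun q hq => hfin (q, t) ⟨hq, hp.2⟩) p hp.1
    refine ContinuousOn.comp hc ?_ fun y hy => hy
    exact (continuous_id.prodMk (continuous_const (y := t))).continuousOn
  | _, .new A => fun hE h hc hfin (y, w, t) hp => by
    obtain ⟨hA, hAc, hAfin⟩ := hE.of_succ (consNew A)
    have ih := extends_prolong hK hU hg hgf A hE.of_succ hA hAc hAfin
    have ht : IsUnit t := hp.2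
    obtain ⟨t, rfl⟩ := ht
    let S : Set (Amb K V (consNew A) × Amb K V (consNew A)) :=
      ext K U (consNew A) ×ˢ ext K U (consNew A)
    let T : Set (Amb K V (consNew A) × Amb K V (consNew A)) :=
      finExt K U (consNew A) ×ˢ finExt K U (consNew A)
    -- With the last scalar `t` a fixed unit, cells in the last direction are the same as pairs of
    -- endpoints. In these coordinates the finite pairs are dense.
    let j : Amb K V (consNew A) × Amb K V (consNew A) → Amb K V (.new (consNew A)) :=
      fun q => (q.1, (↑t⁻¹ : K) • (q.2 - q.1), (t : K))
    have hj : Continuous j := by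
      change Continuous fun q : Amb K V (consNew A) × Amb K V (consNew A) =>
        (q.1, (↑t⁻¹ : K) • (q.2 - q.1), (t : K))
      fun_prop
    have hjt : ∀ q : Amb K V (consNew A) × Amb K V (consNew A),
        q.1 + (t : K) • (↑t⁻¹ : K) • (q.2 - q.1) = q.2 := fun q => by
      rw [smul_smul, Units.mul_inv, one_smul, add_sub_cancel]
    have hjS : MapsTo j S (ext K U (.new (consNew A))) := fun q hq => ⟨hq.1, by
      change q.1 + (t : K) • (↑t⁻¹ : K) • (q.2 - q.1) ∈ _
      rw [hjt]; exact hq.2⟩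
    have hST : S ⊆ closure T := by
      rw [closure_prod_eq]
      exact prod_mono (ext_subset_closure_finExt hK hU _) (ext_subset_closure_finExt hK hU _)
    have key : EqOn (fun q => h (j q)) (fun q => (↑t⁻¹ : K) • (hA q.2 - hA q.1)) S := by
      refine Set.EqOn.of_subset_closure (s := T) (fun q hq => ?_)
        (hc.comp hj.continuousOn hjS) ?_ (prod_mono (finExt_subset_ext _) (finExt_subset_ext _)) hST
      · have h1 : j q ∈ finExt K U (.new (consNew A)) := ⟨⟨hq.1, by
          change q.1 + (t : K) • (↑t⁻¹ : K) • (q.2 - q.1) ∈ _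
          rw [hjt]; exact hq.2⟩, t.isUnit⟩
        refine (hfin _ h1).trans ?_
        change topComp (consNew A) (Ring.inverse (t : K) • (finMap K f (consNew A)
          (q.1 + (t : K) • (↑t⁻¹ : K) • (q.2 - q.1)) - finMap K f (consNew A) q.1)) = _
        rw [hjt, topComp_smul, topComp_sub, ← hAfin _ hq.1, ← hAfin _ hq.2, Ring.inverse_unit]
      · exact (((hAc.comp continuousOn_snd fun q hq => hq.2).sub
          (hAc.comp continuousOn_fst fun q hq => hq.1)).const_smul _)
    have hyS : (consMap A y, consMap A (y + (t : K) • w)) ∈ S :=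
      ⟨consMap_mem A _ (finExt_subset_ext A hp.1.1), consMap_mem A _ (finExt_subset_ext A hp.1.2)⟩
    have hk := key hyS
    have hjy : j (consMap A y, consMap A (y + (t : K) • w))
        = (consMap A y, consMap A w, (t : K)) := by
      simp only [j, consMap_add_smul, add_sub_cancel_left, smul_smul, Units.inv_mul, one_smul]
      rfl
    simp only [hjy, ih _ hp.1.1, ih _ hp.1.2] at hk
    refine hk.trans ?_
    change _ = topComp A (Ring.inverse (t : K) • (finMap K g A (y + (t : K) • w) - finMap K g A y))
    rw [topComp_smul, topComp_sub, Ring.inverse_unit]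

/-- The extension in a single direction is `f^[1]`. The extensions of `f` on cubes with an
additional first direction serve as extensions for `f^[1]`, to which the induction hypothesis
applies. -/
theorem Extends.isC (hK : Dense {t : K | IsUnit t}) {n : ℕ} {U : Set V} (hU : IsOpen U)
    {f : V → W} (hf : Extends K n U f) : IsC K n U f := by
  induction n generalizing V with
  | zero =>
    obtain ⟨h, hc, hfin⟩ := hf .empty
    exact ContinuousOn.congr hc fun x hx => (hfin x hx).symm
  | succ n ih =>
    obtain ⟨g, hg, hgfin⟩ : ∃ g : V × V × K → W, ContinuousOn g (extDom K U) ∧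
        ∀ p ∈ finExt K U (.new .empty), g p = topComp (.new .empty) (finMap K f (.new .empty) p) :=
      hf.one (.new .empty)
    have hgf : ∀ (x v : V) (t : Kˣ), (x, v, (t : K)) ∈ extDom K U →
        g (x, v, (t : K)) = (↑t⁻¹ : K) • (f (x + (t : K) • v) - f x) := fun x v t hx => by
      refine (hgfin (x, v, (t : K)) ⟨hx, t.isUnit⟩).trans ?_
      change Ring.inverse (t : K) • (f (x + (t : K) • v) - f x) = _
      rw [Ring.inverse_unit]
    refine ⟨g, hg, hgf, ih (V := V × V × K) (isOpen_extDom hU) fun A => ?_⟩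
    obtain ⟨h, hc, hfin⟩ := hf (consNew A)
    have hm : MapsTo (consMap (K := K) (V := V) A) (ext K (extDom K U) A) (ext K U (consNew A)) :=
      fun p hp => consMap_mem A p hp
    have hcm : Continuous (consMap (K := K) (V := V) A) := continuous_consMap A
    exact ⟨fun p => h (consMap A p), ContinuousOn.comp hc hcm.continuousOn hm,
      fun p hp => extends_prolong (f := f) hK hU hg hgf A hf h hc hfin p hp⟩

theorem isC_iff (hK : Dense {t : K | IsUnit t}) {n : ℕ} {U : Set V} (hU : IsOpen U) (f : V → W) :
    IsC K n U f ↔ ∃ F : CubeHom (tangentCube K n U) (tangentCube K n (univ : Set W)),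
      ContinuouslyExtends F f := by
  refine ⟨fun hf => ?_, fun ⟨F, hFc, hF⟩ => Extends.isC hK hU fun A => ?_⟩
  · obtain ⟨F, hF, -⟩ := exists_continuouslyExtends hK hU hf (mapsTo_univ f U)
    exact ⟨F, hF⟩
  · classical
    refine ⟨fun y => if hy : y ∈ ext K U A then topComp A (val (F.map A ⟨y, hy⟩)) else 0, ?_,
      fun p hp => ?_⟩
    · rw [continuousOn_iff_continuous_domRestrict]
      refine ((continuous_topComp A).comp (hFc A)).congr fun p => ?_
      simp [domRestrict, p.2]
    · exact (dif_pos (finExt_subset_ext A hp)).trans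
        (congrArg (topComp A) (hF A ⟨p, finExt_subset_ext A hp⟩ hp))

end converse

/-! ### Approximation of top cells by finite ones -/

open Filter Function

instance instFiniteDir : (n : ℕ) → Finite (Dir n)
  | 0 =>
    have : IsEmpty (Dir 0) := ⟨fun i => nomatch i⟩
    inferInstance
  | n + 1 =>
    have := instFiniteDir n
    Finite.of_surjective (fun o : Option (Dir n) => o.elim Dir.last Dir.prev) fun
      | .last => ⟨none, rfl⟩
      | .prev i => ⟨some i, rfl⟩

section approx

variable (K V : Type u) [CommRing K] [AddCommGroup V] [Module K V]
  [TopologicalSpace K] [TopologicalSpace V] (n : ℕ)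

/-- The neighborhoods of zero, as an index set. -/
def Scale : Type u := {s : Set (Amb K V (Vtx.top n)) // s ∈ 𝓝 0}

/-- The filter of small neighborhoods of zero. -/
def fine : Filter (Scale K V n) := comap Subtype.val (𝓝 (0 : Amb K V (Vtx.top n))).smallSets

instance : (fine K V n).NeBot := comap_neBot fun t ht => by
  obtain ⟨s, hs, hst⟩ := (hasBasis_smallSets _).mem_iff.mp ht
  exact ⟨⟨s, hs⟩, hst (mem_powerset Subset.rfl)⟩

variable {K V n}

variable [IsTopologicalRing K] [IsTopologicalAddGroup V] [ContinuousSMul K V]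

/-- This is the purpose of indexing nets by neighborhoods of zero: an error allowed to be any
element of the index itself tends to zero. -/
theorem tendsto_fine {v v₀ : Scale K V n → Amb K V (Vtx.top n)} {b : Amb K V (Vtx.top n)}
    (h : ∀ i, v i - v₀ i ∈ i.1) (h₀ : Tendsto v₀ (fine K V n) (𝓝 b)) :
    Tendsto v (fine K V n) (𝓝 b) := by
  have h1 : Tendsto (fun i => v i - v₀ i) (fine K V n) (𝓝 0) := fun t ht => by
    have h2 : {i : Scale K V n | i.1 ⊆ t} ∈ fine K V n :=
      preimage_mem_comap ((hasBasis_smallSets _).mem_of_mem ht)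
    exact mem_map.mpr (mem_of_superset h2 fun i (hi : i.1 ⊆ t) => hi (h i))
  simpa using h1.add h₀

theorem exists_finite_approx (hK : Dense {t : K | IsUnit t}) {D : Set (Dir n → Bool)}
    (hD : IsLowerSet D) {v₀ : Scale K V n → Amb K V (Vtx.top n)} {b : Amb K V (Vtx.top n)}
    (h₀ : Tendsto v₀ (fine K V n) (𝓝 b))
    (hfin : ∀ᶠ i in fine K V n, ∀ ε ∈ D, vtx _ (v₀ i) ε ∈ finExt K univ (Vtx.bot n)) :
    ∃ v : Scale K V n → Amb K V (Vtx.top n), Tendsto v (fine K V n) (𝓝 b) ∧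
      ∀ᶠ i in fine K V n, v i ∈ finExt K univ (Vtx.top n) ∧
        ∀ ε ∈ D, vtx _ (v i) ε = vtx _ (v₀ i) ε := by
  have : ∀ i : Scale K V n, ∃ z : Amb K V (Vtx.top n), z - v₀ i ∈ i.1 ∧
      ((∀ ε ∈ D, vtx _ (v₀ i) ε ∈ finExt K univ (Vtx.bot n)) →
        z ∈ finExt K univ (Vtx.top n) ∧ ∀ ε ∈ D, vtx _ z ε = vtx _ (v₀ i) ε) := fun i => by
    by_cases h : ∀ ε ∈ D, vtx _ (v₀ i) ε ∈ finExt K univ (Vtx.bot n)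
    · have hcont : Tendsto (fun z => z - v₀ i) (𝓝 (v₀ i)) (𝓝 0) := by
        have : Continuous fun z => z - v₀ i := by fun_prop
        simpa using this.tendsto (v₀ i)
      obtain ⟨z, hz, hz'⟩ := mem_closure_iff_nhds.mp (mem_closure_finExt hK _ D hD _ h) _
        (hcont i.2)
      exact ⟨z, hz, fun _ => ⟨hz'.1, vtx_eq_of_vanishOn _ hD hz'.2⟩⟩
    -- A default value at indices that are eventually excluded.
    · exact ⟨v₀ i, by rw [sub_self]; exact mem_of_mem_nhds i.2, fun h' => absurd h' h⟩
  choose v hv hv' using this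
  exact ⟨v, tendsto_fine hv h₀, hfin.mono fun i hi => hv' i hi⟩

end approx

/-! ### The local cells of a manifold

A point `a` of the top vertex set of `U^n` is represented by the set of all nets of finite elements
which converge to it. Finite elements are determined by their vertices, which makes sense in the
manifold. -/

section cells

variable {K V M : Type u} [CommRing K] [AddCommGroup V] [Module K V]
  [TopologicalSpace K] [TopologicalSpace V] [TopologicalSpace M] {n : ℕ}

variable (K V M n) in
/-- Nets in `M × K^n`. -/
abbrev Net : Type u := Germ (fine K V n) (Amb K M (Vtx.bot n))

/-- The image under a chart of the vertices of a net of top cells. -/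
def netVtx (φ : OpenPartialHomeomorph M V) (u : Scale K V n → Amb K V (Vtx.top n)) :
    (Dir n → Bool) → Net K V M n :=
  fun ε => ((fun i => Amb.map id φ.symm (Vtx.bot n) (vtx _ (u i) ε) :
    Scale K V n → Amb K M (Vtx.bot n)) : Germ (fine K V n) _)

/-- The nets of finite elements which converge to `a`. -/
def nets (φ : OpenPartialHomeomorph M V) (a : Amb K V (Vtx.top n)) :
    Set ((Dir n → Bool) → Net K V M n) :=
  {x | ∃ u : Scale K V n → Amb K V (Vtx.top n), Tendsto u (fine K V n) (𝓝 a) ∧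
    (∀ᶠ i in fine K V n, u i ∈ finExt K univ (Vtx.top n)) ∧ x = netVtx φ u}

theorem groundMap_symm_injOn (φ : OpenPartialHomeomorph M V) {p q : Amb K V (Vtx.bot n)}
    (hp : groundPt K V n p ∈ φ.target) (hq : groundPt K V n q ∈ φ.target)
    (h : Amb.map id φ.symm (Vtx.bot n) p = Amb.map id φ.symm (Vtx.bot n) q) : p = q := by
  refine ground_ext n p q (φ.symm.injOn hp hq ?_) ?_
  · simpa [groundPt_map] using congrArg (groundPt K M n) h
  · simpa [groundScal_map] using congrArg (groundScal K M n) h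

variable [IsTopologicalRing K] [IsTopologicalAddGroup V] [ContinuousSMul K V]
  {φ : OpenPartialHomeomorph M V}

theorem eventually_mem_ext {U : Set V} (hU : IsOpen U) {a : Amb K V (Vtx.top n)}
    (ha : a ∈ ext K U (Vtx.top n)) {u : Scale K V n → Amb K V (Vtx.top n)}
    (hu : Tendsto u (fine K V n) (𝓝 a)) : ∀ᶠ i in fine K V n, u i ∈ ext K U (Vtx.top n) :=
  hu.eventually ((isOpen_ext hU _).mem_nhds ha)

/-- In a chart, the vertices of a net determine those of the preimages. -/
theorem eventually_vtx_eq {a a' : Amb K V (Vtx.top n)} (ha : a ∈ ext K φ.target (Vtx.top n))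
    (ha' : a' ∈ ext K φ.target (Vtx.top n)) {u u' : Scale K V n → Amb K V (Vtx.top n)}
    (hu : Tendsto u (fine K V n) (𝓝 a)) (hu' : Tendsto u' (fine K V n) (𝓝 a'))
    {ε ε' : Dir n → Bool} (h : netVtx φ u ε = netVtx φ u' ε') :
    ∀ᶠ i in fine K V n, vtx _ (u i) ε = vtx _ (u' i) ε' := by
  filter_upwards [eventually_mem_ext φ.open_target ha hu, eventually_mem_ext φ.open_target ha' hu',
    Germ.coe_eq.mp h] with i hi hi' h
  exact groundMap_symm_injOn φ (groundPt_mem_of_mem_ext hi _) (groundPt_mem_of_mem_ext hi' _) h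

theorem netVtx_congr {u u' : Scale K V n → Amb K V (Vtx.top n)} {ε ε' : Dir n → Bool}
    (h : ∀ᶠ i in fine K V n, vtx _ (u i) ε = vtx _ (u' i) ε') :
    netVtx φ u ε = netVtx φ u' ε' :=
  Germ.coe_eq.mpr (h.mono fun i hi => by simp only [hi])

theorem nets_nonempty (hK : Dense {t : K | IsUnit t}) (φ : OpenPartialHomeomorph M V)
    (a : Amb K V (Vtx.top n)) : (nets φ a).Nonempty := by
  obtain ⟨v, hv, hv'⟩ := exists_finite_approx hK (D := ∅) (fun _ _ _ h => h)
    (tendsto_const_nhds (x := a)) (Eventually.of_forall fun _ _ h => h.elim)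
  exact ⟨_, v, hv, hv'.mono fun _ h => h.1, rfl⟩

/-- Within one chart, finite cells with the same vertices coincide, so a common element of the two
sets comes from a single net converging to both points. -/
theorem inseparable_of_mem_nets {a a' : Amb K V (Vtx.top n)}
    (ha : a ∈ ext K φ.target (Vtx.top n)) (ha' : a' ∈ ext K φ.target (Vtx.top n))
    {x : (Dir n → Bool) → Net K V M n} (hx : x ∈ nets φ a) (hx' : x ∈ nets φ a') :
    Inseparable a a' := by
  obtain ⟨u', hu', hfin', hx'⟩ := hx'
  obtain ⟨u, hu, hfin, rfl⟩ := hx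
  have h1 : ∀ᶠ i in fine K V n, ∀ ε, vtx _ (u i) ε = vtx _ (u' i) ε :=
    eventually_all.mpr fun ε => eventually_vtx_eq ha ha' hu hu' (congrFun hx' ε)
  refine tendsto_nhds_unique_inseparable hu (hu'.congr' ?_)
  filter_upwards [h1, hfin'] with i hi hi'
  exact vtx_injective _ _ _ hi' fun ε => (hi ε).symm

theorem nets_eq_of_inseparable {a a' : Amb K V (Vtx.top n)} (h : Inseparable a a') :
    nets φ a = nets φ a' := by
  ext x
  have : 𝓝 a = 𝓝 a' := h
  simp only [nets, this]

theorem flipAt_mem_nets (j : Dir n) {a : Amb K V (Vtx.top n)} {x : (Dir n → Bool) → Net K V M n}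
    (hx : x ∈ nets φ a) : flipAt j x ∈ nets φ (invMap (topEdge j) K V a) := by
  obtain ⟨u, hu, hfin, rfl⟩ := hx
  refine ⟨fun i => invMap (topEdge j) K V (u i), ((continuous_invMap _).tendsto a).comp hu,
    hfin.mono fun i hi => invMap_mem_finExt _ hi, ?_⟩
  funext ε
  refine netVtx_congr (Eventually.of_forall fun i => ?_)
  rw [vtx_invMap, topEdge_dir]

theorem invSet_nets (j : Dir n) (a : Amb K V (Vtx.top n)) :
    invSet j (nets φ a) = nets φ (invMap (topEdge j) K V a) := by
  ext x
  refine ⟨fun hx => ?_, fun hx => ?_⟩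
  · rw [← flipAt_flipAt j x]
    exact flipAt_mem_nets j hx
  · have := flipAt_mem_nets j hx
    rwa [invMap_invMap] at this

/-- One inclusion is continuity of the product. For the other, a net `w` tending to `a ∗ b` is
factored as `(w ∗ v⁻¹) ∗ v`, where `v` is a finite net tending to `b` with the same source as `w`.
-/
theorem mulSet_nets (hK : Dense {t : K | IsUnit t}) (j : Dir n) {a b : Amb K V (Vtx.top n)}
    (ha : a ∈ ext K φ.target (Vtx.top n)) (hb : b ∈ ext K φ.target (Vtx.top n))
    (h : srcMap K V (topEdge j) a = tgtMap (topEdge j) K V b) :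
    mulSet j (nets φ a) (nets φ b) = nets φ (compMap K V (topEdge j) a b) := by
  set e := topEdge j with he
  have hdir : e.dir = j := topEdge_dir j
  ext x
  constructor
  · rintro ⟨_, ⟨u, hu, hufin, rfl⟩, _, ⟨v, hv, hvfin, rfl⟩, hc, rfl⟩
    have h1 : ∀ᶠ i in fine K V n, ∀ ε, vtx _ (u i) (update ε j false)
        = vtx _ (v i) (update ε j true) :=
      eventually_all.mpr fun ε => eventually_vtx_eq ha hb hu hv (hc ε)
    have h2 : ∀ᶠ i in fine K V n, srcMap K V e (u i) = tgtMap e K V (v i) := by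
      filter_upwards [h1, hufin] with i hi hufin
      refine vtx_injective _ _ _ (srcMap_mem_finExt e hufin) fun ε => ?_
      rw [vtx_srcMap, vtx_tgtMap, hdir, hi]
    refine ⟨fun i => compMap K V e (u i) (v i),
      ((continuous_compMap e).tendsto (a, b)).comp (hu.prodMk_nhds hv), ?_, ?_⟩
    · filter_upwards [h2, hufin, hvfin] with i hi hu hv
      exact compMap_mem_finExt e hu hv hi
    · funext ε
      simp only [stack]
      split_ifs with hε
      · exact netVtx_congr (h2.mono fun i hi => ((vtx_compMap e _ _ hi ε).1 (by rw [hdir]; exact hε)).symm)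
      · refine netVtx_congr (h2.mono fun i hi => ((vtx_compMap e _ _ hi ε).2 ?_).symm)
        rw [hdir]; simpa using hε
  · rintro ⟨w, hw, hwfin, rfl⟩
    -- A translate of `b` with the source of `w i`. It need not be finite, but its source vertices
    -- are, and `exists_finite_approx` preserves them.
    let v₀ : Scale K V n → Amb K V (Vtx.top n) := fun i =>
      b - oneMap K V e (srcMap K V e b) + oneMap K V e (srcMap K V e (w i))
    have hv₀ : Tendsto v₀ (fine K V n) (𝓝 b) := by
      have hc : Continuous fun z => b - oneMap K V e (srcMap K V e b)
          + oneMap K V e (srcMap K V e z) :=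
        continuous_const.add ((continuous_oneMap e).comp (continuous_srcMap e))
      have := (hc.tendsto _).comp hw
      rwa [srcMap_compMap, sub_add_cancel] at this
    have hsv₀ : ∀ i, srcMap K V e (v₀ i) = srcMap K V e (w i) := fun i => by
      have h2 := congrArg (srcMap K V e) (sub_add_cancel b (oneMap K V e (srcMap K V e b)))
      rw [srcMap_add, srcMap_oneMap, add_eq_right] at h2
      simp only [v₀]
      rw [srcMap_add, h2, srcMap_oneMap, zero_add]
    have hvtx : ∀ z : Amb K V (Vtx.top n), ∀ ε : Dir n → Bool, ε j = false →
        vtx _ z ε = vtx _ (srcMap K V e z) ε := fun z ε hε => by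
      rw [vtx_srcMap, hdir, ← hε, update_eq_self]
    obtain ⟨v, hv, hvfin⟩ := exists_finite_approx hK (isLowerSet_face j) hv₀
      (hwfin.mono fun i hi ε hε => by
        rw [hvtx _ ε hε, hsv₀]
        exact (mem_finExt_iff _ _).mp (srcMap_mem_finExt e hi) ε)
    have hsv : ∀ᶠ i in fine K V n, srcMap K V e (w i) = tgtMap e K V (invMap e K V (v i)) := by
      filter_upwards [hvfin, hwfin] with i hi hwi
      refine vtx_injective _ _ _ (srcMap_mem_finExt e hwi) fun ε => ?_
      rw [tgtMap_invMap, ← hsv₀, vtx_srcMap, vtx_srcMap, hi.2 _ (by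
        change update ε e.dir false j = false
        rw [hdir, update_self])]
    have hq : Tendsto (fun i => compMap K V e (w i) (invMap e K V (v i))) (fine K V n) (𝓝 a) := by
      have := ((continuous_compMap e).tendsto (_, _)).comp
        (hw.prodMk_nhds (((continuous_invMap e).tendsto b).comp hv))
      refine this.trans (le_of_eq (congrArg 𝓝 ?_))
      change compMap K V e (compMap K V e a b) (invMap e K V b) = a
      have h3 : srcMap K V e b = tgtMap e K V (invMap e K V b) := (tgtMap_invMap e K V b).symm
      rw [compMap_assoc, compMap_invMap, ← h, compMap_one_src]
    refine ⟨_, ⟨_, hq, ?_, rfl⟩, _, ⟨v, hv, hvfin.mono fun _ hi => hi.1, rfl⟩, fun ε => ?_, ?_⟩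
    · filter_upwards [hsv, hwfin, hvfin] with i hi hwi hvi
      exact compMap_mem_finExt e hwi (invMap_mem_finExt e hvi.1) hi
    · refine netVtx_congr (hsv.mono fun i hi => ?_)
      rw [(vtx_compMap e _ _ hi _).2 (by rw [hdir, update_self]), vtx_invMap, hdir, update_self,
        update_idem]
      rfl
    · funext ε
      simp only [stack]
      split_ifs with hε
      · exact netVtx_congr (hsv.mono fun i hi => ((vtx_compMap e _ _ hi ε).1 (by rw [hdir]; exact hε)).symm)
      · have hε : ε j = false := by simpa using hε
        refine netVtx_congr (hvfin.mono fun i hi => ?_)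
        rw [hi.2 ε hε, hvtx (v₀ i) ε hε, hsv₀, ← hvtx _ ε hε]

theorem srcSet_nets (hK : Dense {t : K | IsUnit t}) (j : Dir n) {a : Amb K V (Vtx.top n)}
    (ha : a ∈ ext K φ.target (Vtx.top n)) :
    srcSet j (nets φ a) = nets φ (oneMap K V (topEdge j) (srcMap K V (topEdge j) a)) := by
  rw [srcSet, invSet_nets, mulSet_nets hK j (invMap_mem _ a ha) ha (srcMap_invMap _ K V a),
    invMap_compMap]

theorem tgtSet_nets (hK : Dense {t : K | IsUnit t}) (j : Dir n) {a : Amb K V (Vtx.top n)}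
    (ha : a ∈ ext K φ.target (Vtx.top n)) :
    tgtSet j (nets φ a) = nets φ (oneMap K V (topEdge j) (tgtMap (topEdge j) K V a)) := by
  rw [tgtSet, invSet_nets, mulSet_nets hK j ha (invMap_mem _ a ha) (tgtMap_invMap _ K V a).symm,
    compMap_invMap]

/-- Mix the components of the two nets: those that matter for `R` from the first, the others from
the second. The mixture converges to `a` and has the right vertices on `R ∪ R'`; it is then made
finite without changing these. -/
theorem gluable_nets (hK : Dense {t : K | IsUnit t}) {a : Amb K V (Vtx.top n)}
    (ha : a ∈ ext K φ.target (Vtx.top n)) : Gluable (nets φ a) := by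
  rintro R R' hR hR' _ ⟨u, hu, hufin, rfl⟩ _ ⟨v, hv, hvfin, rfl⟩ hxy
  have h1 : ∀ᶠ i in fine K V n, ∀ ε ∈ R ∩ R', vtx _ (u i) ε = vtx _ (v i) ε := by
    refine eventually_all.mpr fun ε => ?_
    by_cases hε : ε ∈ R ∩ R'
    · exact (eventually_vtx_eq ha ha hu hv (hxy ε hε.1 hε.2)).mono fun _ h _ => h
    · exact Eventually.of_forall fun _ h => absurd h hε
  have hm : Tendsto (fun i => mix _ R (u i) (v i)) (fine K V n) (𝓝 a) := by
    have := ((continuous_mix _ R).tendsto (a, a)).comp (hu.prodMk_nhds hv)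
    simp only [mix_self] at this
    exact this
  have hmR : ∀ i, ∀ ε ∈ R, vtx _ (mix _ R (u i) (v i)) ε = vtx _ (u i) ε := fun i =>
    vtx_eq_of_vanishOn _ hR (vanishOn_mix_sub_left _ R _ _)
  have hmR' : ∀ᶠ i in fine K V n, ∀ ε ∈ R', vtx _ (mix _ R (u i) (v i)) ε = vtx _ (v i) ε := by
    filter_upwards [h1, hufin] with i hi hui
    exact vtx_eq_of_vanishOn _ hR' (vanishOn_mix_sub_right _ hR hR'
      (vanishOn_of_vtx_eq _ _ (hR.inter hR') _ _ hui hi))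
  obtain ⟨w, hw, hwfin⟩ := exists_finite_approx hK (hR.union hR') hm (by
    filter_upwards [hmR', hufin, hvfin] with i hi hui hvi ε hε
    rcases hε with hε | hε
    · rw [hmR i ε hε]; exact (mem_finExt_iff _ _).mp hui ε
    · rw [hi ε hε]; exact (mem_finExt_iff _ _).mp hvi ε)
  refine ⟨_, ⟨w, hw, hwfin.mono fun _ h => h.1, rfl⟩, fun ε hε => ?_, fun ε hε => ?_⟩
  · refine netVtx_congr (hwfin.mono fun i hi => ?_)
    rw [hi.2 ε (Or.inl hε), hmR i ε hε]
  · refine netVtx_congr ((hwfin.and hmR').mono fun i hi => ?_)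
    rw [hi.1.2 ε (Or.inr hε), hi.2 ε hε]

/-- Reflections of sets of nets are sets of nets, so all of them are gluable. The coset property is
the unit law, since `X ∗ X⁻¹` is the set of nets of a unit. -/
theorem isRegular_nets (hK : Dense {t : K | IsUnit t}) {a : Amb K V (Vtx.top n)}
    (ha : a ∈ ext K φ.target (Vtx.top n)) : IsRegular (nets φ a) where
  gluable l := by
    induction l generalizing a with
    | nil => exact gluable_nets hK ha
    | cons j l ih =>
      rw [List.foldl_cons, invSet_nets]
      exact ih (invMap_mem _ a ha)
  isCoset j := by
    have h1 : tgtMap (topEdge j) K V a = srcMap K V (topEdge j)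
      (oneMap K V (topEdge j) (tgtMap (topEdge j) K V a)) := (srcMap_oneMap _ K V _).symm
    rw [IsCoset, tgtSet_nets hK j ha, mulSet_nets hK j (oneMap_mem _ _ (tgtMap_mem _ a ha)) ha
      h1.symm, compMap_one_left]

theorem eq_of_nets_eq [T0Space V] (hK : Dense {t : K | IsUnit t}) {A : Vtx n} {a a' : Amb K V A}
    (ha : a ∈ ext K φ.target A) (ha' : a' ∈ ext K φ.target A)
    (h : nets φ (up A a) = nets φ (up A a')) (hs : scal A a = scal A a') : a = a' := by
  obtain ⟨x, hx⟩ := nets_nonempty hK φ (up A a)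
  have := (inseparable_of_mem_nets ((up_mem_ext A a).mpr ha) ((up_mem_ext A a').mpr ha') hx
    (h ▸ hx)).map (continuous_down A)
  rw [down_up, down_up] at this
  exact eq_of_inseparable A a a' this hs

end cells

/-! ### Inverses of products -/

section inverses

variable {K V : Type u} [CommRing K] [AddCommGroup V] [Module K V] {n : ℕ}

/-- Uniqueness of inverses. It yields the compatibility of inversion with the other structure maps
without unfolding its polynomial definition. -/
theorem invMap_eq_of_compMap {B A : Vtx n} (e : Edge B A) {a b : Amb K V A}
    (h : srcMap K V e a = tgtMap e K V b)
    (hab : compMap K V e a b = oneMap K V e (tgtMap e K V a)) : invMap e K V a = b := by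
  have h1 := compMap_one_src e K V (invMap e K V a)
  rw [srcMap_invMap, ← hab, ← compMap_assoc, invMap_compMap, compMap_one_left] at h1
  exact h1.symm

theorem invMap_compMap_self {B A : Vtx n} (e : Edge B A) {a b : Amb K V A}
    (h : srcMap K V e a = tgtMap e K V b) :
    invMap e K V (compMap K V e a b) = compMap K V e (invMap e K V b) (invMap e K V a) := by
  have h' : srcMap K V e (invMap e K V b) = tgtMap e K V (invMap e K V a) := by
    rw [srcMap_invMap, tgtMap_invMap, h]
  refine invMap_eq_of_compMap e ?_ ?_
  · rw [srcMap_compMap, tgtMap_compMap _ _ _ _ _ h', tgtMap_invMap]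
  · rw [compMap_assoc, ← compMap_assoc e K V b, compMap_invMap, compMap_one_left, compMap_invMap,
      tgtMap_compMap _ _ _ _ _ h]

variable {D C B A : Vtx n} {e : Edge B A} {f : Edge C A} {f' : Edge D B} {e' : Edge D C}

theorem srcMap_invMap_face (hF : Face e f f' e') (a : Amb K V A) :
    srcMap K V e (invMap f K V a) = invMap f' K V (srcMap K V e a) := by
  refine (invMap_eq_of_compMap f' ?_ ?_).symm
  · rw [srcMap_srcMap hF, ← srcMap_tgtMap hF.symm, tgtMap_invMap]
  · rw [← srcMap_compMap_face hF, compMap_invMap, srcMap_oneMap_face hF, srcMap_tgtMap hF.symm]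

theorem tgtMap_invMap_face (hF : Face e f f' e') (a : Amb K V A) :
    tgtMap e K V (invMap f K V a) = invMap f' K V (tgtMap e K V a) := by
  refine (invMap_eq_of_compMap f' ?_ ?_).symm
  · rw [srcMap_tgtMap hF, ← tgtMap_tgtMap hF.symm, tgtMap_invMap]
  · rw [← tgtMap_compMap_face hF _ _ _ _ (tgtMap_invMap f K V a).symm, compMap_invMap,
      tgtMap_oneMap_face hF, tgtMap_tgtMap hF.symm]

theorem invMap_compMap_face (hF : Face e f f' e') {a b : Amb K V A}
    (h : srcMap K V f a = tgtMap f K V b) :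
    invMap e K V (compMap K V f a b) = compMap K V f (invMap e K V a) (invMap e K V b) := by
  have h' : srcMap K V f (invMap e K V a) = tgtMap f K V (invMap e K V b) := by
    rw [srcMap_invMap_face hF.symm, tgtMap_invMap_face hF.symm, h]
  refine invMap_eq_of_compMap e ?_ ?_
  · rw [srcMap_compMap_face hF, tgtMap_compMap_face hF _ _ _ _ h', tgtMap_invMap, tgtMap_invMap]
  · rw [compMap_compMap hF, compMap_invMap, compMap_invMap, ← oneMap_compMap hF,
      tgtMap_compMap_face hF _ _ _ _ h]

theorem scal_invMap (y : Amb K V A) :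
    scal A (invMap e K V y) = invMap e K PUnit.{u + 1} (scal A y) :=
  (invMap_map e K V K PUnit (RingHom.id K) 0 (fun _ _ => rfl) y).symm

theorem up_top : ∀ {n : ℕ} (y : Amb K V (Vtx.top n)), up (Vtx.top n) y = y
  | 0, _ => rfl
  | n + 1, (y, w, t) => Prod.ext (up_top y) (Prod.ext (up_top w) rfl)

end inverses

/-! ### Local cells and structure maps -/

section localCells

variable {K V M : Type u} [CommRing K] [AddCommGroup V] [Module K V]
  [TopologicalSpace K] [TopologicalSpace V] [TopologicalSpace M] {n : ℕ}
  [IsTopologicalRing K] [IsTopologicalAddGroup V] [ContinuousSMul K V]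
  {φ : OpenPartialHomeomorph M V} {B A : Vtx n} (e : Edge B A)

theorem srcSet_nets_up (hK : Dense {t : K | IsUnit t}) {a : Amb K V A}
    (ha : a ∈ ext K φ.target A) :
    srcSet e.dir (nets φ (up A a)) = nets φ (up B (srcMap K V e a)) := by
  rw [srcSet_nets hK _ ((up_mem_ext A a).mpr ha), up_srcMap]

theorem tgtSet_nets_up (hK : Dense {t : K | IsUnit t}) {a : Amb K V A}
    (ha : a ∈ ext K φ.target A) :
    tgtSet e.dir (nets φ (up A a)) = nets φ (up B (tgtMap e K V a)) := by
  rw [tgtSet_nets hK _ ((up_mem_ext A a).mpr ha), up_tgtMap]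

theorem invSet_nets_up (a : Amb K V A) :
    invSet e.dir (nets φ (up A a)) = nets φ (up A (invMap e K V a)) := by
  rw [invSet_nets, up_invMap]

theorem mulSet_nets_up (hK : Dense {t : K | IsUnit t}) {a b : Amb K V A}
    (ha : a ∈ ext K φ.target A) (hb : b ∈ ext K φ.target A)
    (h : srcMap K V e a = tgtMap e K V b) :
    mulSet e.dir (nets φ (up A a)) (nets φ (up A b)) = nets φ (up A (compMap K V e a b)) := by
  rw [up_compMap]
  refine mulSet_nets hK _ ((up_mem_ext A a).mpr ha) ((up_mem_ext A b).mpr hb) ?_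
  rw [← srcMap_oneMap (topEdge e.dir) K V (srcMap K V _ (up A a)), ← up_srcMap, h, up_tgtMap,
    srcMap_oneMap]

/-! ### Change of charts -/

variable {ψ : OpenPartialHomeomorph M V}

theorem symm_transition {x : V} (hx : x ∈ (φ.symm.trans ψ).source) :
    ψ.symm ((φ.symm.trans ψ) x) = φ.symm x := by
  rw [OpenPartialHomeomorph.trans_source] at hx
  exact ψ.left_inv hx.2

theorem transition_mapsTo_source :
    MapsTo (φ.symm.trans ψ) (φ.symm.trans ψ).source (ψ.symm.trans φ).source := fun x hx => by
  have h1 := symm_transition hx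
  rw [OpenPartialHomeomorph.trans_source] at hx ⊢
  refine ⟨ψ.map_source hx.2, ?_⟩
  rw [mem_preimage, h1]
  exact φ.map_target hx.1

theorem transition_mapsTo_target : MapsTo (φ.symm.trans ψ) (φ.symm.trans ψ).source ψ.target :=
  fun x hx => transition_source_subset ψ φ (transition_mapsTo_source hx)

/-- A continuous prolongation of the transition map `τ` carries nets converging to `a` to nets
converging to the image of `a`. Their vertices in `M` are unchanged, because `ψ⁻¹ ∘ τ = φ⁻¹`. -/
theorem nets_subset_nets {F : CubeHom (tangentCube K n (φ.symm.trans ψ).source)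
    (tangentCube K n ψ.target)} (hF : ContinuouslyExtends F (φ.symm.trans ψ))
    (hvtx : ∀ (p : ext K (φ.symm.trans ψ).source (Vtx.top n)) ε, vtx _ (val (F.map _ p)) ε
        = Amb.map id (φ.symm.trans ψ) (Vtx.bot n) (vtx _ p.1 ε))
    (a : ext K (φ.symm.trans ψ).source (Vtx.top n)) :
    nets φ a.1 ⊆ nets ψ (val (F.map _ a)) := by
  classical
  rintro _ ⟨u, hu, hufin, rfl⟩
  have hopen := isOpen_ext (K := K) (φ.symm.trans ψ).open_source (Vtx.top n)
  have hmem := eventually_mem_ext (φ.symm.trans ψ).open_source a.2 hu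
  let T : Amb K V (Vtx.top n) → Amb K V (Vtx.top n) := fun y =>
    if h : y ∈ ext K (φ.symm.trans ψ).source (Vtx.top n) then val (F.map _ ⟨y, h⟩) else 0
  have hT : ∀ p : ext K (φ.symm.trans ψ).source (Vtx.top n), T p.1 = val (F.map _ p) :=
    fun p => dif_pos p.2
  have hTc : ContinuousOn T (ext K (φ.symm.trans ψ).source (Vtx.top n)) :=
    continuousOn_iff_continuous_domRestrict.mpr ((hF.1 _).congr fun p => (hT p).symm)
  have hTa := ((hTc.continuousAt (hopen.mem_nhds a.2)).tendsto).comp hu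
  rw [hT a] at hTa
  refine ⟨_, hTa, ?_, ?_⟩
  · filter_upwards [hmem, hufin] with i hi hui
    rw [mem_finExt_iff]
    intro ε
    change vtx _ (T (u i)) ε ∈ _
    rw [hT ⟨u i, hi⟩, hvtx]
    exact groundMap_mem_finExt _ ((mem_finExt_iff _ _).mp hui ε) (mem_univ _)
  · funext ε
    refine Filter.Germ.coe_eq.mpr (hmem.mono fun i hi => ?_)
    change Amb.map id φ.symm _ (vtx _ (u i) ε) = Amb.map id ψ.symm _ (vtx _ (T (u i)) ε)
    rw [hT ⟨u i, hi⟩, hvtx]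
    refine ground_ext n _ _ ?_ ?_
    · rw [groundPt_map, groundPt_map, groundPt_map]
      exact (symm_transition (groundPt_mem_of_mem_ext hi ε)).symm
    · rw [groundScal_map, groundScal_map, groundScal_map]

/-- The prolongation of a transition map does not change the sets of nets. -/
theorem exists_transition [T0Space V] (hK : Dense {t : K | IsUnit t})
    (hφψ : IsC K n (φ.symm.trans ψ).source (φ.symm.trans ψ))
    (hψφ : IsC K n (ψ.symm.trans φ).source (ψ.symm.trans φ)) :
    ∃ F : CubeHom (tangentCube K n (φ.symm.trans ψ).source) (tangentCube K n ψ.target),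
      ContinuouslyExtends F (φ.symm.trans ψ) ∧
      (∀ p : ext K (φ.symm.trans ψ).source (Vtx.bot n), val (F.map (Vtx.bot n) p)
        = Amb.map id (φ.symm.trans ψ) (Vtx.bot n) p.1) ∧
      ∀ (A : Vtx n) (a : ext K (φ.symm.trans ψ).source A),
        scal A (val (F.map A a)) = scal A a.1 ∧
        nets φ (up A a.1) = nets ψ (up A (val (F.map A a))) := by
  obtain ⟨F, hF, hFvtx, hFs⟩ := exists_continuouslyExtends hK (φ.symm.trans ψ).open_source hφψ
    transition_mapsTo_target
  obtain ⟨F', hF', hF'vtx, -⟩ := exists_continuouslyExtends hK (ψ.symm.trans φ).open_source hψφ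
    transition_mapsTo_target
  refine ⟨F, hF, fun p => ?_, fun A a => ⟨hFs A a, ?_⟩⟩
  · simpa only [vtx_bot] using hFvtx (Vtx.bot n) p fun _ => false
  have htop : ∀ a : ext K (φ.symm.trans ψ).source (Vtx.top n),
      nets φ a.1 = nets ψ (val (F.map _ a)) := fun a => by
    have h1 := nets_subset_nets hF (hFvtx _) a
    have hmem : val (F.map _ a) ∈ ext K (ψ.symm.trans φ).source (Vtx.top n) := by
      rw [mem_ext_iff]
      intro ε
      rw [hFvtx, mem_ext_bot, groundPt_map]
      exact transition_mapsTo_source (groundPt_mem_of_mem_ext a.2 ε)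
    -- Going back along the inverse transition leads to a point sharing a net with `a`, hence
    -- inseparable from it and having the same set of nets. That the two prolongations are mutually
    -- inverse is not needed.
    have h2 := nets_subset_nets hF' (hF'vtx _) ⟨_, hmem⟩
    refine Subset.antisymm h1 (h2.trans ?_)
    obtain ⟨x, hx⟩ := nets_nonempty hK φ a.1
    have := inseparable_of_mem_nets (ext_mono (transition_source_subset φ ψ) _ a.2)
      (Subtype.prop (F'.map (Vtx.top n) ⟨_, hmem⟩)) hx (h2 (h1 hx))
    exact (nets_eq_of_inseparable this).symm.subset
  have hup : ∀ (A : Vtx n) (a : ext K (φ.symm.trans ψ).source A),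
      val (F.map (Vtx.top n) ⟨up A a.1, (up_mem_ext A a.1).mpr a.2⟩) = up A (val (F.map A a)) := by
    refine fun A => vtx_induction (P := fun A => ∀ a : ext K (φ.symm.trans ψ).source A,
      val (F.map (Vtx.top n) ⟨up A a.1, (up_mem_ext A a.1).mpr a.2⟩) = up A (val (F.map A a)))
      (fun {B A} e ih b => ?_) (fun a => ?_) A
    · have h1 := ih ⟨oneMap K V e b.1, oneMap_mem e b.1 b.2⟩
      have h2 := congrArg val (F.map_one e b)
      simp only [up_oneMap] at h1
      refine h1.trans ((congrArg (up A) h2).trans ?_)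
      exact up_oneMap e _
    · simp only [up_top]
  rw [← hup, ← htop]

end localCells

/-! ### The `n`-fold tangent groupoid of a manifold -/

section manifold

variable {K V M : Type u} [CommRing K] [AddCommGroup V] [Module K V]
  [TopologicalSpace K] [TopologicalSpace V] [TopologicalSpace M] {n : ℕ}

/-- The cells of the tangent groupoid of a manifold, as pairs of a cell of the point (the scalar
components) and a set of nets: they are generated under products by the cells which belong to a
chart. -/
inductive IsCell (𝒜 : Set (OpenPartialHomeomorph M V)) :
    {A : Vtx n} → Amb K PUnit.{u + 1} A → Set ((Dir n → Bool) → Net K V M n) → Prop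
  | chart {A : Vtx n} (φ : OpenPartialHomeomorph M V) (hφ : φ ∈ 𝒜) (a : Amb K V A)
      (ha : a ∈ ext K φ.target A) : IsCell 𝒜 (scal A a) (nets φ (up A a))
  | comp {B A : Vtx n} (e : Edge B A) {s r : Amb K PUnit.{u + 1} A}
      {X Y : Set ((Dir n → Bool) → Net K V M n)} (hX : IsCell 𝒜 s X) (hY : IsCell 𝒜 r Y)
      (hsr : srcMap K PUnit e s = tgtMap e K PUnit r) (hXY : srcSet e.dir X = tgtSet e.dir Y) :
      IsCell 𝒜 (compMap K PUnit e s r) (mulSet e.dir X Y)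

/-! ### Closure of the generated cells under the structure maps -/

namespace IsCell

variable [IsTopologicalRing K] [IsTopologicalAddGroup V] [ContinuousSMul K V]
  {𝒜 : Set (OpenPartialHomeomorph M V)} {A : Vtx n} {s : Amb K PUnit.{u + 1} A}
  {X : Set ((Dir n → Bool) → Net K V M n)}

theorem isRegular (hK : Dense {t : K | IsUnit t}) (h : IsCell 𝒜 s X) : IsRegular X := by
  induction h with
  | chart φ hφ a ha => exact isRegular_nets hK ((up_mem_ext _ a).mpr ha)
  | comp e _ _ _ hXY hX hY => exact hX.mulSet hY hXY

/-- A cell at `A` is degenerate in every direction outside `A`; this gives the law that the source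
of a unit is the original object. -/
theorem srcSet_self (hK : Dense {t : K | IsUnit t}) (h : IsCell 𝒜 s X) :
    ∀ {C : Vtx n} (e : Edge A C), srcSet e.dir X = X := by
  induction h with
  | chart φ hφ a ha =>
    intro C e
    rw [← up_oneMap e, srcSet_nets_up e hK (oneMap_mem e a ha), srcMap_oneMap, up_oneMap]
  | comp f' hX hY _ hXY ihX ihY =>
    intro C e
    obtain ⟨_, f, e', hF⟩ := exists_face_of_path e f'
    rw [srcSet_mulSet (hF.symm.dir_eq ▸ hF.dir_ne) (hX.isRegular hK) (hY.isRegular hK) hXY,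
      ihX, ihY]

theorem tgtSet_self (hK : Dense {t : K | IsUnit t}) (h : IsCell 𝒜 s X) :
    ∀ {C : Vtx n} (e : Edge A C), tgtSet e.dir X = X := by
  induction h with
  | chart φ hφ a ha =>
    intro C e
    rw [← up_oneMap e, tgtSet_nets_up e hK (oneMap_mem e a ha), tgtMap_oneMap, up_oneMap]
  | comp f' hX hY _ hXY ihX ihY =>
    intro C e
    obtain ⟨_, f, e', hF⟩ := exists_face_of_path e f'
    rw [tgtSet_mulSet (hF.symm.dir_eq ▸ hF.dir_ne) (hX.isRegular hK) (hY.isRegular hK) hXY,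
      ihX, ihY]

theorem one (h : IsCell 𝒜 s X) : ∀ {C : Vtx n} (e : Edge A C),
    IsCell 𝒜 (oneMap K PUnit e s) X := by
  induction h with
  | chart φ hφ a ha =>
    intro C e
    rw [← up_oneMap e, ← scal_oneMap]
    exact .chart φ hφ _ (oneMap_mem e a ha)
  | comp f' hX hY hsr hXY ihX ihY =>
    intro C e
    obtain ⟨_, f, e', hF⟩ := exists_face_of_path e f'
    rw [oneMap_compMap hF, ← hF.symm.dir_eq]
    refine .comp f (ihX e) (ihY e) ?_ (by rwa [hF.symm.dir_eq])
    rw [srcMap_oneMap_face hF.symm, tgtMap_oneMap_face hF.symm, hsr]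

/-- Along the edge of a product, the source is that of the right factor. Across it, the source is
the product of the sources, which remain composable because sources and targets in different
directions commute on regular sets. -/
theorem src (hK : Dense {t : K | IsUnit t}) (h : IsCell 𝒜 s X) : ∀ {B : Vtx n} (e : Edge B A),
    IsCell 𝒜 (srcMap K PUnit e s) (srcSet e.dir X) := by
  induction h with
  | chart φ hφ a ha =>
    intro B e
    rw [srcSet_nets_up e hK ha, ← scal_srcMap]
    exact .chart φ hφ _ (srcMap_mem e a ha)
  | @comp C A f s r X Y hX hY hsr hXY ihX ihY =>
    intro B e
    by_cases hBC : B = C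
    · subst hBC
      obtain rfl := Edge.eq_of_same_ends e f
      rw [srcMap_compMap, srcSet_mulSet_self ((hY.isRegular hK).isCoset _) hXY]
      exact ihY e
    · obtain ⟨_, f', e', hF⟩ := exists_face_of_ne e f hBC
      have hd := hF.symm.dir_eq
      rw [srcMap_compMap_face hF, srcSet_mulSet hF.dir_ne (hX.isRegular hK) (hY.isRegular hK) hXY,
        hd]
      refine .comp f' (ihX e) (ihY e) ?_ ?_
      · rw [srcMap_srcMap hF, hsr, srcMap_tgtMap hF.symm]
      · rw [← hd, srcSet_srcSet hF.dir_ne (hX.isRegular hK), hXY,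
          srcSet_tgtSet hF.symm.dir_ne (hY.isRegular hK)]

theorem inv (hK : Dense {t : K | IsUnit t}) (h : IsCell 𝒜 s X) : ∀ {B : Vtx n} (e : Edge B A),
    IsCell 𝒜 (invMap e K PUnit s) (invSet e.dir X) := by
  induction h with
  | chart φ hφ a ha =>
    intro B e
    rw [invSet_nets_up e, ← scal_invMap]
    exact .chart φ hφ _ (invMap_mem e a ha)
  | @comp C A f s r X Y hX hY hsr hXY ihX ihY =>
    intro B e
    by_cases hBC : B = C
    · subst hBC
      obtain rfl := Edge.eq_of_same_ends e f
      rw [invMap_compMap_self e hsr, invSet_mulSet_self]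
      refine .comp e (ihY e) (ihX e) ?_ ?_
      · rw [srcMap_invMap, tgtMap_invMap, hsr]
      · rw [srcSet_invSet_self, tgtSet_invSet_self, hXY]
    · obtain ⟨_, f', e', hF⟩ := exists_face_of_ne e f hBC
      rw [invMap_compMap_face hF hsr, invSet_mulSet hF.dir_ne.symm]
      refine .comp f (ihX e) (ihY e) ?_ ?_
      · rw [srcMap_invMap_face hF.symm, tgtMap_invMap_face hF.symm, hsr]
      · rw [srcSet_invSet hF.symm.dir_ne, tgtSet_invSet hF.symm.dir_ne, hXY]

theorem tgt (hK : Dense {t : K | IsUnit t}) (h : IsCell 𝒜 s X) {B : Vtx n} (e : Edge B A) :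
    IsCell 𝒜 (tgtMap e K PUnit s) (tgtSet e.dir X) := by
  rw [← srcMap_invMap, ← srcSet_invSet_self]
  exact (h.inv hK e).src hK e

/-- Where no edge ends there are no products; in particular, every object belongs to a chart. -/
theorem exists_chart (h : IsCell 𝒜 s X) (hA : ∀ B, Edge B A → False) :
    ∃ φ ∈ 𝒜, ∃ a ∈ ext K φ.target A, s = scal A a ∧ X = nets φ (up A a) := by
  cases h with
  | chart φ hφ a ha => exact ⟨φ, hφ, a, ha, rfl, rfl⟩
  | comp e _ _ _ _ => exact (hA _ e).elim

end IsCell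

variable [IsTopologicalRing K] [IsTopologicalAddGroup V] [ContinuousSMul K V]
  (𝒜 : Set (OpenPartialHomeomorph M V))

/-- The `n`-fold tangent groupoid of a manifold. -/
def tangentGroupoid (hK : Dense {t : K | IsUnit t}) (n : ℕ) : CubeData.{u} n where
  cell A := {p : Amb K PUnit.{u + 1} A × Set ((Dir n → Bool) → Net K V M n) // IsCell 𝒜 p.1 p.2}
  src e p := ⟨(srcMap K PUnit e p.1.1, srcSet e.dir p.1.2), p.2.src hK e⟩
  tgt e p := ⟨(tgtMap e K PUnit p.1.1, tgtSet e.dir p.1.2), p.2.tgt hK e⟩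
  one e p := ⟨(oneMap K PUnit e p.1.1, p.1.2), p.2.one e⟩
  inv e p := ⟨(invMap e K PUnit p.1.1, invSet e.dir p.1.2), p.2.inv hK e⟩
  comp e p q h := ⟨(compMap K PUnit e p.1.1 q.1.1, mulSet e.dir p.1.2 q.1.2), .comp e p.2 q.2
    (congrArg (fun r => r.1.1) h) (congrArg (fun r => r.1.2) h)⟩

theorem tangentGroupoid_isNFoldGroupoid (hK : Dense {t : K | IsUnit t}) (n : ℕ) :
    (tangentGroupoid 𝒜 hK n).IsNFoldGroupoid where
  src_comp e a b h := Subtype.ext (Prod.ext (srcMap_compMap _ _ _ _ _)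
    (srcSet_mulSet_self ((b.2.isRegular hK).isCoset _) (congrArg (fun r => r.1.2) h)))
  tgt_comp e a b h := Subtype.ext (Prod.ext
    (tgtMap_compMap _ _ _ _ _ (congrArg (fun r => r.1.1) h))
    (tgtSet_mulSet_self ((a.2.isRegular hK).isCoset _) (congrArg (fun r => r.1.2) h)))
  assoc e a b c _ _ _ _ := Subtype.ext (Prod.ext (compMap_assoc _ _ _ _ _ _)
    (mulSet_assoc _ _ _ _))
  src_one e x := Subtype.ext (Prod.ext (srcMap_oneMap _ _ _ _) (x.2.srcSet_self hK e))
  tgt_one e x := Subtype.ext (Prod.ext (tgtMap_oneMap _ _ _ _) (x.2.tgtSet_self hK e))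
  comp_one e a _ := Subtype.ext (Prod.ext (compMap_one_src _ _ _ _)
    ((a.2.isRegular hK).isCoset _).mul_srcSet)
  one_comp e a _ := Subtype.ext (Prod.ext (compMap_one_left _ _ _ _ _)
    ((a.2.isRegular hK).isCoset _).tgtSet_mul)
  src_inv e a := Subtype.ext (Prod.ext (srcMap_invMap _ _ _ _) (srcSet_invSet_self _ _))
  tgt_inv e a := Subtype.ext (Prod.ext (tgtMap_invMap _ _ _ _) (tgtSet_invSet_self _ _))
  comp_inv e a _ := Subtype.ext (Prod.ext (compMap_invMap _ _ _ _) rfl)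
  inv_comp e a _ := Subtype.ext (Prod.ext (invMap_compMap _ _ _ _) rfl)
  src_src e f f' e' h a := by
    have hF := face_of_ne e f f' e' h
    refine Subtype.ext (Prod.ext (srcMap_srcMap hF _ _ _) ?_)
    change srcSet f'.dir (srcSet e.dir a.1.2) = srcSet e'.dir (srcSet f.dir a.1.2)
    rw [← hF.dir_eq, ← hF.symm.dir_eq]
    exact srcSet_srcSet hF.dir_ne (a.2.isRegular hK)
  src_tgt e f f' e' h a := by
    have hF := face_of_ne e f f' e' h
    refine Subtype.ext (Prod.ext (srcMap_tgtMap hF _ _ _) ?_)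
    change srcSet f'.dir (tgtSet e.dir a.1.2) = tgtSet e'.dir (srcSet f.dir a.1.2)
    rw [← hF.dir_eq, ← hF.symm.dir_eq]
    exact srcSet_tgtSet hF.dir_ne (a.2.isRegular hK)
  tgt_tgt e f f' e' h a := by
    have hF := face_of_ne e f f' e' h
    refine Subtype.ext (Prod.ext (tgtMap_tgtMap hF _ _ _) ?_)
    change tgtSet f'.dir (tgtSet e.dir a.1.2) = tgtSet e'.dir (tgtSet f.dir a.1.2)
    rw [← hF.dir_eq, ← hF.symm.dir_eq]
    exact tgtSet_tgtSet hF.dir_ne (a.2.isRegular hK)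
  src_unit e f f' e' h c := by
    have hF := face_of_ne e f f' e' h
    exact Subtype.ext (Prod.ext (srcMap_oneMap_face hF _ _ _)
      (congrArg (fun i => srcSet i c.1.2) hF.dir_eq))
  tgt_unit e f f' e' h c := by
    have hF := face_of_ne e f f' e' h
    exact Subtype.ext (Prod.ext (tgtMap_oneMap_face hF _ _ _)
      (congrArg (fun i => tgtSet i c.1.2) hF.dir_eq))
  src_mul e f f' e' hBC a b h _ := by
    have hF := face_of_ne e f f' e' hBC
    refine Subtype.ext (Prod.ext (srcMap_compMap_face hF _ _ _ _) ?_)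
    refine (srcSet_mulSet hF.dir_ne (a.2.isRegular hK) (b.2.isRegular hK)
      (congrArg (fun r => r.1.2) h)).trans ?_
    rw [hF.symm.dir_eq]
    rfl
  tgt_mul e f f' e' hBC a b h _ := by
    have hF := face_of_ne e f f' e' hBC
    refine Subtype.ext (Prod.ext
      (tgtMap_compMap_face hF _ _ _ _ (congrArg (fun r => r.1.1) h)) ?_)
    refine (tgtSet_mulSet hF.dir_ne (a.2.isRegular hK) (b.2.isRegular hK)
      (congrArg (fun r => r.1.2) h)).trans ?_
    rw [hF.symm.dir_eq]
    rfl
  one_one e f f' e' h d := Subtype.ext (Prod.ext (oneMap_oneMap (face_of_ne e f f' e' h) _ _ _) rfl)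
  one_mul e f f' e' h a b _ _ := by
    have hF := face_of_ne e f f' e' h
    exact Subtype.ext (Prod.ext (oneMap_compMap hF _ _ _ _)
      (congrArg (fun i => mulSet i a.1.2 b.1.2) hF.symm.dir_eq.symm))
  interchange e f f' e' h a b c d hac hbd hab hcd _ _ := by
    have hF := face_of_ne e f f' e' h
    exact Subtype.ext (Prod.ext (compMap_compMap hF _ _ _ _ _ _)
      (mulSet_interchange hF.dir_ne (c.2.isRegular hK) (b.2.isRegular hK) (d.2.isRegular hK)
        (congrArg (fun r => r.1.2) hab) (congrArg (fun r => r.1.2) hcd)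
        (congrArg (fun r => r.1.2) hac) (congrArg (fun r => r.1.2) hbd)))

variable {𝒜}

/-- The inclusion of the `n`-fold groupoid of a chart. -/
def chartHom (hK : Dense {t : K | IsUnit t}) (φ : 𝒜) :
    CubeHom (tangentCube K n φ.1.target) (tangentGroupoid 𝒜 hK n) where
  map A a := ⟨(scal A a.1, nets φ.1 (up A a.1)), .chart φ.1 φ.2 a.1 a.2⟩
  map_src e a := Subtype.ext (Prod.ext (scal_srcMap e a.1) (srcSet_nets_up e hK a.2).symm)
  map_tgt e a := Subtype.ext (Prod.ext (scal_tgtMap e a.1) (tgtSet_nets_up e hK a.2).symm)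
  map_one e b := Subtype.ext (Prod.ext (scal_oneMap e b.1)
    (congrArg (nets φ.1) (up_oneMap e b.1)))
  map_comp e a b h _ := Subtype.ext (Prod.ext (scal_compMap e a.1 b.1)
    (mulSet_nets_up e hK a.2 b.2 (congrArg Subtype.val h)).symm)

theorem chartHom_inv (hK : Dense {t : K | IsUnit t}) (φ : 𝒜) {B A : Vtx n} (e : Edge B A)
    (a : (tangentCube K n φ.1.target).cell A) :
    (tangentGroupoid 𝒜 hK n).inv e ((chartHom hK φ).map A a)
      = (chartHom hK φ).map A ((tangentCube K n φ.1.target).inv e a) :=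
  Subtype.ext (Prod.ext (scal_invMap a.1).symm (invSet_nets_up e a.1))

theorem chartHom_injective [T0Space V] (hK : Dense {t : K | IsUnit t}) (φ : 𝒜) (A : Vtx n) :
    Function.Injective ((chartHom hK φ).map A) := fun a b h =>
  Subtype.ext (eq_of_nets_eq hK a.2 b.2 (congrArg (fun r => r.1.2) h)
    (congrArg (fun r => r.1.1) h))

/-- The tangent groupoid is generated by the groupoids of the charts. -/
theorem tangentGroupoid_generated (hK : Dense {t : K | IsUnit t})
    (S : ∀ A : Vtx n, Set ((tangentGroupoid 𝒜 hK n).cell A)) (hS : (tangentGroupoid 𝒜 hK n).IsSub S)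
    (hc : ∀ (φ : 𝒜) (A : Vtx n), range ((chartHom hK φ).map A) ⊆ S A) (A : Vtx n) :
    S A = univ := by
  have key : ∀ {A : Vtx n} {s : Amb K PUnit.{u + 1} A} {X : Set ((Dir n → Bool) → Net K V M n)}
      (h : IsCell 𝒜 s X), (⟨(s, X), h⟩ : (tangentGroupoid 𝒜 hK n).cell A) ∈ S A := fun h => by
    induction h with
    | chart φ hφ a ha => exact hc ⟨φ, hφ⟩ _ ⟨⟨a, ha⟩, rfl⟩
    | comp e hX hY hsr hXY ihX ihY =>
      exact hS.comp_mem e _ ihX _ ihY (Subtype.ext (Prod.ext hsr hXY))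
  exact eq_univ_of_forall fun p => key p.2

theorem isSub_range_chartHom [T0Space V] (hK : Dense {t : K | IsUnit t}) (φ : 𝒜) :
    (tangentGroupoid 𝒜 hK n).IsSub fun A => range ((chartHom hK φ).map A) where
  src_mem e := by rintro _ ⟨a, rfl⟩; exact ⟨_, (chartHom hK φ).map_src e a⟩
  tgt_mem e := by rintro _ ⟨a, rfl⟩; exact ⟨_, (chartHom hK φ).map_tgt e a⟩
  one_mem e := by rintro _ ⟨a, rfl⟩; exact ⟨_, (chartHom hK φ).map_one e a⟩
  inv_mem e := by rintro _ ⟨a, rfl⟩; exact ⟨_, (chartHom_inv hK φ e a).symm⟩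
  comp_mem e := by
    rintro _ ⟨a, rfl⟩ _ ⟨b, rfl⟩ h
    have h' : (tangentCube K n φ.1.target).src e a = (tangentCube K n φ.1.target).tgt e b := by
      refine chartHom_injective hK φ _ ?_
      rw [(chartHom hK φ).map_src, (chartHom hK φ).map_tgt, h]
    exact ⟨_, (chartHom hK φ).map_comp e a b h' h⟩

/-! ### Objects -/

theorem continuous_groundPt : ∀ n : ℕ, Continuous (groundPt K V n)
  | 0 => continuous_id
  | n + 1 => (continuous_groundPt n).comp (continuous_fst (X := Amb K V (Vtx.bot n)) (Y := K))

theorem groundScal_scal : ∀ (n : ℕ) (p : Amb K V (Vtx.bot n)),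
    groundScal K PUnit.{u + 1} n (scal (Vtx.bot n) p) = groundScal K V n p
  | 0 => fun _ => rfl
  | n + 1 => fun (p, t) => by
    change Fin.snoc (α := fun _ => K) (groundScal K PUnit.{u + 1} n (scal (Vtx.bot n) p)) t
      = Fin.snoc (α := fun _ => K) (groundScal K V n p) t
    rw [groundScal_scal n p]

theorem scal_bot_eq_iff {p q : Amb K V (Vtx.bot n)} : scal (Vtx.bot n) p = scal (Vtx.bot n) q ↔
    groundScal K V n p = groundScal K V n q := by
  refine ⟨fun h => ?_, fun h => ground_ext n _ _ rfl ?_⟩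
  · rw [← groundScal_scal, h, groundScal_scal]
  · rw [groundScal_scal, groundScal_scal, h]

/-- The vertices of a common net converge in `M` to the corresponding vertices of both cells, and
limits in a Hausdorff space are unique. -/
theorem ground_eq_of_mem_nets [T2Space M] {φ ψ : OpenPartialHomeomorph M V}
    {a b : Amb K V (Vtx.top n)} (ha : a ∈ ext K φ.target (Vtx.top n))
    (hb : b ∈ ext K ψ.target (Vtx.top n)) {x : (Dir n → Bool) → Net K V M n}
    (hxa : x ∈ nets φ a) (hxb : x ∈ nets ψ b) (ε : Dir n → Bool) :
    φ.symm (groundPt K V n (vtx _ a ε)) = ψ.symm (groundPt K V n (vtx _ b ε)) := by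
  have key : ∀ {φ : OpenPartialHomeomorph M V} {a : Amb K V (Vtx.top n)}
      {u : Scale K V n → Amb K V (Vtx.top n)}, a ∈ ext K φ.target (Vtx.top n) →
      Filter.Tendsto u (fine K V n) (𝓝 a) →
      Filter.Tendsto (fun i => φ.symm (groundPt K V n (vtx _ (u i) ε))) (fine K V n)
        (𝓝 (φ.symm (groundPt K V n (vtx _ a ε)))) := fun {φ a u} ha hu =>
    (φ.symm.continuousAt (groundPt_mem_of_mem_ext ha ε)).tendsto.comp
      ((((continuous_groundPt n).comp (continuous_vtx _ ε)).tendsto a).comp hu)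
  obtain ⟨u, hu, -, rfl⟩ := hxa
  obtain ⟨v, hv, -, hxv⟩ := hxb
  refine tendsto_nhds_unique (key ha hu) ((key hb hv).congr' ?_)
  filter_upwards [Filter.Germ.coe_eq.mp (congrFun hxv ε)] with i hi
  simpa [groundPt_map] using congrArg (groundPt K M n) hi.symm

theorem nets_eq_iff_ground [T0Space V] [T2Space M] (hK : Dense {t : K | IsUnit t})
    (h𝒜 : IsAtlas K n 𝒜) (φ ψ : 𝒜) (p : ext K φ.1.target (Vtx.bot n))
    (q : ext K ψ.1.target (Vtx.bot n)) :
    (chartHom hK φ).map (Vtx.bot n) p = (chartHom hK ψ).map (Vtx.bot n) q ↔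
      φ.1.symm (groundPt K V n p.1) = ψ.1.symm (groundPt K V n q.1) ∧
        groundScal K V n p.1 = groundScal K V n q.1 := by
  refine ⟨fun h => ⟨?_, ?_⟩, fun ⟨h, hs⟩ => ?_⟩
  · have hnets : nets φ.1 (up _ p.1) = nets ψ.1 (up _ q.1) := congrArg (fun r => r.1.2) h
    obtain ⟨x, hx⟩ := nets_nonempty hK φ.1 (up _ p.1)
    have := ground_eq_of_mem_nets ((up_mem_ext _ _).mpr p.2) ((up_mem_ext _ _).mpr q.2) hx
      (hnets ▸ hx) fun _ => false
    simpa only [vtx_up, vtx_bot] using this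
  · exact scal_bot_eq_iff.mp (congrArg (fun r => r.1.1) h)
  · obtain ⟨F, -, hFbot, hF⟩ := exists_transition (n := n) hK (h𝒜.isC_transition φ.1 φ.2 ψ.1 ψ.2)
      (h𝒜.isC_transition ψ.1 ψ.2 φ.1 φ.2)
    have hp := (mem_ext_bot n p.1).mp p.2
    have hq := (mem_ext_bot n q.1).mp q.2
    have hmem : p.1 ∈ ext K (φ.1.symm.trans ψ.1).source (Vtx.bot n) := by
      rw [mem_ext_bot, OpenPartialHomeomorph.trans_source]
      refine ⟨hp, ?_⟩
      rw [mem_preimage, h]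
      exact ψ.1.map_target hq
    -- On objects the prolonged transition map is `τ × id`, so it takes `p` to `q`; invariance of
    -- sets of nets under transition then identifies the two cells.
    have hFq : val (F.map (Vtx.bot n) ⟨p.1, hmem⟩) = q.1 := by
      rw [hFbot]
      refine ground_ext n _ _ ?_ ?_
      · rw [groundPt_map]
        change ψ.1 (φ.1.symm (groundPt K V n p.1)) = _
        rw [h, ψ.1.right_inv hq]
      · rw [groundScal_map, hs]
    have := (hF (Vtx.bot n) ⟨p.1, hmem⟩).2
    rw [hFq] at this
    exact Subtype.ext (Prod.ext (scal_bot_eq_iff.mpr hs) this)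

/-- The objects of the tangent groupoid. -/
theorem exists_base [T0Space V] [T2Space M] (hK : Dense {t : K | IsUnit t}) (h𝒜 : IsAtlas K n 𝒜) :
    ∃ base : (tangentGroupoid 𝒜 hK n).cell (Vtx.bot n) ≃ M × (Fin n → K),
      ∀ (φ : 𝒜) (p : ext K φ.1.target (Vtx.bot n)), base ((chartHom hK φ).map (Vtx.bot n) p)
        = (φ.1.symm (groundPt K V n p), groundScal K V n p) := by
  choose φ hφ hx using h𝒜.exists_mem_source
  have hex : ∀ z : M × (Fin n → K), ∃ p : ext K (φ z.1).target (Vtx.bot n),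
      groundPt K V n p.1 = φ z.1 z.1 ∧ groundScal K V n p.1 = z.2 := fun z => by
    obtain ⟨p, hp, hp'⟩ := exists_ground n (φ z.1 z.1) z.2
    exact ⟨⟨p, (mem_ext_bot n p).mpr (hp ▸ (φ z.1).map_source (hx z.1))⟩, hp, hp'⟩
  choose p hp hp' using hex
  let g : M × (Fin n → K) → (tangentGroupoid 𝒜 hK n).cell (Vtx.bot n) := fun z =>
    (chartHom hK ⟨φ z.1, hφ z.1⟩).map (Vtx.bot n) (p z)
  have hg : ∀ (ψ : 𝒜) (q : ext K ψ.1.target (Vtx.bot n)) (z : M × (Fin n → K)),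
      (chartHom hK ψ).map (Vtx.bot n) q = g z ↔
        (ψ.1.symm (groundPt K V n q.1), groundScal K V n q.1) = z := fun ψ q z => by
    refine (nets_eq_iff_ground hK h𝒜 ψ ⟨φ z.1, hφ z.1⟩ q (p z)).trans ?_
    rw [hp, hp', (φ z.1).left_inv (hx z.1), Prod.ext_iff]
  have hbij : Function.Bijective g := by
    refine ⟨fun z z' h => ?_, fun c => ?_⟩
    · rw [← (hg _ _ z).mp rfl, (hg _ _ z').mp h]
    · obtain ⟨ψ, hψ, q, hq, h1, h2⟩ := c.2.exists_chart fun B e => Vtx.isEmpty_edge_bot e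
      refine ⟨_, ((hg ⟨ψ, hψ⟩ ⟨q, hq⟩ _).mpr rfl).symm.trans ?_⟩
      exact Subtype.ext (Prod.ext h1.symm h2.symm)
  refine ⟨(Equiv.ofBijective g hbij).symm, fun ψ q => ?_⟩
  rw [Equiv.symm_apply_eq]
  exact (hg ψ q _).mpr rfl

/-- Translation moves inseparable points of `V` into the image of a chart, whose inverse embeds that
image into the Hausdorff space `M`. -/
theorem t0Space_of_chart [T2Space M] [Nonempty M] (h𝒜 : IsAtlas K n 𝒜) : T0Space V := by
  obtain ⟨x⟩ := ‹Nonempty M›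
  obtain ⟨φ, -, hx⟩ := h𝒜.exists_mem_source x
  refine ⟨fun v w h => ?_⟩
  have hv : φ x ∈ φ.target := φ.map_source hx
  have hins : Inseparable (φ x) (φ x + (w - v)) := by
    have := (h.map (f := fun z => φ x + (z - v)) (by fun_prop))
    simpa using this
  have hw : φ x + (w - v) ∈ φ.target := (hins.mem_open_iff φ.open_target).mp hv
  have h1 : Inseparable (φ.symm (φ x)) (φ.symm (φ x + (w - v))) :=
    hins.map_of_continuousAt (φ.symm.continuousAt hv) (φ.symm.continuousAt hw)
  have h2 := φ.symm.injOn hv hw h1.eq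
  rw [left_eq_add, sub_eq_zero] at h2
  exact h2.symm

/-- For the last clause, the cells of a global chart are closed under all structure maps and contain
those of every other chart via the transition maps; since the charts generate, they are all the
cells. -/
theorem isTangentGroupoid_tangentGroupoid [T0Space V] (hK : Dense {t : K | IsUnit t})
    (h𝒜 : IsAtlas K n 𝒜) (base : (tangentGroupoid 𝒜 hK n).cell (Vtx.bot n) ≃ M × (Fin n → K))
    (hbase : ∀ (φ : 𝒜) (p : ext K φ.1.target (Vtx.bot n)),
      base ((chartHom hK φ).map (Vtx.bot n) p)
        = (φ.1.symm (groundPt K V n p), groundScal K V n p)) :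
    IsTangentGroupoid 𝒜 (tangentGroupoid 𝒜 hK n) base (chartHom hK) := by
  have hcompat : ∀ φ ψ : 𝒜, ∃ T : CubeHom (tangentCube K n (φ.1.symm.trans ψ.1).source)
      (tangentCube K n ψ.1.target), ContinuouslyExtends T (φ.1.symm.trans ψ.1) ∧
      ∀ (A : Vtx n) (p : ext K (φ.1.symm.trans ψ.1).source A),
        (chartHom hK φ).map A ⟨p.1, ext_mono (transition_source_subset φ.1 ψ.1) A p.2⟩
          = (chartHom hK ψ).map A (T.map A p) := fun φ ψ => by
    obtain ⟨F, hF, -, h⟩ := exists_transition hK (h𝒜.isC_transition φ.1 φ.2 ψ.1 ψ.2)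
      (h𝒜.isC_transition ψ.1 ψ.2 φ.1 φ.2)
    exact ⟨F, hF, fun A p => Subtype.ext (Prod.ext (h A p).1.symm (h A p).2)⟩
  refine ⟨tangentGroupoid_isNFoldGroupoid 𝒜 hK n, hbase, chartHom_injective hK, hcompat,
    tangentGroupoid_generated hK, fun φ hφ A => ⟨chartHom_injective hK φ A, ?_⟩⟩
  rw [← range_eq_univ]
  refine tangentGroupoid_generated hK _ (isSub_range_chartHom hK φ) (fun ψ A => ?_) A
  rintro _ ⟨a, rfl⟩
  obtain ⟨T, -, hT⟩ := hcompat ψ φ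
  have hsub : ψ.1.target ⊆ (ψ.1.symm.trans φ.1).source := fun x hx => by
    rw [OpenPartialHomeomorph.trans_source, hφ]
    exact ⟨hx, mem_univ _⟩
  exact ⟨_, (hT A ⟨a.1, ext_mono hsub A a.2⟩).symm⟩

/-! ### The empty manifold and the general case -/

/-- The empty `n`-fold groupoid. -/
def emptyCube (n : ℕ) : CubeData.{u} n where
  cell _ := PEmpty
  src _ := PEmpty.elim
  tgt _ := PEmpty.elim
  one _ := PEmpty.elim
  inv _ := PEmpty.elim
  comp _ a _ _ := a

theorem isEmpty_ext_of_isEmpty {U : Set V} (hU : U = ∅) (A : Vtx n) : IsEmpty (ext K U A) :=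
  ⟨fun p => by
    have := groundPt_mem_of_mem_ext p.2 fun _ => false
    exact notMem_empty _ (hU.subset this)⟩

theorem exists_isTangentGroupoid_of_isEmpty [IsEmpty M] (𝒜 : Set (OpenPartialHomeomorph M V)) :
    ∃ (G : CubeData.{u} n) (base : G.cell (Vtx.bot n) ≃ M × (Fin n → K))
      (ι : ∀ φ : 𝒜, CubeHom (tangentCube K n φ.1.target) G), IsTangentGroupoid 𝒜 G base ι := by
  have htarget : ∀ φ : OpenPartialHomeomorph M V, φ.target = ∅ := fun φ =>
    eq_empty_of_forall_notMem fun x _ => isEmptyElim (φ.symm x)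
  have hE : ∀ (φ : OpenPartialHomeomorph M V) (A : Vtx n), IsEmpty (ext K φ.target A) :=
    fun φ A => isEmpty_ext_of_isEmpty (htarget φ) A
  have hE' : ∀ (φ ψ : OpenPartialHomeomorph M V) (A : Vtx n),
      IsEmpty (ext K (φ.symm.trans ψ).source A) := fun φ ψ A =>
    isEmpty_ext_of_isEmpty (subset_empty_iff.mp ((transition_source_subset φ ψ).trans
      (htarget φ).subset)) A
  have hom : ∀ (U : Set V) (G : CubeData.{u} n) (_ : ∀ A : Vtx n, IsEmpty (ext K U A)),
      Nonempty (CubeHom (tangentCube K n U) G) := fun U G h =>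
    ⟨⟨fun A a => ((h A).false a).elim, fun e a => ((h _).false a).elim,
      fun e a => ((h _).false a).elim, fun e a => ((h _).false a).elim,
      fun e a => ((h _).false a).elim⟩⟩
  have hs : ∀ A, Subsingleton ((emptyCube n).cell A) := fun A => inferInstanceAs (Subsingleton PEmpty)
  refine ⟨emptyCube n, (Equiv.equivOfIsEmpty PEmpty _ : PEmpty.{u + 1} ≃ _), fun φ =>
    (hom _ (emptyCube n) (hE φ.1)).some, ?_, fun φ p => ((hE φ.1 _).false p).elim,
    fun φ A a => ((hE φ.1 _).false a).elim, fun φ ψ => ?_, fun S _ _ A => ?_, fun φ _ A => ?_⟩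
  · constructor <;> intros <;> exact (hs _).elim _ _
  · obtain ⟨T⟩ := hom _ (tangentCube K n ψ.1.target) (hE' φ.1 ψ.1)
    refine ⟨T, ⟨fun A => ?_, fun A p => ((hE' φ.1 ψ.1 _).false p).elim⟩,
      fun A p => ((hE' φ.1 ψ.1 _).false p).elim⟩
    have := hE' φ.1 ψ.1 A
    exact continuous_of_discreteTopology
  · exact eq_univ_of_forall fun a => (a : PEmpty).elim
  · exact ⟨fun a => ((hE φ.1 _).false a).elim, fun a => (a : PEmpty).elim⟩

/-- The empty manifold is treated apart, since it puts no separation condition on `V`, which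
injectivity of the chart inclusions otherwise uses. -/
theorem exists_isTangentGroupoid [T2Space M] (hK : Dense {t : K | IsUnit t})
    (h𝒜 : IsAtlas K n 𝒜) :
    ∃ (G : CubeData.{u} n) (base : G.cell (Vtx.bot n) ≃ M × (Fin n → K))
      (ι : ∀ φ : 𝒜, CubeHom (tangentCube K n φ.1.target) G), IsTangentGroupoid 𝒜 G base ι := by
  cases isEmpty_or_nonempty M
  · exact exists_isTangentGroupoid_of_isEmpty 𝒜
  · have := t0Space_of_chart h𝒜
    obtain ⟨base, hbase⟩ := exists_base hK h𝒜
    exact ⟨_, base, _, isTangentGroupoid_tangentGroupoid hK h𝒜 base hbase⟩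

end manifold

end FullCubic

open FullCubic in
theorem theorem5p5 (K : Type u) [CommRing K] [TopologicalSpace K] [IsTopologicalRing K]
    (hK : Dense {t : K | IsUnit t}) (n : ℕ) :
    (∀ (V W : Type u)
        [AddCommGroup V] [Module K V] [TopologicalSpace V] [IsTopologicalAddGroup V]
        [ContinuousSMul K V]
        [AddCommGroup W] [Module K W] [TopologicalSpace W] [IsTopologicalAddGroup W]
        [ContinuousSMul K W] [T2Space W]
        (U : Set V) (_ : IsOpen U) (f : V → W),
        IsC K n U f ↔
          ∃ F : CubeHom (tangentCube K n U) (tangentCube K n (Set.univ : Set W)),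
            ContinuouslyExtends F f) ∧
    (∀ (V M : Type u)
        [AddCommGroup V] [Module K V] [TopologicalSpace V] [IsTopologicalAddGroup V]
        [ContinuousSMul K V]
        [TopologicalSpace M] [T2Space M]
        (𝒜 : Set (OpenPartialHomeomorph M V)) (_ : IsAtlas K n 𝒜),
        ∃ (G : CubeData.{u} n) (base : G.cell (Vtx.bot n) ≃ M × (Fin n → K))
          (ι : ∀ φ : 𝒜, CubeHom (tangentCube K n φ.1.target) G),
          IsTangentGroupoid 𝒜 G base ι) := by
  exact ⟨fun V W _ _ _ _ _ _ _ _ _ _ _ U hU f => isC_iff hK hU f,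
    fun V M _ _ _ _ _ _ _ 𝒜 h𝒜 => exists_isTangentGroupoid hK h𝒜⟩
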